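/- Throughout, everything is over $\mathbb C$ and $p$ denotes parity. Let $\mathfrak g$ be a simple finite-dimensional Lie superalgebra with a nondegenerate even supersymmetric invariant bilinear form $(\cdot|\cdot)$, let $h^\vee$ be its dual Coxeter number (half the eigenvalue of the Casimir operator $\sum_i(-1)^{p(a_i)}a_ia^i$, $(a_i|a^j)=\delta_{ij}$, on the adjoint representation), and let $k\in\mathbb C$ with $k+h^\vee\ne0$. Let $x,f\in\mathfrak g$ be even elements such that * (A1) $\operatorname{ad}x$ is diagonalizable with eigenvalues in $\frac12\mathbb Z$; let $\mathfrak g_j$ be its eigenspaces and $\mathfrak g_+=\bigoplus_{j>0}\mathfrak g_j$; * (A2) $[x,f]=-f$; * (A3) $\operatorname{ad}f:\mathfrak g_{1/2}\to\mathfrak g_{-1/2}$ is an isomorphism. Let $A_{\rm ne}=\mathfrak g_{1/2}$ with the form $\langle a,b\rangle=(f|[a,b])$, and $A_{\rm ch}=\Pi\mathfrak g_+\oplus\Pi\mathfrak g_+^*$ ($\Pi$ reverses parity) with the skew-supersymmetric form for which both summands are isotropic and $\langle a,b^*\rangle=b^*(a)$. Let $U_k$ be the associative superalgebra generated by elements $at^n$,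 linear in $a\in\mathfrak g\oplus A_{\rm ch}\oplus A_{\rm ne}$, $n\in\mathbb Z$, with supercommutators $[at^m,bt^n]=[a,b]t^{m+n}+m\,\delta_{m,-n}(a|b)k$ for $a,b\in\mathfrak g$, $[at^m,bt^n]=\delta_{m,-n-1}\langle a,b\rangle$ for $a,b$ both in $A_{\rm ch}$ or both in $A_{\rm ne}$, and zero supercommutators between different summands. Let $U_k^{\rm com}$ be its completion with respect to the left ideals generated by the $at^n$ with $n\ge N$. To $a$ corresponds the $U_k^{\rm com}$-valued field $a(z)=\sum_n(at^n)z^{-n-1}$. The $n$-th products of fields are $a_{(n)}b=\operatorname{Res}_w(w-z)^n[a(w),b(z)]$ and $a_{(-n-1)}b={:}(\partial^na)b{:}/n!$ for $n\ge0$, and $[a_\lambda b]=\sum_{n\ge0}\frac{\lambda^n}{n!}a_{(n)}b$. Let $\mathcal C$ be the smallest space of fields containing $1$ and all the fields $a(z)$ and closed under $\partial$ and all $n$-th products, and let $\mathcal C=\bigoplus_m\mathcal C_m$ be its charge decomposition, where the fields from $\Pi\mathfrak g_+$, $\Pi\mathfrak g_+^*$, $\mathfrak g$, $A_{\rm ne}$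 have charge $1,-1,0,0$. Let $\{u_i\}_{i\in\tilde S}$ be a parity-homogeneous basis of $\mathfrak g$ with $[x,u_i]=m_iu_i$, $S=\{i:m_i>0\}$, $S'=\{i:m_i=\frac12\}$, $[u_i,u_j]=\sum_\ell c_{ij}^\ell u_\ell$, and let $\{u^i\}$ be the dual basis, $(u_i|u^j)=\delta_{ij}$. Let $\varphi_i,\varphi_i^*$ $(i\in S)$ be the corresponding dual bases of $\Pi\mathfrak g_+,\Pi\mathfrak g_+^*$, let $\Phi_i$ $(i\in S')$ be the corresponding basis of $A_{\rm ne}$, and let $\Phi^i$ be its dual basis, $\langle\Phi_i,\Phi^j\rangle=\delta_{ij}$. Put $$d=\sum_{i\in S}(-1)^{p(u_i)}u_i\varphi_i^*-\tfrac12\sum_{i,j,\ell\in S}(-1)^{p(u_i)p(u_\ell)}c_{ij}^\ell\,\varphi_\ell\varphi_i^*\varphi_j^*+\sum_{i\in S}(f|u_i)\varphi_i^*+\sum_{i\in S'}\varphi_i^*\Phi_i,\qquad d_0=\operatorname{Res}_zd(z),$$ $$L=\frac1{2(k+h^\vee)}\sum_{i\in\tilde S}(-1)^{p(u_i)}{:}u_iu^i{:}+\partial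 x-\sum_{i\in S}m_i{:}\varphi_i^*\partial\varphi_i{:}+\sum_{i\in S}(1-m_i){:}(\partial\varphi_i^*)\varphi_i{:}+\tfrac12\sum_{i\in S'}{:}(\partial\Phi^i)\Phi_i{:}\,.$$ Let $W_k(\mathfrak g,x,f)=\{a\in\mathcal C_0:[d_0,a]=0\}\big/\{a\in[d_0,\mathcal C_1]\cap\mathcal C_0:[d_0,a]=0\}$ be the $0$-th homology of $(\mathcal C,d_0)$ (the quantum reduction). **Theorem.** One has $[d_0,L(z)]=0$ in $U_k^{\rm com}$. Hence $L$ descends to an energy-momentum field of $W_k(\mathfrak g,x,f)$: the field $L(z)$ is local with itself and lies in $\mathcal C_0$, the $n$-th products ($n\in\mathbb Z$) of $\mathcal C$ induce well-defined bilinear $n$-th products on $W_k(\mathfrak g,x,f)$, and for these the class of $L$ satisfies $$[L_\lambda L]=(\partial+2\lambda)L+\tfrac{\lambda^3}{12}\,c,\qquad c=\frac{k\,\operatorname{sdim}\mathfrak g}{k+h^\vee}-12k(x|x)-\sum_{i\in S}(-1)^{p(u_i)}(12m_i^2-12m_i+2)-\tfrac12\operatorname{sdim}\mathfrak g_{1/2}.$$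 -/

import Mathlib

open scoped BigOperators Topology

noncomputable section

namespace QuantumReduction

/-! ### Superspaces and Lie superalgebras

A vector superspace over `ℂ` is a vector space with its parity involution `Γ`
(`Γ = (-1)^p` on the part of parity `p`). -/

/-- The sign `(-1)^p` of a parity. -/
def sgn (p : ZMod 2) : ℂ := if p = 0 then 1 else -1

/-- The part of parity `p` of the superspace with parity involution `Γ`. -/
def part {V : Type*} [AddCommGroup V] [Module ℂ V] (Γ : V →ₗ[ℂ] V) (p : ZMod 2) :
    Submodule ℂ V :=
  Module.End.eigenspace Γ (sgn p)

/-- The superdimension `dim W_even - dim W_odd` of a (parity stable) subspace `W`. -/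
def sdim {V : Type*} [AddCommGroup V] [Module ℂ V] (Γ : V →ₗ[ℂ] V) (W : Submodule ℂ V) : ℂ :=
  (Module.finrank ℂ (W ⊓ part Γ 0 : Submodule ℂ V) : ℂ)
    - (Module.finrank ℂ (W ⊓ part Γ 1 : Submodule ℂ V) : ℂ)

/-- The family dual to `b`: `B (b i) (b' j) = δ i j`. -/
def dualFamily {V ι : Type*} [AddCommGroup V] [Module ℂ V] [DecidableEq ι]
    (B : V →ₗ[ℂ] V →ₗ[ℂ] ℂ) (b : ι → V) : ι → V :=
  Classical.epsilon fun b' : ι → V => ∀ i j, B (b i) (b' j) = if i = j then 1 else 0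

/-- Lie superalgebra structures on the vector space `g`. -/
structure LieSuperalgebra (g : Type*) [AddCommGroup g] [Module ℂ g] where
  /-- the parity involution -/
  Γ : g →ₗ[ℂ] g
  Γ_Γ : ∀ a, Γ (Γ a) = a
  bracket : g →ₗ[ℂ] g →ₗ[ℂ] g
  Γ_bracket : ∀ a b, Γ (bracket a b) = bracket (Γ a) (Γ b)
  skew : ∀ p q, ∀ a ∈ part Γ p, ∀ b ∈ part Γ q,
    bracket a b = -(sgn (p * q) • bracket b a)
  jacobi : ∀ p q, ∀ a ∈ part Γ p, ∀ b ∈ part Γ q, ∀ c,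
    bracket a (bracket b c) = bracket (bracket a b) c + sgn (p * q) • bracket b (bracket a c)

/-- Simplicity: not abelian, and without nontrivial (graded) ideals. -/
def LieSuperalgebra.IsSimple {g : Type*} [AddCommGroup g] [Module ℂ g]
    (G : LieSuperalgebra g) : Prop :=
  (∃ a b, G.bracket a b ≠ 0) ∧
    ∀ I : Submodule ℂ g, (∀ a ∈ I, G.Γ a ∈ I) → (∀ a, ∀ b ∈ I, G.bracket a b ∈ I) →
      I = ⊥ ∨ I = ⊤

/-- The input `(g, (.|.), x, f, k)` of the quantum reduction: a simple Lie superalgebra with a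
nondegenerate even supersymmetric invariant bilinear form, even elements `x`, `f` such that
`ad x` is diagonalizable with eigenvalues in `½ℤ` and `[x, f] = -f`, and a level `k`. -/
structure ReductionData (g : Type*) [AddCommGroup g] [Module ℂ g] extends
    LieSuperalgebra g where
  simple : toLieSuperalgebra.IsSimple
  /-- the bilinear form `(a|b)` -/
  form : g →ₗ[ℂ] g →ₗ[ℂ] ℂ
  form_even : ∀ a b, form (Γ a) (Γ b) = form a b
  form_symm : ∀ p q, ∀ a ∈ part Γ p, ∀ b ∈ part Γ q, form a b = sgn (p * q) * form b a
  form_invariant : ∀ a b c, form (bracket a b) c = form a (bracket b c)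
  form_nondegenerate : form.Nondegenerate
  x : g
  f : g
  x_even : Γ x = x
  f_even : Γ f = f
  x_diagonalizable : ⨆ n : ℤ, Module.End.eigenspace (bracket x) ((n : ℂ) / 2) = ⊤
  bracket_x_f : bracket x f = -f
  k : ℂ

namespace ReductionData

variable {g : Type*} [AddCommGroup g] [Module ℂ g] (D : ReductionData g)

/-- The eigenspace `g_j` of `ad x`. -/
def gr (j : ℚ) : Submodule ℂ g := Module.End.eigenspace (D.bracket D.x) (j : ℂ)

/-- `g_+ = ⨁_{j > 0} g_j`. -/
def gplus : Submodule ℂ g := ⨆ j : {q : ℚ // 0 < q}, D.gr j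

/-- `g_{1/2}`. -/
def ghalf : Submodule ℂ g := D.gr (1 / 2)

/-- `h` is one half of the eigenvalue of the Casimir operator `∑ (-1)^{p(a_i)} a_i a^i` in the
adjoint representation, for all pairs `a_i`, `a^i` of homogeneous dual bases. -/
def IsDualCoxeterNumber (h : ℂ) : Prop :=
  ∀ (n : ℕ) (a : Module.Basis (Fin n) ℂ g) (p : Fin n → ZMod 2) (a' : Fin n → g),
    (∀ i, a i ∈ part D.Γ (p i)) →
    (∀ i j, D.form (a i) (a' j) = if i = j then 1 else 0) →
    ∀ v, ∑ i, sgn (p i) • D.bracket (a i) (D.bracket (a' i) v) = (2 * h) • v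

/-- The dual Coxeter number `h^∨`. -/
def dualCoxeter : ℂ := Classical.epsilon D.IsDualCoxeterNumber

theorem Γ_mem_gr {j : ℚ} {a : g} (ha : a ∈ D.gr j) : D.Γ a ∈ D.gr j := by
  rw [gr, Module.End.mem_eigenspace_iff] at ha ⊢
  have h := D.Γ_bracket D.x a
  rw [D.x_even, ha, map_smul] at h
  exact h.symm

theorem Γ_mem_gplus {a : g} (ha : a ∈ D.gplus) : D.Γ a ∈ D.gplus := by
  have h : D.gplus ≤ D.gplus.comap D.Γ := by
    conv_lhs => rw [gplus]
    refine iSup_le fun j a ha => ?_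
    exact Submodule.mem_iSup_of_mem (p := fun j : {q : ℚ // 0 < q} => D.gr j) j (D.Γ_mem_gr ha)
  exact h ha

/-- The parity involution of `g` restricted to `g_+`. -/
def Γplus : D.gplus →ₗ[ℂ] D.gplus := D.Γ.restrict fun _ ha => D.Γ_mem_gplus ha

/-- The parity involution of `g` restricted to `g_{1/2}`. -/
def Γhalf : D.ghalf →ₗ[ℂ] D.ghalf := D.Γ.restrict fun _ ha => D.Γ_mem_gr ha

/-- The form `⟨a, b⟩ = (f|[a, b])` on `A_ne = g_{1/2}`. -/
def neForm : D.ghalf →ₗ[ℂ] D.ghalf →ₗ[ℂ] ℂ :=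
  (D.bracket.compr₂ (D.form D.f)).domRestrict₁₂ D.ghalf D.ghalf

/-! ### The completed enveloping algebra -/

/-- The superspace `g ⊕ A_ch ⊕ A_ne`, where `A_ch = Π g_+ ⊕ Π g_+^*` and `A_ne = g_{1/2}`. -/
abbrev Gen : Type _ := g × D.gplus × Module.Dual ℂ D.gplus × D.ghalf

/-- The parity involution of `g ⊕ Π g_+ ⊕ Π g_+^* ⊕ g_{1/2}` (`Π` reverses the parity). -/
def genΓ : D.Gen →ₗ[ℂ] D.Gen :=
  D.Γ.prodMap ((-D.Γplus).prodMap ((-D.Γplus.dualMap).prodMap D.Γhalf))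

/-- The bracket of `g`, extended by zero to `g ⊕ A_ch ⊕ A_ne`. -/
def genBracket (a b : D.Gen) : D.Gen := (D.bracket a.1 b.1, 0, 0, 0)

/-- The form on `A_ch ⊕ A_ne`. On `A_ch` it is the skew-supersymmetric form for which
`Π g_+` and `Π g_+^*` are isotropic and `⟨φ, ψ^*⟩ = ψ^*(φ)`; the second term is
`⟨φ^*, ψ⟩ = -(-1)^{p(φ^*) p(ψ)} ⟨ψ, φ^*⟩`, the parities being those of `A_ch`. -/
def ghostForm (a b : D.Gen) : ℂ :=
  b.2.2.1 a.2.1 + a.2.2.1 (D.Γplus b.2.1) + D.neForm a.2.2.2 b.2.2.2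

/-- The scalar part of `[a t^m, b t^n]`, the central elements `K` acting as `k` on the Kac--Moody
affinization of `g` and as `1` on the Clifford affinizations of `A_ch` and `A_ne`. -/
def cocycle (a : D.Gen) (m : ℤ) (b : D.Gen) (n : ℤ) : ℂ :=
  (if m + n = 0 then (m : ℂ) * D.k * D.form a.1 b.1 else 0)
    + (if m + n = -1 then D.ghostForm a b else 0)

/-- The tensor algebra of `(g ⊕ A_ch ⊕ A_ne) ⊗ ℂ[t, t⁻¹]`. -/
abbrev TA : Type _ := TensorAlgebra ℂ (ℤ →₀ D.Gen)

/-- The element `a t^n` of the tensor algebra. -/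
def preMode (a : D.Gen) (n : ℤ) : D.TA := TensorAlgebra.ι ℂ (Finsupp.single n a)

/-- The commutation relations of the affinizations. -/
inductive Rel : D.TA → D.TA → Prop
  | comm (p q : ZMod 2) (a b : D.Gen) (m n : ℤ)
      (ha : a ∈ part D.genΓ p) (hb : b ∈ part D.genΓ q) :
      Rel (D.preMode a m * D.preMode b n)
        (sgn (p * q) • (D.preMode b n * D.preMode a m)
          + D.preMode (D.genBracket a b) (m + n)
          + algebraMap ℂ D.TA (D.cocycle a m b n))

/-- `U_k = U_k(ĝ) ⊗ U_1(Â_ch) ⊗ U_1(Â_ne)`, by generators and relations. -/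
def U : Type _ := RingQuot D.Rel

instance : Ring D.U := inferInstanceAs (Ring (RingQuot D.Rel))
instance : Algebra ℂ D.U := inferInstanceAs (Algebra ℂ (RingQuot D.Rel))

/-- The quotient map from the tensor algebra. -/
def toU : D.TA →ₐ[ℂ] D.U := RingQuot.mkAlgHom ℂ D.Rel

/-- The element `a t^n` of `U_k`. -/
def mode (n : ℤ) : D.Gen →ₗ[ℂ] D.U :=
  D.toU.toLinearMap ∘ₗ TensorAlgebra.ι ℂ ∘ₗ Finsupp.lsingle n

theorem mode_apply (n : ℤ) (a : D.Gen) : D.mode n a = D.toU (D.preMode a n) := rfl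

theorem mode_mul_mode {p q : ZMod 2} {a b : D.Gen} (m n : ℤ)
    (ha : a ∈ part D.genΓ p) (hb : b ∈ part D.genΓ q) :
    D.mode m a * D.mode n b = sgn (p * q) • (D.mode n b * D.mode m a)
      + D.mode (m + n) (D.genBracket a b) + algebraMap ℂ D.U (D.cocycle a m b n) := by
  simp only [mode_apply, ← map_mul]
  have h := RingQuot.mkAlgHom_rel ℂ (Rel.comm p q a b m n ha hb)
  simp only [map_add, map_smul, AlgHom.commutes] at h
  exact h

theorem U_induction {P : D.U → Prop} (hc : ∀ c : ℂ, P (algebraMap ℂ D.U c))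
    (hm : ∀ n a, P (D.mode n a)) (hadd : ∀ u v, P u → P v → P (u + v))
    (hmul : ∀ u v, P u → P v → P (u * v)) (u : D.U) : P u := by
  obtain ⟨w, rfl⟩ := RingQuot.mkAlgHom_surjective ℂ D.Rel u
  change P (D.toU w)
  induction w using TensorAlgebra.induction with
  | algebraMap r => simpa using hc r
  | ι y =>
    induction y using Finsupp.induction_linear with
    | zero => simpa using hc 0
    | add y z hy hz => simpa using hadd _ _ hy hz
    | single n a => exact hm n a
  | mul a b ha hb => simpa using hmul _ _ ha hb
  | add a b ha hb => simpa using hadd _ _ ha hb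

theorem genΓ_genΓ (a : D.Gen) : D.genΓ (D.genΓ a) = a := by
  obtain ⟨a, b, c, d⟩ := a
  have h1 : ∀ b, D.Γplus (D.Γplus b) = b := fun b => Subtype.ext (D.Γ_Γ b)
  have h2 : ∀ b, D.Γhalf (D.Γhalf b) = b := fun b => Subtype.ext (D.Γ_Γ b)
  have h3 : D.Γplus.dualMap (D.Γplus.dualMap c) = c := by
    ext b; simp [h1]
  simp [genΓ, D.Γ_Γ, h1, h2, h3]

theorem exists_parts (a : D.Gen) :
    ∃ a0 ∈ part D.genΓ 0, ∃ a1 ∈ part D.genΓ 1, a = a0 + a1 := by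
  refine ⟨(1 / 2 : ℂ) • (a + D.genΓ a), ?_, (1 / 2 : ℂ) • (a - D.genΓ a), ?_, ?_⟩
  · rw [part, Module.End.mem_eigenspace_iff]
    simp only [map_smul, map_add, genΓ_genΓ, sgn, if_true, one_smul]
    rw [add_comm]
  · rw [part, Module.End.mem_eigenspace_iff]
    simp only [map_smul, map_sub, genΓ_genΓ, sgn, one_ne_zero, if_false]
    module
  · module

/-- The left ideal `U_k A_(N)` generated by the `a t^n` with `n ≥ N`. -/
def filt (N : ℕ) : Ideal D.U :=
  Ideal.span {u | ∃ n : ℤ, (N : ℤ) ≤ n ∧ ∃ a, u = D.mode n a}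

theorem mode_mem_filt {N : ℕ} {n : ℤ} (h : (N : ℤ) ≤ n) (a : D.Gen) : D.mode n a ∈ D.filt N :=
  Ideal.subset_span ⟨n, h, a, rfl⟩

theorem filt_anti {M N : ℕ} (h : M ≤ N) : D.filt N ≤ D.filt M := by
  refine Ideal.span_mono ?_
  rintro _ ⟨n, hn, a, rfl⟩
  exact ⟨n, by omega, a, rfl⟩

theorem exists_filt_mul (v : D.U) : ∀ N, ∃ M, ∀ u ∈ D.filt M, u * v ∈ D.filt N := by
  induction v using D.U_induction with
  | hc c =>
    intro N
    refine ⟨N, fun u hu => ?_⟩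
    rw [← Algebra.commutes]
    exact Ideal.mul_mem_left _ _ hu
  | hadd v w hv hw =>
    intro N
    obtain ⟨M, hM⟩ := hv N
    obtain ⟨M', hM'⟩ := hw N
    refine ⟨max M M', fun u hu => ?_⟩
    rw [mul_add]
    exact add_mem (hM u (D.filt_anti (le_max_left _ _) hu))
      (hM' u (D.filt_anti (le_max_right _ _) hu))
  | hmul v w hv hw =>
    intro N
    obtain ⟨M, hM⟩ := hw N
    obtain ⟨M', hM'⟩ := hv M
    refine ⟨M', fun u hu => ?_⟩
    rw [← mul_assoc]
    exact hM _ (hM' u hu)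
  | hm n b =>
    intro N
    have key : ∀ m : ℤ, (N + n.natAbs + 1 : ℕ) ≤ m → ∀ p q a b,
        a ∈ part D.genΓ p → b ∈ part D.genΓ q → D.mode m a * D.mode n b ∈ D.filt N := by
      intro m hm p q a b ha hb
      rw [D.mode_mul_mode m n ha hb]
      have hc : D.cocycle a m b n = 0 := by
        rw [cocycle, if_neg (by omega), if_neg (by omega), add_zero]
      rw [hc, map_zero, add_zero, ← smul_mul_assoc]
      exact add_mem (Ideal.mul_mem_left _ _ (D.mode_mem_filt (by omega) _))
        (D.mode_mem_filt (by omega) _)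
    refine ⟨N + n.natAbs + 1, fun u hu => ?_⟩
    induction hu using Submodule.span_induction with
    | mem u hu =>
      obtain ⟨m, hm, a, rfl⟩ := hu
      obtain ⟨a0, ha0, a1, ha1, rfl⟩ := D.exists_parts a
      obtain ⟨b0, hb0, b1, hb1, rfl⟩ := D.exists_parts b
      simp only [map_add, add_mul, mul_add]
      exact add_mem (add_mem (key m hm _ _ _ _ ha0 hb0) (key m hm _ _ _ _ ha1 hb0))
        (add_mem (key m hm _ _ _ _ ha0 hb1) (key m hm _ _ _ _ ha1 hb1))
    | zero => simp
    | add u v _ _ hu hv => rw [add_mul]; exact add_mem hu hv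
    | smul c u _ hu => rw [smul_eq_mul, mul_assoc]; exact Ideal.mul_mem_left _ _ hu

theorem filtBasis :
    RingSubgroupsBasis fun N : ℕ => (D.filt N).toAddSubgroup where
  inter i j := ⟨max i j, le_inf (D.filt_anti (le_max_left _ _)) (D.filt_anti (le_max_right _ _))⟩
  mul i := by
    refine ⟨i, ?_⟩
    rintro _ ⟨u, -, v, hv, rfl⟩
    exact Ideal.mul_mem_left _ _ hv
  leftMul u i := ⟨i, fun v hv => Ideal.mul_mem_left _ _ hv⟩
  rightMul v i := by
    obtain ⟨M, hM⟩ := D.exists_filt_mul v i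
    exact ⟨M, hM⟩

instance : TopologicalSpace D.U := D.filtBasis.topology
instance : NonarchimedeanRing D.U := D.filtBasis.nonarchimedean
instance : UniformSpace D.U := IsTopologicalAddGroup.rightUniformSpace D.U
instance : IsUniformAddGroup D.U := isUniformAddGroup_of_addCommGroup
instance : UniformContinuousConstSMul ℂ D.U where
  uniformContinuous_const_smul c := by
    have h : (fun u : D.U => c • u) = (AddMonoidHom.mulLeft (algebraMap ℂ D.U c) : D.U → D.U) := by
      funext u; simp [Algebra.smul_def]
    rw [h]
    exact uniformContinuous_addMonoidHom_of_continuous (continuous_const_mul _)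

/-- The completion `U_k^com` of `U_k` with respect to the left ideals `U_k A_(N)`. -/
abbrev UCom : Type _ := UniformSpace.Completion D.U

theorem cocycle_genΓ (a : D.Gen) (m : ℤ) (b : D.Gen) (n : ℤ) :
    D.cocycle (D.genΓ a) m (D.genΓ b) n = D.cocycle a m b n := by
  have h1 : ∀ b, D.Γplus (D.Γplus b) = b := fun b => Subtype.ext (D.Γ_Γ b)
  have h2 : ∀ a b, D.neForm (D.Γhalf a) (D.Γhalf b) = D.neForm a b := by
    intro a b
    change D.form D.f (D.bracket (D.Γ a) (D.Γ b)) = D.form D.f (D.bracket a b)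
    rw [← D.Γ_bracket, ← D.form_even D.f (D.bracket a b), D.f_even]
  simp [cocycle, ghostForm, genΓ, D.form_even, h1, h2]

theorem genBracket_genΓ (a b : D.Gen) :
    D.genBracket (D.genΓ a) (D.genΓ b) = D.genΓ (D.genBracket a b) := by
  simp [genBracket, genΓ, D.Γ_bracket]

theorem genΓ_mem_part {p : ZMod 2} {a : D.Gen} (ha : a ∈ part D.genΓ p) :
    D.genΓ a ∈ part D.genΓ p := by
  have h := ha
  rw [part, Module.End.mem_eigenspace_iff] at h
  rw [h]
  exact Submodule.smul_mem _ _ ha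

/-- The parity automorphism of `U_k`: `a t^n ↦ (Γ a) t^n`. -/
def parU : D.U →ₐ[ℂ] D.U :=
  RingQuot.liftAlgHom ℂ ⟨TensorAlgebra.lift ℂ
      (D.toU.toLinearMap ∘ₗ TensorAlgebra.ι ℂ ∘ₗ Finsupp.mapRange.linearMap D.genΓ), by
    rintro _ _ ⟨p, q, a, b, m, n, ha, hb⟩
    simp only [map_mul, map_add, map_smul, preMode, TensorAlgebra.lift_ι_apply, LinearMap.comp_apply,
      Finsupp.mapRange.linearMap_apply, Finsupp.mapRange_single, AlgHom.toLinearMap_apply,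
      AlgHom.commutes]
    have h := D.mode_mul_mode m n (D.genΓ_mem_part ha) (D.genΓ_mem_part hb)
    rw [cocycle_genΓ, genBracket_genΓ] at h
    exact h⟩

theorem parU_mode (n : ℤ) (a : D.Gen) : D.parU (D.mode n a) = D.mode n (D.genΓ a) := by
  have h : D.parU (D.toU (TensorAlgebra.ι ℂ (Finsupp.single n a))) = D.mode n (D.genΓ a) := by
    refine (RingQuot.liftAlgHom_mkAlgHom_apply ℂ _ _ _).trans ?_
    rw [TensorAlgebra.lift_ι_apply]
    simp [mode]
  exact h

theorem continuous_parU : Continuous D.parU := by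
  have h : ∀ N, ∀ u ∈ D.filt N, D.parU u ∈ D.filt N := by
    intro N u hu
    induction hu using Submodule.span_induction with
    | mem u hu =>
      obtain ⟨m, hm, a, rfl⟩ := hu
      rw [parU_mode]
      exact D.mode_mem_filt hm _
    | zero => simp
    | add u v _ _ hu hv => rw [map_add]; exact add_mem hu hv
    | smul c u _ hu => rw [smul_eq_mul, map_mul]; exact Ideal.mul_mem_left _ _ hu
  refine continuous_of_continuousAt_zero (D.parU : D.U →+ D.U) ?_
  rw [ContinuousAt, map_zero, D.filtBasis.hasBasis_nhds_zero.tendsto_iff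
    D.filtBasis.hasBasis_nhds_zero]
  exact fun N _ => ⟨N, trivial, fun u hu => h N u hu⟩

/-- The parity automorphism of `U_k^com`. -/
def par : D.UCom →ₐ[ℂ] D.UCom :=
  { UniformSpace.Completion.mapRingHom (D.parU : D.U →+* D.U) D.continuous_parU with
    commutes' := fun c => by
      have h := UniformSpace.Completion.mapRingHom_coe (f := (D.parU : D.U →+* D.U))
        D.continuous_parU (algebraMap ℂ D.U c)
      have h' : (D.parU : D.U →+* D.U) (algebraMap ℂ D.U c) = algebraMap ℂ D.U c :=
        D.parU.commutes c
      rw [h'] at h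
      exact h }

/-- `(-1)^{p(u) p(v)} v u`, extended bilinearly. -/
def swap (u v : D.UCom) : D.UCom :=
  v * ((1 / 2 : ℂ) • (u + D.par u)) + D.par v * ((1 / 2 : ℂ) • (u - D.par u))

/-- The supercommutator `[u, v] = u v - (-1)^{p(u) p(v)} v u` of `U_k^com`. -/
def superComm (u v : D.UCom) : D.UCom := u * v - D.swap u v

/-! ### Fields and their `n`-th products -/

/-- Formal distributions `a(z) = ∑ a_(n) z^{-n-1}` with values in `U_k^com`, given by `n ↦ a_(n)`.
All the ones considered below are fields (`a_(n) → 0` for `n → +∞`). -/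
abbrev Fld : Type _ := ℤ → D.UCom

/-- `(∂ a)_(n) = -n a_(n-1)`. -/
def deriv : D.Fld →ₗ[ℂ] D.Fld where
  toFun a n := (-(n : ℂ)) • a (n - 1)
  map_add' a b := by funext n; simp
  map_smul' c a := by funext n; simp [smul_smul, mul_comm]

/-- The normally ordered product
`:a(z)b(z): = ∑_{n < 0} a_(n) z^{-n-1} b(z) + (-1)^{p(a)p(b)} b(z) ∑_{n ≥ 0} a_(n) z^{-n-1}`. -/
def normalOrd (a b : D.Fld) : D.Fld := fun m =>
  (∑' j : ℕ, a (-(j : ℤ) - 1) * b (m + j)) + ∑' j : ℕ, D.swap (a j) (b (m - j - 1))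

/-- The `n`-th product of fields: for `n ≥ 0` it is `Res_x (x - z)^n [a(x), b(z)]`, and
`a_(-n-1) b = :∂^n a b: / n!`. -/
def nprod : ℤ → D.Fld → D.Fld → D.Fld
  | Int.ofNat n, a, b => fun m =>
      ∑ j ∈ Finset.range (n + 1),
        ((-1 : ℂ) ^ j * (n.choose j : ℂ)) • D.superComm (a ((n : ℤ) - j)) (b (m + j))
  | Int.negSucc n, a, b => (1 / (n.factorial : ℂ)) • D.normalOrd ((D.deriv^[n]) a) b

/-- Locality: `(z - w)^N [a(z), b(w)] = 0` for some `N`. -/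
def IsLocal (a b : D.Fld) : Prop :=
  ∃ N : ℕ, ∀ m n : ℤ, ∑ j ∈ Finset.range (N + 1),
    ((-1 : ℂ) ^ j * (N.choose j : ℂ)) • D.superComm (a (m + N - j)) (b (n + j)) = 0

/-- The identity field. -/
def one : D.Fld := fun n => if n = -1 then 1 else 0

/-- The field `∑ (a t^n) z^{-n-1}` attached to `a` in `g ⊕ A_ch ⊕ A_ne`. -/
def field (a : D.Gen) : D.Fld := fun n => ((D.mode n a : D.U) : D.UCom)

/-- The currents `a(z)`, `a ∈ g`. -/
def current (a : g) : D.Fld := D.field (a, 0, 0, 0)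

/-- The charged ghosts `φ(z)`, `φ ∈ Π g_+`. -/
def ghost (a : D.gplus) : D.Fld := D.field (0, a, 0, 0)

/-- The charged ghosts `φ^*(z)`, `φ^* ∈ Π g_+^*`. -/
def ghostDual (a : Module.Dual ℂ D.gplus) : D.Fld := D.field (0, 0, a, 0)

/-- The neutral ghosts `Φ(z)`, `Φ ∈ g_{1/2}`. -/
def neutral (a : D.ghalf) : D.Fld := D.field (0, 0, 0, a)

/-- The vertex algebra `C(g, x, f, k)`, the smallest space of fields that contains `1`, the currents
and the ghosts and is closed under `∂` and all `n`-th products, together with its charge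
decomposition: `HasCharge m a` says that `a` lies in `C_m`. -/
inductive HasCharge : ℤ → D.Fld → Prop
  | one : HasCharge 0 D.one
  | current (a : g) : HasCharge 0 (D.current a)
  | neutral (a : D.ghalf) : HasCharge 0 (D.neutral a)
  | ghost (a : D.gplus) : HasCharge 1 (D.ghost a)
  | ghostDual (a : Module.Dual ℂ D.gplus) : HasCharge (-1) (D.ghostDual a)
  | zero (m : ℤ) : HasCharge m 0
  | add (m : ℤ) (a b : D.Fld) : HasCharge m a → HasCharge m b → HasCharge m (a + b)
  | smul (m : ℤ) (c : ℂ) (a : D.Fld) : HasCharge m a → HasCharge m (c • a)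
  | deriv (m : ℤ) (a : D.Fld) : HasCharge m a → HasCharge m (D.deriv a)
  | nprod (m m' : ℤ) (n : ℤ) (a b : D.Fld) :
      HasCharge m a → HasCharge m' b → HasCharge (m + m') (D.nprod n a b)

/-- The space `C_m` of elements of charge `m` in `C(g, x, f, k)`. -/
def chargePart (m : ℤ) : Submodule ℂ D.Fld where
  carrier := {a | D.HasCharge m a}
  zero_mem' := HasCharge.zero m
  add_mem' := HasCharge.add m _ _
  smul_mem' c a := HasCharge.smul m c a

/-- The operator `a(z) ↦ [u, a(z)]` on fields. -/
def ad (u : D.UCom) : D.Fld →ₗ[ℂ] D.Fld where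
  toFun a n := D.superComm u (a n)
  map_add' a b := by
    funext n
    simp only [superComm, swap, Pi.add_apply, map_add, mul_add, add_mul]
    abel
  map_smul' c a := by
    funext n
    simp only [superComm, swap, Pi.smul_apply, map_smul, RingHom.id_apply, mul_smul_comm,
      smul_mul_assoc, smul_add, smul_sub]

theorem deriv_ad (u : D.UCom) (a : D.Fld) : D.deriv (D.ad u a) = D.ad u (D.deriv a) := by
  funext n
  have h := congrFun ((D.ad u).map_smul (-(n : ℂ)) (fun _ => a (n - 1))) 0
  exact h.symm

/-! ### The differential and the energy-momentum field -/

/-- A basis of `g` that is homogeneous for parity and for the gradation by `ad x`. -/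
structure HomogeneousBasis (ι : Type*) where
  u : Module.Basis ι ℂ g
  parity : ι → ZMod 2
  deg : ι → ℚ
  mem_part : ∀ i, u i ∈ part D.Γ (parity i)
  mem_gr : ∀ i, u i ∈ D.gr (deg i)

namespace HomogeneousBasis

variable {D} {ι : Type*} [Fintype ι] (B : D.HomogeneousBasis ι)

/-- The index set `S` of the basis of `g_+`. -/
abbrev S : Type _ := {i : ι // 0 < B.deg i}

/-- The index set `S'` of the basis of `g_{1/2}`. -/
abbrev S' : Type _ := {i : ι // B.deg i = 1 / 2}

/-- The inclusion of `S'` in `S`. -/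
def S'toS (i : B.S') : B.S := ⟨i.1, by rw [i.2]; norm_num⟩

/-- The basis vectors `u_i`, `i ∈ S`, in `g_+`. -/
def uplus (i : B.S) : D.gplus :=
  ⟨B.u i, Submodule.mem_iSup_of_mem (p := fun j : {q : ℚ // 0 < q} => D.gr j)
    ⟨B.deg i, i.2⟩ (B.mem_gr i)⟩

/-- The basis vectors `u_i`, `i ∈ S'`, in `g_{1/2}`. -/
def uhalf (i : B.S') : D.ghalf := ⟨B.u i, by have h := B.mem_gr i; rwa [i.2] at h⟩

/-- The fields `φ_i(z)`. -/
def φ (i : B.S) : D.Fld := D.ghost (B.uplus i)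

/-- The fields `φ^*_i(z)` of the dual basis. -/
def φs (i : B.S) : D.Fld := D.ghostDual ((B.u.coord i).domRestrict D.gplus)

/-- The fields `Φ_i(z)`. -/
def Φ (i : B.S') : D.Fld := D.neutral (B.uhalf i)

/-- The fields `Φ^i(z)` of the basis dual with respect to `⟨.,.⟩`. -/
def Φd [DecidableEq ι] (i : B.S') : D.Fld := D.neutral (dualFamily D.neForm B.uhalf i)

/-- The structure constants `c^l_{ij}`. -/
def c (i j l : ι) : ℂ := B.u.repr (D.bracket (B.u i) (B.u j)) l

/-- The field
`d = ∑ (-1)^{p(u_i)} u_i φ^*_i - ½ ∑ (-1)^{p(u_i) p(u_l)} c^l_{ij} φ_l φ^*_i φ^*_j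
  + ∑ (f|u_i) φ^*_i + ∑ φ^*_i Φ_i`. -/
def d : D.Fld :=
  (∑ i : B.S, sgn (B.parity i) • D.normalOrd (D.current (B.u i)) (B.φs i))
    - (1 / 2 : ℂ) • (∑ i : B.S, ∑ j : B.S, ∑ l : B.S,
        (sgn (B.parity i * B.parity l) * B.c i j l) •
          D.normalOrd (B.φ l) (D.normalOrd (B.φs i) (B.φs j)))
    + (∑ i : B.S, D.form D.f (B.u i) • B.φs i)
    + ∑ i : B.S', D.normalOrd (B.φs (B.S'toS i)) (B.Φ i)

/-- `d_0 = Res_z d(z)`. -/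
def d0 : D.UCom := B.d 0

/-- The Sugawara field `L^g = (2(k + h^∨))⁻¹ ∑ (-1)^{p(u_i)} :u_i u^i:`. -/
def Lg [DecidableEq ι] : D.Fld :=
  (1 / (2 * (D.k + D.dualCoxeter))) • ∑ i : ι, sgn (B.parity i) •
    D.normalOrd (D.current (B.u i)) (D.current (dualFamily D.form B.u i))

/-- `L^ch = -∑ m_i :φ^*_i ∂φ_i: + ∑ (1 - m_i) :(∂φ^*_i) φ_i:`. -/
def Lch : D.Fld :=
  -(∑ i : B.S, (B.deg i : ℂ) • D.normalOrd (B.φs i) (D.deriv (B.φ i)))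
    + ∑ i : B.S, (1 - (B.deg i : ℂ)) • D.normalOrd (D.deriv (B.φs i)) (B.φ i)

/-- `L^ne = ½ ∑ :(∂Φ^i) Φ_i:`. -/
def Lne [DecidableEq ι] : D.Fld := (1 / 2 : ℂ) • ∑ i : B.S', D.normalOrd (D.deriv (B.Φd i)) (B.Φ i)

/-- `L = L^g + ∂x + L^ch + L^ne`. -/
def L [DecidableEq ι] : D.Fld := B.Lg + D.deriv (D.current D.x) + B.Lch + B.Lne

/-- The central charge `c(g, x, f, k)`. -/
def centralCharge : ℂ :=
  D.k * sdim D.Γ ⊤ / (D.k + D.dualCoxeter) - 12 * D.k * D.form D.x D.x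
    - (∑ i : B.S, sgn (B.parity i) * (12 * (B.deg i : ℂ) ^ 2 - 12 * (B.deg i : ℂ) + 2))
    - (1 / 2 : ℂ) * sdim D.Γ D.ghalf

/-! ### The quantum reduction -/

/-- The cycles `{a ∈ C_0 | [d_0, a] = 0}`. -/
def cycles : Submodule ℂ D.Fld := D.chargePart 0 ⊓ LinearMap.ker (D.ad B.d0)

/-- The boundaries `[d_0, C_1]`. -/
def boundaries : Submodule ℂ D.Fld := (D.chargePart 1).map (D.ad B.d0)

/-- `W_k(g, x, f)`, the `0`-th homology of `(C(g, x, f, k), d_0)`. -/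
abbrev W : Type _ := B.cycles ⧸ B.boundaries.submoduleOf B.cycles

/-- The homology class of a cycle. -/
def cls : B.cycles →ₗ[ℂ] B.W := (B.boundaries.submoduleOf B.cycles).mkQ

theorem deriv_mem_cycles {a : D.Fld} (ha : a ∈ B.cycles) : D.deriv a ∈ B.cycles := by
  refine ⟨HasCharge.deriv 0 a ha.1, ?_⟩
  have h : D.ad B.d0 a = 0 := ha.2
  change D.ad B.d0 (D.deriv a) = 0
  rw [← deriv_ad, h, map_zero]

theorem deriv_mem_boundaries {a : D.Fld} (ha : a ∈ B.boundaries) : D.deriv a ∈ B.boundaries := by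
  obtain ⟨b, hb, rfl⟩ := ha
  exact ⟨D.deriv b, HasCharge.deriv 1 b hb, (D.deriv_ad _ _).symm⟩

theorem one_mem_cycles : D.one ∈ B.cycles := by
  refine ⟨HasCharge.one, ?_⟩
  change D.ad B.d0 D.one = 0
  funext n
  by_cases hn : n = -1
  · simp only [ad, LinearMap.coe_mk, AddHom.coe_mk, superComm, swap, one, hn, if_true, mul_one,
      map_one, one_mul, Pi.zero_apply]
    module
  · simp [ad, superComm, swap, one, hn]

/-- The derivation of `W_k(g, x, f)` induced by `∂`. -/
def T : B.W →ₗ[ℂ] B.W :=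
  Submodule.mapQ _ _ (D.deriv.restrict fun _ ha => B.deriv_mem_cycles ha)
    fun _ ha => B.deriv_mem_boundaries ha

/-- The vacuum of `W_k(g, x, f)`. -/
def vac : B.W := B.cls ⟨D.one, B.one_mem_cycles⟩

/-- `P` is the family of `n`-th products of `W_k(g, x, f)` induced by those of `C(g, x, f, k)`. -/
def IsInduced (P : ℤ → B.W →ₗ[ℂ] B.W →ₗ[ℂ] B.W) : Prop :=
  ∀ (n : ℤ) (a b : B.cycles), ∃ h : D.nprod n a b ∈ B.cycles,
    P n (B.cls a) (B.cls b) = B.cls ⟨D.nprod n a b, h⟩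

end HomogeneousBasis

end ReductionData

/-- The relation `[L_λ L] = (∂ + 2λ) L + λ^3 c / 12`, where `[a_λ b] = ∑_{n ≥ 0} λ^n a_(n) b / n!`,
in a space `V` with `n`-th products `P`, derivation `T` (that is, `∂`) and vacuum `vac`. -/
def IsEnergyMomentum {V : Type*} [AddCommGroup V] [Module ℂ V] (P : ℤ → V →ₗ[ℂ] V →ₗ[ℂ] V)
    (T : V →ₗ[ℂ] V) (vac L : V) (c : ℂ) : Prop :=
  P 0 L L = T L ∧ P 1 L L = (2 : ℂ) • L ∧ P 2 L L = 0 ∧ P 3 L L = (c / 2) • vac ∧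
    ∀ n : ℤ, 4 ≤ n → P n L L = 0

end QuantumReduction

/-!
# The energy-momentum field of the quantum reduction of a simple Lie superalgebra

Everything is computed with the modes of fields in `U_k^com`. The neighbourhoods of `0` in
`U_k^com` are generated by left ideals, so that `x_i b_i → 0` whenever `b_i → 0`; hence the sums of
normally ordered products converge, normal ordering preserves fields, and the supercommutator with a
homogeneous element is a derivation of all `n`-th products (`ad_nprod`). As `d_0` is odd, this gives
products on the homology once the sign is written as the parity automorphism, which preserves the
charge spaces and, up to sign, commutes with `[d_0, .]`.

The relation `[X_λ Y] = ∑ j, λ^j c_j / j!` is used in the form `OPE` of a commutator formula for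
modes. The Leibniz rule for the modes of `X`, together with the comparison of `:(z^M a)b:` with
`z^M :ab:` (`normalOrd_shift_left`), is the noncommutative Wick formula `OPE.wick`.

* The brackets of the generating fields with the four summands of `L` follow from the Wick formula.
  For the Sugawara field this needs the invariance of the Casimir element and the value `2 h^∨` of
  the Casimir operator in the adjoint representation, which is a scalar by Schur's lemma
  (`casimir_eq`). As `L` is even these brackets can be read in the opposite order: the generating
  fields are of weights `1 - m_i` (for `u_i` and `φ_i`), `m_i` (for `φ^*_i`) and `1/2` (for `Φ_i`),
  and primary except for the term `-k λ² (a|x)` in `[L_λ a]`.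
* A second application of the Wick formula (`OPE.wick_weight`) gives
  `[L_λ L] = (∂ + 2λ) L + λ² Y / 2 + λ³ c / 12`, where `c` is the sum of the contractions of the
  quadratic terms and of the anomaly of `∂x`. There is no need to compute `Y`: skew-symmetry of the
  bracket of the even field `L` with itself forces `Y = 0` (`OPE.eq_zero_of_even`).
* The field `d` is a sum of products of primary fields without contractions, each of total weight
  one (`isCurrent_d`). So `[L_(n), d_(m)] = -(m + n) d_(m+n-1) + n d_(m+n-1)`, which vanishes for
  `m = 0`.

The `n`-th products in the theorem are then read off from the commutator formula for `L`, since the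
`n`-th product involves the `n`-th difference of its binomial coefficients.
-/

namespace QuantumReduction

/-! ### Signs -/

theorem sgn_zero : sgn 0 = 1 := by simp [sgn]

theorem sgn_one : sgn 1 = -1 := by simp [sgn]

theorem parity_cases (p : ZMod 2) : p = 0 ∨ p = 1 := by
  fin_cases p
  · exact Or.inl rfl
  · exact Or.inr rfl

theorem sgn_add (p q : ZMod 2) : sgn (p + q) = sgn p * sgn q := by
  have h : (1 : ZMod 2) + 1 = 0 := rfl
  rcases parity_cases p with rfl | rfl <;> rcases parity_cases q with rfl | rfl <;>
    simp [sgn_zero, sgn_one, h]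

theorem sgn_mul_sgn_self (p : ZMod 2) : sgn p * sgn p = 1 := by
  rcases parity_cases p with rfl | rfl <;> simp [sgn_zero, sgn_one]

theorem sgn_mul_self (p : ZMod 2) : sgn (p * p) = sgn p := by
  rcases parity_cases p with rfl | rfl <;> simp [sgn_zero, sgn_one]

theorem mem_part_iff {V : Type*} [AddCommGroup V] [Module ℂ V] {Γ : V →ₗ[ℂ] V} {p : ZMod 2}
    {a : V} : a ∈ part Γ p ↔ Γ a = sgn p • a :=
  Module.End.mem_eigenspace_iff

namespace ReductionData

variable {g : Type*} [AddCommGroup g] [Module ℂ g] (D : ReductionData g)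

/-! ### The topology of the completed enveloping algebra -/

theorem par_coe (u : D.U) : D.par (u : D.UCom) = ((D.parU u : D.U) : D.UCom) :=
  UniformSpace.Completion.mapRingHom_coe (f := (D.parU : D.U →+* D.U)) D.continuous_parU u

theorem continuous_par : Continuous D.par :=
  UniformSpace.Completion.continuous_map (f := (D.parU : D.U → D.U))

theorem parU_parU (u : D.U) : D.parU (D.parU u) = u := by
  induction u using D.U_induction with
  | hc c => simp
  | hm n a => simp only [parU_mode, genΓ_genΓ]
  | hadd u v hu hv => simp [hu, hv]
  | hmul u v hu hv => simp [hu, hv]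

theorem par_par (u : D.UCom) : D.par (D.par u) = u := by
  induction u using UniformSpace.Completion.induction_on with
  | hp => exact isClosed_eq (D.continuous_par.comp D.continuous_par) continuous_id
  | ih u => simp only [par_coe, parU_parU]

/-- The closures of the left ideals `U_k A_(N)` are left ideals of `U_k^com` and form a basis of
neighbourhoods of `0`. -/
theorem exists_leftIdeal_subset {W : Set D.UCom} (hW : W ∈ 𝓝 (0 : D.UCom)) :
    ∃ I : Submodule D.UCom D.UCom, (I : Set D.UCom) ∈ 𝓝 (0 : D.UCom) ∧
      IsClosed (I : Set D.UCom) ∧ (I : Set D.UCom) ⊆ W := by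
  have hb := D.filtBasis.hasBasis_nhds_zero.hasBasis_of_isDenseInducing
    (UniformSpace.Completion.isDenseInducing_coe (α := D.U))
  rw [UniformSpace.Completion.coe_zero] at hb
  obtain ⟨N, -, hN⟩ := hb.mem_iff.mp hW
  let V : AddSubgroup D.UCom := ((D.filt N).toAddSubgroup.map
    (UniformSpace.Completion.toCompl : D.U →+ D.UCom)).topologicalClosure
  have hV : (V : Set D.UCom)
      = closure ((fun u : D.U => (u : D.UCom)) '' ((D.filt N).toAddSubgroup : Set D.U)) := rfl
  refine ⟨{ V with smul_mem' := ?_ }, ?_, AddSubgroup.isClosed_topologicalClosure _, ?_⟩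
  · intro u v hv
    change u * v ∈ (V : Set D.UCom)
    have hv' : v ∈ (V : Set D.UCom) := hv
    have hcl : IsClosed (V : Set D.UCom) := AddSubgroup.isClosed_topologicalClosure _
    induction u using UniformSpace.Completion.induction_on with
    | hp => exact hcl.preimage (continuous_id.mul continuous_const)
    | ih u =>
      rw [hV] at hv' ⊢
      refine map_mem_closure (f := fun w : D.UCom => (u : D.UCom) * w)
        (continuous_const.mul continuous_id) hv' ?_
      rintro _ ⟨w, hw, rfl⟩
      exact ⟨u * w, Ideal.mul_mem_left _ _ hw, UniformSpace.Completion.coe_mul _ _⟩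
  · exact hb.mem_of_mem trivial
  · exact hN

variable {D}

/-- Left multiples of a null family are null, whatever the coefficients: the neighbourhoods of
`0` can be taken to be left ideals. -/
theorem tendsto_mul_left_zero {α : Type*} {l : Filter α} (x : α → D.UCom) {b : α → D.UCom}
    (hb : Filter.Tendsto b l (𝓝 0)) : Filter.Tendsto (fun i => x i * b i) l (𝓝 0) := by
  intro W hW
  obtain ⟨I, hI, -, hIW⟩ := D.exists_leftIdeal_subset hW
  have h : ∀ᶠ i in l, b i ∈ I := hb hI
  exact h.mono fun i hi => hIW (I.smul_mem (x i) hi)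

theorem summable_mul_left (x : ℕ → D.UCom) {b : ℕ → D.UCom}
    (hb : Filter.Tendsto b Filter.atTop (𝓝 0)) : Summable fun j => x j * b j := by
  refine NonarchimedeanAddGroup.summable_of_tendsto_cofinite_zero ?_
  rw [Nat.cofinite_eq_atTop]
  exact tendsto_mul_left_zero x hb

/-! ### Supercommutators -/

variable (D) in
/-- The power `par ^ p` of the parity automorphism: the twist that appears in the Leibniz rule
for the supercommutator with an element of parity `p`. -/
def tw (p : ZMod 2) : D.UCom →ₐ[ℂ] D.UCom := if p = 0 then AlgHom.id ℂ _ else D.par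

theorem tw_zero (u : D.UCom) : D.tw 0 u = u := by simp [tw]

theorem tw_one (u : D.UCom) : D.tw 1 u = D.par u := by simp [tw]

theorem continuous_tw (p : ZMod 2) : Continuous (D.tw p) := by
  rcases parity_cases p with rfl | rfl
  · simpa [tw] using (continuous_id : Continuous (id : D.UCom → D.UCom))
  · simpa [tw] using D.continuous_par

variable (D) in
/-- `u` is homogeneous of parity `p`. -/
def HasParity (p : ZMod 2) (u : D.UCom) : Prop := D.par u = sgn p • u

theorem HasParity.tw {q : ZMod 2} {u : D.UCom} (hu : D.HasParity q u) (p : ZMod 2) :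
    D.tw p u = sgn (p * q) • u := by
  rcases parity_cases p with rfl | rfl
  · simp [tw_zero, sgn_zero]
  · rw [tw_one, one_mul]; exact hu

theorem exists_hasParity_add (u : D.UCom) :
    ∃ v w, D.HasParity 0 v ∧ D.HasParity 1 w ∧ u = v + w := by
  refine ⟨(1 / 2 : ℂ) • (u + D.par u), (1 / 2 : ℂ) • (u - D.par u), ?_, ?_, by module⟩
  · simp only [HasParity, map_smul, map_add, par_par, sgn_zero, one_smul, add_comm]
  · simp only [HasParity, map_smul, map_sub, par_par, sgn_one]
    module

theorem swap_eq {p : ZMod 2} {u : D.UCom} (hu : D.HasParity p u) (v : D.UCom) :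
    D.swap u v = D.tw p v * u := by
  rw [swap, hu]
  rcases parity_cases p with rfl | rfl
  · rw [sgn_zero, one_smul, sub_self, tw_zero, smul_zero, mul_zero, add_zero]
    congr 1
    module
  · rw [sgn_one, tw_one]
    have h1 : (1 / 2 : ℂ) • (u + (-1 : ℂ) • u) = 0 := by module
    have h2 : (1 / 2 : ℂ) • (u - (-1 : ℂ) • u) = u := by module
    rw [h1, h2, mul_zero, zero_add]

theorem swap_add_left (u v w : D.UCom) : D.swap (u + v) w = D.swap u w + D.swap v w := by
  simp only [swap, map_add, smul_add, smul_sub, mul_add, mul_sub]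
  abel

theorem swap_add_right (u v w : D.UCom) : D.swap u (v + w) = D.swap u v + D.swap u w := by
  simp only [swap, map_add, add_mul]
  abel

theorem swap_smul_left (c : ℂ) (u v : D.UCom) : D.swap (c • u) v = c • D.swap u v := by
  simp only [swap, map_smul, ← smul_add, ← smul_sub, smul_comm _ c, mul_smul_comm]

theorem swap_smul_right (c : ℂ) (u v : D.UCom) : D.swap u (c • v) = c • D.swap u v := by
  simp only [swap, map_smul, smul_mul_assoc, smul_add]

theorem par_swap (u v : D.UCom) : D.par (D.swap u v) = D.swap (D.par u) (D.par v) := by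
  simp only [swap, map_add, map_mul, map_smul, map_sub, par_par]

theorem superComm_add_left (u v w : D.UCom) :
    D.superComm (u + v) w = D.superComm u w + D.superComm v w := by
  simp only [superComm, swap_add_left, add_mul]; abel

theorem superComm_add_right (u v w : D.UCom) :
    D.superComm u (v + w) = D.superComm u v + D.superComm u w := by
  simp only [superComm, swap_add_right, mul_add]; abel

theorem superComm_smul_left (c : ℂ) (u v : D.UCom) :
    D.superComm (c • u) v = c • D.superComm u v := by
  simp only [superComm, swap_smul_left, smul_mul_assoc, smul_sub]

theorem superComm_smul_right (c : ℂ) (u v : D.UCom) :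
    D.superComm u (c • v) = c • D.superComm u v := by
  simp only [superComm, swap_smul_right, mul_smul_comm, smul_sub]

theorem par_superComm (u v : D.UCom) :
    D.par (D.superComm u v) = D.superComm (D.par u) (D.par v) := by
  simp only [superComm, map_sub, map_mul, par_swap]

theorem superComm_eq {p : ZMod 2} {u : D.UCom} (hu : D.HasParity p u) (v : D.UCom) :
    D.superComm u v = u * v - D.tw p v * u := by
  rw [superComm, swap_eq hu]

theorem superComm_eq_of_even_right (u : D.UCom) {v : D.UCom} (hv : D.HasParity 0 v) :
    D.superComm u v = u * v - v * u := by
  have h : D.par v = v := by simpa [HasParity, sgn_zero] using hv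
  rw [superComm, swap, h, ← mul_add]
  congr 2
  module

/-- The supercommutator with a homogeneous element is a superderivation. -/
theorem superComm_mul {p : ZMod 2} {u : D.UCom} (hu : D.HasParity p u) (v w : D.UCom) :
    D.superComm u (v * w) = D.superComm u v * w + D.tw p v * D.superComm u w := by
  simp only [superComm_eq hu, map_mul]
  noncomm_ring

theorem HasParity.superComm {p q : ZMod 2} {u v : D.UCom} (hu : D.HasParity p u)
    (hv : D.HasParity q v) : D.HasParity (p + q) (D.superComm u v) := by
  rw [HasParity, par_superComm, hu, hv, sgn_add, superComm_smul_left, superComm_smul_right,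
    smul_smul]

theorem tw_tw (p q : ZMod 2) (u : D.UCom) : D.tw p (D.tw q u) = D.tw (p + q) u := by
  rcases parity_cases p with rfl | rfl <;> rcases parity_cases q with rfl | rfl
  · simp [tw_zero]
  · simp [tw_zero]
  · simp [tw_zero]
  · have h : (1 : ZMod 2) + 1 = 0 := rfl
    rw [h, tw_zero, tw_one, tw_one, par_par]

/-- The Leibniz rule for the term `swap` of the normally ordered product. -/
theorem superComm_swap {p : ZMod 2} {u : D.UCom} (hu : D.HasParity p u) (v w : D.UCom) :
    D.superComm u (D.swap v w)
      = D.swap (D.superComm u v) w + D.swap (D.tw p v) (D.superComm u w) := by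
  have key : ∀ q v, D.HasParity q v → D.superComm u (D.swap v w)
      = D.swap (D.superComm u v) w + D.swap (D.tw p v) (D.superComm u w) := by
    intro q v hv
    have hc := hu.superComm hv
    rw [swap_eq hv, superComm_mul hu, swap_eq hc, hv.tw, swap_smul_left, swap_eq hv]
    simp only [superComm_eq hu, map_sub, map_mul, tw_tw, hu.tw]
    rw [hv.tw]
    have e := sgn_mul_sgn_self (p * q)
    simp only [mul_sub, sub_mul, smul_mul_assoc, mul_smul_comm, smul_sub, smul_smul,
      mul_comm q p, e, one_smul, mul_assoc, add_comm q p]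
    abel
  obtain ⟨v0, v1, h0, h1, rfl⟩ := exists_hasParity_add v
  simp only [swap_add_left, superComm_add_right, map_add, key _ _ h0, key _ _ h1]
  abel

theorem continuous_swap_right (u : D.UCom) : Continuous fun v => D.swap u v :=
  (continuous_mul_const _).add (D.continuous_par.mul_const _)

theorem continuous_superComm_right (u : D.UCom) : Continuous fun v => D.superComm u v :=
  (continuous_const_mul u).sub (continuous_swap_right u)

theorem tendsto_swap_zero {α : Type*} {l : Filter α} {u : α → D.UCom} (v : α → D.UCom)
    (hu : Filter.Tendsto u l (𝓝 0)) : Filter.Tendsto (fun i => D.swap (u i) (v i)) l (𝓝 0) := by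
  have hp : Filter.Tendsto (fun i => D.par (u i)) l (𝓝 0) := by
    have h := (D.continuous_par.tendsto 0).comp hu
    rwa [map_zero] at h
  have h1 : Filter.Tendsto (fun i => (1 / 2 : ℂ) • (u i + D.par (u i))) l (𝓝 0) := by
    simpa using (hu.add hp).const_smul (1 / 2 : ℂ)
  have h2 : Filter.Tendsto (fun i => (1 / 2 : ℂ) • (u i - D.par (u i))) l (𝓝 0) := by
    simpa using (hu.sub hp).const_smul (1 / 2 : ℂ)
  have h := (tendsto_mul_left_zero v h1).add (tendsto_mul_left_zero (fun i => D.par (v i)) h2)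
  rwa [add_zero] at h

variable (D) in
/-- The supercommutator with `u` as an additive map. -/
def superCommHom (u : D.UCom) : D.UCom →+ D.UCom :=
  AddMonoidHom.mk' (D.superComm u) (superComm_add_right u)

/-! ### Fields and normally ordered products -/

/-- A formal distribution `a(z)` is a field if `a_(n) → 0` as `n → +∞`. -/
def IsField (a : D.Fld) : Prop := Filter.Tendsto a Filter.atTop (𝓝 0)

theorem IsField.zero : IsField (0 : D.Fld) := tendsto_const_nhds

theorem IsField.add {a b : D.Fld} (ha : IsField a) (hb : IsField b) : IsField (a + b) := by
  have h := Filter.Tendsto.add ha hb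
  rwa [add_zero] at h

theorem IsField.smul {a : D.Fld} (ha : IsField a) (c : ℂ) : IsField (c • a) := by
  have h := Filter.Tendsto.const_smul ha c
  rwa [smul_zero] at h

theorem IsField.sum {α : Type*} {s : Finset α} {a : α → D.Fld} (h : ∀ i ∈ s, IsField (a i)) :
    IsField (∑ i ∈ s, a i) :=
  Finset.sum_induction a IsField (fun _ _ => IsField.add) IsField.zero h

/-- The field `z^k a(z)`. -/
def shift (k : ℤ) (a : D.Fld) : D.Fld := fun n => a (n + k)

theorem IsField.shift {a : D.Fld} (ha : IsField a) (k : ℤ) : IsField (shift k a) :=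
  Filter.Tendsto.comp ha (Filter.tendsto_atTop_add_const_right _ k Filter.tendsto_id)

theorem IsField.comp_natCast {a : D.Fld} (ha : IsField a) :
    Filter.Tendsto (fun j : ℕ => a j) Filter.atTop (𝓝 0) :=
  Filter.Tendsto.comp ha tendsto_natCast_atTop_atTop

theorem IsField.comp_add {a : D.Fld} (ha : IsField a) (m : ℤ) :
    Filter.Tendsto (fun j : ℕ => a (m + j)) Filter.atTop (𝓝 0) := by
  have h := (ha.shift m).comp_natCast
  simpa only [ReductionData.shift, add_comm m] using h

theorem IsField.map {a : D.Fld} (ha : IsField a) {F : D.UCom → D.UCom} (hF : Continuous F)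
    (h0 : F 0 = 0) : IsField fun n => F (a n) := by
  have h := (hF.tendsto 0).comp ha
  rwa [h0] at h

theorem IsField.tw {a : D.Fld} (ha : IsField a) (p : ZMod 2) : IsField fun n => D.tw p (a n) :=
  ha.map (continuous_tw p) (map_zero _)

theorem superComm_zero_right (u : D.UCom) : D.superComm u 0 = 0 :=
  (D.superCommHom u).map_zero

theorem IsField.ad {a : D.Fld} (ha : IsField a) (u : D.UCom) : IsField (D.ad u a) :=
  ha.map (continuous_superComm_right u) (superComm_zero_right u)

theorem isField_one : IsField D.one := by
  refine tendsto_const_nhds.congr' ?_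
  filter_upwards [Filter.eventually_ge_atTop (0 : ℤ)] with n hn
  rw [one, if_neg (by omega)]

/-- The generating fields are fields, as `a t^n ∈ U_k A_(N)` for `n ≥ N`. -/
theorem isField_field (a : D.Gen) : IsField (D.field a) := by
  have h : Filter.Tendsto (fun n => D.mode n a) Filter.atTop (𝓝 (0 : D.U)) := by
    rw [D.filtBasis.hasBasis_nhds_zero.tendsto_right_iff]
    intro N _
    filter_upwards [Filter.eventually_ge_atTop (N : ℤ)] with n hn
    exact D.mode_mem_filt hn a
  exact ((UniformSpace.Completion.continuous_coe D.U).tendsto 0).comp h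

theorem summable_mul {b : D.Fld} (hb : IsField b) (x : ℕ → D.UCom) (m : ℤ) :
    Summable fun j : ℕ => x j * b (m + j) :=
  summable_mul_left x (hb.comp_add m)

theorem summable_swap {a : D.Fld} (ha : IsField a) (x : ℕ → D.UCom) :
    Summable fun j : ℕ => D.swap (a j) (x j) := by
  refine NonarchimedeanAddGroup.summable_of_tendsto_cofinite_zero ?_
  rw [Nat.cofinite_eq_atTop]
  exact tendsto_swap_zero x ha.comp_natCast

theorem tsum_mem_of_isClosed {I : Submodule D.UCom D.UCom} (hI : IsClosed (I : Set D.UCom))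
    {f : ℕ → D.UCom} (h : ∀ j, f j ∈ I) : ∑' j, f j ∈ I := by
  by_cases hf : Summable f
  · exact hI.mem_of_tendsto hf.hasSum (Filter.Eventually.of_forall fun s => I.sum_mem fun j _ => h j)
  · rw [tsum_eq_zero_of_not_summable hf]; exact I.zero_mem

theorem IsField.normalOrd {a b : D.Fld} (ha : IsField a) (hb : IsField b) :
    IsField (D.normalOrd a b) := by
  have h1 : IsField fun m => ∑' j : ℕ, a (-(j : ℤ) - 1) * b (m + j) := by
    intro W hW
    obtain ⟨I, hI, hIc, hIW⟩ := D.exists_leftIdeal_subset hW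
    have h : ∀ᶠ n in Filter.atTop, b n ∈ I := hb hI
    obtain ⟨M, hM⟩ := Filter.eventually_atTop.mp h
    refine (Filter.eventually_ge_atTop M).mono fun m hm => hIW ?_
    exact tsum_mem_of_isClosed hIc fun j => I.smul_mem _ (hM _ (by omega))
  -- Up to signs the `j`-th term is `b_(m-j-1) a_(j)`: for large `j` it lies in a given left ideal
  -- because `a_(j)` does, and the remaining terms are finitely many and tend to `0` with `m`.
  have h2 : IsField fun m => ∑' j : ℕ, D.swap (a j) (b (m - j - 1)) := by
    intro W hW
    obtain ⟨I, hI, hIc, hIW⟩ := D.exists_leftIdeal_subset hW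
    have h : ∀ᶠ j : ℕ in Filter.atTop, (1 / 2 : ℂ) • (a j + D.par (a j)) ∈ I ∧
        (1 / 2 : ℂ) • (a j - D.par (a j)) ∈ I := by
      have hc : Continuous fun u : D.UCom => (1 / 2 : ℂ) • (u + D.par u) :=
        (continuous_id.add D.continuous_par).const_smul (1 / 2 : ℂ)
      have hd : Continuous fun u : D.UCom => (1 / 2 : ℂ) • (u - D.par u) :=
        (continuous_id.sub D.continuous_par).const_smul (1 / 2 : ℂ)
      have e1 := (ha.map hc (by simp)).comp_natCast
      have e2 := (ha.map hd (by simp)).comp_natCast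
      exact Filter.Eventually.and (e1 hI) (e2 hI)
    obtain ⟨J, hJ⟩ := Filter.eventually_atTop.mp h
    have hfin : Filter.Tendsto (fun m : ℤ => ∑ j ∈ Finset.range J, D.swap (a j) (b (m - j - 1)))
        Filter.atTop (𝓝 0) := by
      rw [← Finset.sum_const_zero (s := Finset.range J) (ι := ℕ)]
      refine tendsto_finsetSum _ fun j _ => ?_
      have e := (hb.map (continuous_swap_right (a j)) (by simp [swap])).shift (-j - 1)
      refine e.congr fun m => ?_
      simp only [ReductionData.shift]
      congr 2
      ring
    have hf : ∀ᶠ m : ℤ in Filter.atTop,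
        ∑ j ∈ Finset.range J, D.swap (a j) (b (m - j - 1)) ∈ I := hfin hI
    refine hf.mono fun m hm => hIW ?_
    change ∑' j : ℕ, D.swap (a j) (b (m - j - 1)) ∈ I
    rw [← (summable_swap ha fun j => b (m - j - 1)).sum_add_tsum_nat_add J]
    refine I.add_mem hm (tsum_mem_of_isClosed hIc fun j => ?_)
    obtain ⟨e1, e2⟩ := hJ (j + J) (by omega)
    exact I.add_mem (I.smul_mem _ e1) (I.smul_mem _ e2)
  exact h1.add h2

theorem IsField.deriv {a : D.Fld} (ha : IsField a) : IsField (D.deriv a) := by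
  intro W hW
  obtain ⟨I, hI, -, hIW⟩ := D.exists_leftIdeal_subset hW
  have h : ∀ᶠ n in Filter.atTop, ReductionData.shift (-1) a n ∈ I := ha.shift (-1) hI
  refine h.mono fun n hn => hIW ?_
  change (-(n : ℂ)) • a (n - 1) ∈ I
  rw [← one_mul (a (n - 1)), ← smul_mul_assoc]
  exact I.smul_mem _ hn

theorem IsField.iterate_deriv {a : D.Fld} (ha : IsField a) (n : ℕ) : IsField ((D.deriv)^[n] a) := by
  induction n with
  | zero => exact ha
  | succ n ih => rw [Function.iterate_succ_apply']; exact ih.deriv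

theorem IsField.nprod {a b : D.Fld} (n : ℤ) (ha : IsField a) (hb : IsField b) :
    IsField (D.nprod n a b) := by
  cases n with
  | ofNat n =>
    have h : IsField (∑ j ∈ Finset.range (n + 1), ((-1 : ℂ) ^ j * (n.choose j : ℂ)) •
        ReductionData.shift j (D.ad (a ((n : ℤ) - j)) b)) :=
      IsField.sum fun j _ => ((hb.ad _).shift j).smul _
    refine h.congr fun m => ?_
    rw [Finset.sum_apply]
    rfl
  | negSucc n => exact ((ha.iterate_deriv n).normalOrd hb).smul _

theorem HasCharge.isField {m : ℤ} {a : D.Fld} (h : D.HasCharge m a) : IsField a := by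
  induction h with
  | one => exact isField_one
  | current a => exact isField_field _
  | neutral a => exact isField_field _
  | ghost a => exact isField_field _
  | ghostDual a => exact isField_field _
  | zero m => exact IsField.zero
  | add m a b _ _ ha hb => exact ha.add hb
  | smul m c a _ ha => exact ha.smul c
  | deriv m a _ ha => exact ha.deriv
  | nprod m m' n a b _ _ ha hb => exact ha.nprod n hb

theorem normalOrd_add_left {a a' b : D.Fld} (ha : IsField a) (ha' : IsField a') (hb : IsField b) :
    D.normalOrd (a + a') b = D.normalOrd a b + D.normalOrd a' b := by
  funext m
  simp only [normalOrd, Pi.add_apply, add_mul, swap_add_left]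
  rw [(summable_mul hb _ m).tsum_add (summable_mul hb _ m),
    (summable_swap ha _).tsum_add (summable_swap ha' _)]
  abel

theorem normalOrd_add_right {a b b' : D.Fld} (ha : IsField a) (hb : IsField b) (hb' : IsField b') :
    D.normalOrd a (b + b') = D.normalOrd a b + D.normalOrd a b' := by
  funext m
  simp only [normalOrd, Pi.add_apply, mul_add, swap_add_right]
  rw [(summable_mul hb _ m).tsum_add (summable_mul hb' _ m),
    (summable_swap ha _).tsum_add (summable_swap ha _)]
  abel

theorem normalOrd_smul_left (c : ℂ) (a b : D.Fld) :
    D.normalOrd (c • a) b = c • D.normalOrd a b := by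
  funext m
  simp only [normalOrd, Pi.smul_apply, smul_mul_assoc, swap_smul_left, tsum_const_smul'', smul_add]

theorem normalOrd_smul_right (c : ℂ) (a b : D.Fld) :
    D.normalOrd a (c • b) = c • D.normalOrd a b := by
  funext m
  simp only [normalOrd, Pi.smul_apply, mul_smul_comm, swap_smul_right, tsum_const_smul'', smul_add]

theorem normalOrd_zero_left (b : D.Fld) : D.normalOrd 0 b = 0 := by
  simpa using normalOrd_smul_left 0 0 b

theorem normalOrd_zero_right (a : D.Fld) : D.normalOrd a 0 = 0 := by
  simpa using normalOrd_smul_right 0 a 0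

theorem normalOrd_shift_right (a b : D.Fld) (k : ℤ) :
    D.normalOrd a (shift k b) = shift k (D.normalOrd a b) := by
  funext m
  simp only [normalOrd, shift]
  congr 1
  · refine tsum_congr fun j => ?_
    rw [add_right_comm]
  · refine tsum_congr fun j => ?_
    congr 2
    ring

theorem swap_zero_left (u : D.UCom) : D.swap 0 u = 0 := by simp [swap]

theorem swap_zero_right (u : D.UCom) : D.swap u 0 = 0 := by simp [swap]

theorem swap_one_right (u : D.UCom) : D.swap u 1 = u := by
  simp only [swap, map_one, one_mul]
  module

theorem normalOrd_one_left (b : D.Fld) : D.normalOrd D.one b = b := by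
  funext m
  have h1 : ∑' j : ℕ, D.one (-(j : ℤ) - 1) * b (m + j) = b m := by
    rw [tsum_eq_single 0]
    · simp [one]
    · intro j hj
      rw [one, if_neg (by omega), zero_mul]
  have h2 : ∑' j : ℕ, D.swap (D.one j) (b (m - j - 1)) = 0 := by
    rw [← tsum_zero (α := D.UCom) (β := ℕ)]
    refine tsum_congr fun j => ?_
    rw [one, if_neg (by omega), swap_zero_left]
  rw [normalOrd, h1, h2, add_zero]

theorem normalOrd_one_right (a : D.Fld) : D.normalOrd a D.one = a := by
  funext m
  rcases lt_or_ge m 0 with hm | hm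
  · have h1 : ∑' j : ℕ, a (-(j : ℤ) - 1) * D.one (m + j) = a m := by
      rw [tsum_eq_single (-1 - m).toNat]
      · rw [one, if_pos (by omega), mul_one]
        congr 1
        omega
      · intro j hj
        rw [one, if_neg (by omega), mul_zero]
    have h2 : ∑' j : ℕ, D.swap (a j) (D.one (m - j - 1)) = 0 := by
      rw [← tsum_zero (α := D.UCom) (β := ℕ)]
      refine tsum_congr fun j => ?_
      rw [one, if_neg (by omega), swap_zero_right]
    rw [normalOrd, h1, h2, add_zero]
  · have h1 : ∑' j : ℕ, a (-(j : ℤ) - 1) * D.one (m + j) = 0 := by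
      rw [← tsum_zero (α := D.UCom) (β := ℕ)]
      refine tsum_congr fun j => ?_
      rw [one, if_neg (by omega), mul_zero]
    have h2 : ∑' j : ℕ, D.swap (a j) (D.one (m - j - 1)) = a m := by
      rw [tsum_eq_single m.toNat]
      · rw [one, if_pos (by omega), swap_one_right]
        congr 1
        omega
      · intro j hj
        rw [one, if_neg (by omega), swap_zero_right]
    rw [normalOrd, h1, h2, zero_add]

/-- The derivation property of `∂` for normally ordered products. -/
theorem deriv_normalOrd {a b : D.Fld} (ha : IsField a) (hb : IsField b) :
    D.deriv (D.normalOrd a b) = D.normalOrd (D.deriv a) b + D.normalOrd a (D.deriv b) := by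
  funext m
  have s1 : Summable fun j : ℕ => ((j : ℂ) • a (-(j : ℤ) - 1)) * b (m - 1 + j) :=
    summable_mul hb _ _
  have s2 : Summable fun j : ℕ => D.swap (D.deriv a j) (b (m - j - 1)) :=
    summable_swap ha.deriv _
  -- Both sums for `:(∂a)b:` are shifted by one index, to involve the same products as the sums for
  -- `:ab:`; the terms gained or lost at the boundary carry the factor `0`.
  have e1 : ∑' j : ℕ, D.deriv a (-(j : ℤ) - 1) * b (m + j)
      = ∑' j : ℕ, ((j : ℂ) • a (-(j : ℤ) - 1)) * b (m - 1 + j) := by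
    rw [s1.tsum_eq_zero_add, Nat.cast_zero, zero_smul, zero_mul, zero_add]
    refine tsum_congr fun j => ?_
    have h1 : -(j : ℤ) - 1 - 1 = -((j + 1 : ℕ) : ℤ) - 1 := by push_cast; ring
    have h2 : m + (j : ℤ) = m - 1 + ((j + 1 : ℕ) : ℤ) := by push_cast; ring
    simp only [ReductionData.deriv, LinearMap.coe_mk, AddHom.coe_mk]
    rw [h1, h2]
    congr 2
    push_cast
    ring
  have e2 : ∑' j : ℕ, D.swap (D.deriv a j) (b (m - j - 1))
      = ∑' j : ℕ, (-(j : ℂ) - 1) • D.swap (a j) (b (m - 1 - j - 1)) := by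
    rw [s2.tsum_eq_zero_add]
    have h0 : D.deriv a ((0 : ℕ) : ℤ) = 0 := by simp [ReductionData.deriv]
    rw [h0, swap_zero_left, zero_add]
    refine tsum_congr fun j => ?_
    rw [← swap_smul_left]
    simp only [ReductionData.deriv, LinearMap.coe_mk, AddHom.coe_mk]
    have h1 : ((j + 1 : ℕ) : ℤ) - 1 = j := by push_cast; ring
    have h2 : m - ((j + 1 : ℕ) : ℤ) - 1 = m - 1 - j - 1 := by push_cast; ring
    rw [h1, h2]
    congr 2
    push_cast
    ring
  have s3 : Summable fun j : ℕ => D.swap (((-(j : ℂ) - 1)) • a j) (b (m - 1 - j - 1)) := by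
    refine (summable_swap ha fun j => (-(j : ℂ) - 1) • b (m - 1 - j - 1)).congr fun j => ?_
    rw [swap_smul_left, swap_smul_right]
  have lhs : D.deriv (D.normalOrd a b) m = (∑' j : ℕ, (-(m : ℂ)) • (a (-(j : ℤ) - 1) * b (m - 1 + j)))
      + ∑' j : ℕ, (-(m : ℂ)) • D.swap (a j) (b (m - 1 - j - 1)) := by
    simp only [ReductionData.deriv, LinearMap.coe_mk, AddHom.coe_mk, normalOrd, smul_add,
      tsum_const_smul'']
  rw [lhs, Pi.add_apply, normalOrd, normalOrd, e1, e2]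
  -- `-m` is the sum of the coefficients `j` and `-(m + j)` from the two derivatives.
  have t1 : ∑' j : ℕ, (-(m : ℂ)) • (a (-(j : ℤ) - 1) * b (m - 1 + j))
      = (∑' j : ℕ, ((j : ℂ) • a (-(j : ℤ) - 1)) * b (m - 1 + j))
        + ∑' j : ℕ, a (-(j : ℤ) - 1) * D.deriv b (m + j) := by
    rw [← s1.tsum_add (summable_mul hb.deriv _ m)]
    refine tsum_congr fun j => ?_
    have h2 : m + (j : ℤ) - 1 = m - 1 + j := by ring
    simp only [ReductionData.deriv, LinearMap.coe_mk, AddHom.coe_mk]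
    rw [h2, smul_mul_assoc, mul_smul_comm, ← add_smul]
    congr 1
    push_cast
    ring
  -- `-m` is the sum of the coefficients `-j - 1` and `-(m - j - 1)` from the two derivatives.
  have t2 : ∑' j : ℕ, (-(m : ℂ)) • D.swap (a j) (b (m - 1 - j - 1))
      = (∑' j : ℕ, (-(j : ℂ) - 1) • D.swap (a j) (b (m - 1 - j - 1)))
        + ∑' j : ℕ, D.swap (a j) (D.deriv b (m - j - 1)) := by
    simp only [← swap_smul_left] at s3 ⊢
    rw [← s3.tsum_add (summable_swap ha _)]
    refine tsum_congr fun j => ?_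
    have h2 : m - (j : ℤ) - 1 - 1 = m - 1 - j - 1 := by ring
    simp only [ReductionData.deriv, LinearMap.coe_mk, AddHom.coe_mk]
    rw [h2, swap_smul_right, swap_smul_left, swap_smul_left, ← add_smul]
    congr 1
    push_cast
    ring
  rw [t1, t2]
  abel

/-! ### The Leibniz rule for `n`-th products -/

/-- The Leibniz rule for normally ordered products. It holds for each term of the two sums, and
`[u, .]` can be taken inside the sums by continuity. -/
theorem superComm_normalOrd {p : ZMod 2} {u : D.UCom} (hu : D.HasParity p u) {a b : D.Fld}
    (ha : IsField a) (hb : IsField b) :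
    D.ad u (D.normalOrd a b)
      = D.normalOrd (D.ad u a) b + D.normalOrd (fun n => D.tw p (a n)) (D.ad u b) := by
  funext m
  have hc : Continuous (D.superCommHom u) := continuous_superComm_right u
  have e1 := ((summable_mul hb (fun j => a (-(j : ℤ) - 1)) m).hasSum.map (D.superCommHom u)
    hc).tsum_eq
  have e2 := ((summable_swap ha fun j => b (m - j - 1)).hasSum.map (D.superCommHom u) hc).tsum_eq
  have h : D.ad u (D.normalOrd a b) m
      = D.superCommHom u (∑' j : ℕ, a (-(j : ℤ) - 1) * b (m + j))
        + D.superCommHom u (∑' j : ℕ, D.swap (a j) (b (m - j - 1))) :=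
    superComm_add_right _ _ _
  rw [h, ← e1, ← e2]
  have f1 : ∑' j : ℕ, (D.superCommHom u ∘ fun j : ℕ => a (-(j : ℤ) - 1) * b (m + j)) j
      = ∑' j : ℕ, (D.ad u a (-(j : ℤ) - 1) * b (m + j)
        + D.tw p (a (-(j : ℤ) - 1)) * D.ad u b (m + j)) :=
    tsum_congr fun j => superComm_mul hu _ _
  have f2 : ∑' j : ℕ, (D.superCommHom u ∘ fun j : ℕ => D.swap (a j) (b (m - j - 1))) j
      = ∑' j : ℕ, (D.swap (D.ad u a j) (b (m - j - 1))
        + D.swap (D.tw p (a j)) (D.ad u b (m - j - 1))) :=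
    tsum_congr fun j => superComm_swap hu _ _
  rw [f1, f2, (summable_mul hb _ m).tsum_add (summable_mul (hb.ad u) _ m),
    (summable_swap (ha.ad u) _).tsum_add (summable_swap (ha.tw p) _)]
  simp only [normalOrd, Pi.add_apply]
  abel

theorem deriv_tw (p : ZMod 2) (a : D.Fld) :
    D.deriv (fun n => D.tw p (a n)) = fun n => D.tw p (D.deriv a n) := by
  funext n
  simp [ReductionData.deriv]

theorem iterate_deriv_tw (p : ZMod 2) (a : D.Fld) (n : ℕ) :
    (D.deriv)^[n] (fun n => D.tw p (a n)) = fun m => D.tw p ((D.deriv)^[n] a m) := by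
  induction n with
  | zero => rfl
  | succ n ih => rw [Function.iterate_succ_apply', ih, deriv_tw, Function.iterate_succ_apply']

theorem iterate_deriv_ad (u : D.UCom) (a : D.Fld) (n : ℕ) :
    (D.deriv)^[n] (D.ad u a) = D.ad u ((D.deriv)^[n] a) := by
  induction n with
  | zero => rfl
  | succ n ih => rw [Function.iterate_succ_apply', ih, deriv_ad, Function.iterate_succ_apply']

/-- The super Jacobi identity. -/
theorem superComm_superComm {p : ZMod 2} {u : D.UCom} (hu : D.HasParity p u) (v w : D.UCom) :
    D.superComm u (D.superComm v w)
      = D.superComm (D.superComm u v) w + D.superComm (D.tw p v) (D.superComm u w) := by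
  have h : D.superComm v w = v * w + (-1 : ℂ) • D.swap v w := by rw [superComm]; module
  rw [h, superComm_add_right, superComm_smul_right, superComm_mul hu, superComm_swap hu]
  rw [superComm.eq_1 D (D.superComm u v) w, superComm.eq_1 D (D.tw p v) (D.superComm u w)]
  module

/-- The supercommutator with a homogeneous element is a derivation of all `n`-th products. -/
theorem ad_nprod {p : ZMod 2} {u : D.UCom} (hu : D.HasParity p u) (n : ℤ) {a b : D.Fld}
    (ha : IsField a) (hb : IsField b) :
    D.ad u (D.nprod n a b)
      = D.nprod n (D.ad u a) b + D.nprod n (fun m => D.tw p (a m)) (D.ad u b) := by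
  cases n with
  | ofNat n =>
    funext m
    change D.superCommHom u (∑ j ∈ Finset.range (n + 1), _) = _
    rw [map_sum]
    simp only [nprod, Pi.add_apply]
    rw [← Finset.sum_add_distrib]
    refine Finset.sum_congr rfl fun j _ => ?_
    rw [← smul_add]
    refine (superComm_smul_right _ _ _).trans ?_
    rw [superComm_superComm hu]
    rfl
  | negSucc n =>
    simp only [nprod]
    rw [map_smul, superComm_normalOrd hu (ha.iterate_deriv n) hb, iterate_deriv_ad,
      iterate_deriv_tw, smul_add]

/-! ### Operator product expansions and the Wick formula -/

/-- All modes of the field `a` have parity `p`. -/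
def FieldParity (p : ZMod 2) (a : D.Fld) : Prop := ∀ n, D.HasParity p (a n)

theorem FieldParity.add {p : ZMod 2} {a b : D.Fld} (ha : FieldParity p a) (hb : FieldParity p b) :
    FieldParity p (a + b) := fun n => by
  have h1 : D.par (a n) = _ := ha n
  have h2 : D.par (b n) = _ := hb n
  rw [HasParity, Pi.add_apply, map_add, h1, h2, smul_add]

theorem FieldParity.zero (p : ZMod 2) : FieldParity p (0 : D.Fld) := fun n => by
  simp [HasParity]

theorem FieldParity.smul {p : ZMod 2} {a : D.Fld} (ha : FieldParity p a) (c : ℂ) :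
    FieldParity p (c • a) := fun n => by
  have h1 : D.par (a n) = _ := ha n
  rw [HasParity, Pi.smul_apply, map_smul, h1, smul_comm]

theorem FieldParity.sum {α : Type*} {s : Finset α} {p : ZMod 2} {a : α → D.Fld}
    (h : ∀ i ∈ s, FieldParity p (a i)) : FieldParity p (∑ i ∈ s, a i) :=
  Finset.sum_induction a (FieldParity p) (fun _ _ => FieldParity.add) (FieldParity.zero p) h

theorem FieldParity.deriv {p : ZMod 2} {a : D.Fld} (ha : FieldParity p a) :
    FieldParity p (D.deriv a) := fun n => by
  have h1 : D.par (a (n - 1)) = _ := ha (n - 1)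
  change D.par ((-(n : ℂ)) • a (n - 1)) = sgn p • (-(n : ℂ)) • a (n - 1)
  rw [map_smul, h1, smul_comm]

theorem par_normalOrd {a b : D.Fld} (ha : IsField a) (hb : IsField b) (n : ℤ) :
    D.par (D.normalOrd a b n)
      = D.normalOrd (fun n => D.par (a n)) (fun n => D.par (b n)) n := by
  have e1 := ((summable_mul hb (fun j => a (-(j : ℤ) - 1)) n).hasSum.map D.par
    D.continuous_par).tsum_eq
  have e2 := ((summable_swap ha fun j => b (n - j - 1)).hasSum.map D.par D.continuous_par).tsum_eq
  rw [normalOrd, map_add, ← e1, ← e2, normalOrd]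
  simp only [Function.comp_def, map_mul, par_swap]

theorem FieldParity.normalOrd {p q : ZMod 2} {a b : D.Fld} (hpa : FieldParity p a)
    (hpb : FieldParity q b) (ha : IsField a) (hb : IsField b) :
    FieldParity (p + q) (D.normalOrd a b) := fun n => by
  have h1 : (fun n => D.par (a n)) = sgn p • a := funext hpa
  have h2 : (fun n => D.par (b n)) = sgn q • b := funext hpb
  rw [HasParity, par_normalOrd ha hb, h1, h2, normalOrd_smul_left, normalOrd_smul_right, smul_smul,
    sgn_add, Pi.smul_apply]

/-- The relation `[X_λ Y] = c0 + λ c1 + λ² c2 / 2 + λ³ c3 / 6` in terms of the modes of `X`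
and `Y`: `[X_(m), Y_(n)] = ∑ j, (m choose j) (c j)_(m + n - j)`. -/
def OPE (X Y c0 c1 c2 c3 : D.Fld) : Prop :=
  ∀ m n : ℤ, D.superComm (X m) (Y n) = c0 (m + n) + (m : ℂ) • c1 (m + n - 1)
    + ((m : ℂ) * (m - 1) / 2) • c2 (m + n - 2)
    + ((m : ℂ) * (m - 1) * (m - 2) / 6) • c3 (m + n - 3)

theorem OPE.congr {X Y c0 c1 c2 c3 e0 e1 e2 e3 : D.Fld} (h : OPE X Y c0 c1 c2 c3)
    (h0 : c0 = e0) (h1 : c1 = e1) (h2 : c2 = e2) (h3 : c3 = e3) : OPE X Y e0 e1 e2 e3 := by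
  subst h0 h1 h2 h3
  exact h

theorem OPE.zero_right (X : D.Fld) : OPE X 0 0 0 0 0 := fun m n => by
  simp [superComm_zero_right]

theorem OPE.zero_left (X : D.Fld) : OPE 0 X 0 0 0 0 := fun m n => by
  simp [superComm, swap]

theorem OPE.one_left (X : D.Fld) : OPE D.one X 0 0 0 0 := fun m n => by
  by_cases h : m = -1
  · have h1 : D.HasParity 0 (1 : D.UCom) := by rw [HasParity, map_one, sgn_zero, one_smul]
    simp [superComm_eq h1, one, h, tw_zero]
  · simp [superComm, swap, one, h]

theorem OPE.add_right {X Y Y' c0 c1 c2 c3 e0 e1 e2 e3 : D.Fld} (h : OPE X Y c0 c1 c2 c3)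
    (h' : OPE X Y' e0 e1 e2 e3) :
    OPE X (Y + Y') (c0 + e0) (c1 + e1) (c2 + e2) (c3 + e3) := fun m n => by
  rw [Pi.add_apply, superComm_add_right, h, h']
  simp only [Pi.add_apply]
  module

theorem OPE.smul_right {X Y c0 c1 c2 c3 : D.Fld} (h : OPE X Y c0 c1 c2 c3) (r : ℂ) :
    OPE X (r • Y) (r • c0) (r • c1) (r • c2) (r • c3) := fun m n => by
  rw [Pi.smul_apply, superComm_smul_right, h]
  simp only [Pi.smul_apply]
  module

theorem OPE.neg_right {X Y c0 c1 c2 c3 : D.Fld} (h : OPE X Y c0 c1 c2 c3) :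
    OPE X (-Y) (-c0) (-c1) (-c2) (-c3) := by
  simpa only [neg_one_smul] using h.smul_right (-1)

theorem OPE.smul_left {X Y c0 c1 c2 c3 : D.Fld} (h : OPE X Y c0 c1 c2 c3) (r : ℂ) :
    OPE (r • X) Y (r • c0) (r • c1) (r • c2) (r • c3) := fun m n => by
  rw [Pi.smul_apply, superComm_smul_left, h]
  simp only [Pi.smul_apply]
  module

theorem OPE.sum_right {α : Type*} (s : Finset α) {X : D.Fld} {Y c0 c1 c2 c3 : α → D.Fld}
    (h : ∀ i ∈ s, OPE X (Y i) (c0 i) (c1 i) (c2 i) (c3 i)) :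
    OPE X (∑ i ∈ s, Y i) (∑ i ∈ s, c0 i) (∑ i ∈ s, c1 i) (∑ i ∈ s, c2 i) (∑ i ∈ s, c3 i) := by
  classical
  induction s using Finset.induction_on with
  | empty => simpa using OPE.zero_right X
  | insert a s ha ih =>
    simp only [Finset.sum_insert ha]
    exact (h a (Finset.mem_insert_self a s)).add_right
      (ih fun i hi => h i (Finset.mem_insert_of_mem hi))

theorem deriv_apply (a : D.Fld) (n : ℤ) : D.deriv a n = (-(n : ℂ)) • a (n - 1) := rfl

theorem OPE.deriv_right {X Y c0 c1 c2 : D.Fld} (h : OPE X Y c0 c1 c2 0) :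
    OPE X (D.deriv Y) (D.deriv c0) (D.deriv c1 + c0) (D.deriv c2 + (2 : ℂ) • c1)
      ((3 : ℂ) • c2) := fun m n => by
  rw [deriv_apply, superComm_smul_right, h]
  simp only [Pi.add_apply, Pi.smul_apply, deriv_apply, Pi.zero_apply]
  have e1 : m + (n - 1) = m + n - 1 := by ring
  have e2 : m + (n - 1) - 1 = m + n - 2 := by ring
  have e3 : m + (n - 1) - 2 = m + n - 3 := by ring
  have e4 : m + n - 1 - 1 = m + n - 2 := by ring
  have e5 : m + n - 2 - 1 = m + n - 3 := by ring
  rw [e2, e3, e1, e4, e5]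
  push_cast
  module

theorem OPE.deriv_left {X Y c0 c1 c2 : D.Fld} (h : OPE X Y c0 c1 c2 0) :
    OPE (D.deriv X) Y 0 (-c0) ((-2 : ℂ) • c1) ((-3 : ℂ) • c2) := fun m n => by
  rw [deriv_apply, superComm_smul_left, h]
  simp only [Pi.neg_apply, Pi.smul_apply, Pi.zero_apply]
  have e1 : m - 1 + n = m + n - 1 := by ring
  have e2 : m - 1 + n - 1 = m + n - 2 := by ring
  have e3 : m - 1 + n - 2 = m + n - 3 := by ring
  rw [e2, e3, e1]
  push_cast
  module

/-- The commutator formula with an even field read in the opposite order, for a field `a` which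
is primary of weight `Δ` up to a multiple of the identity field. -/
theorem OPE.flip {a L : D.Fld} {Δ κ : ℂ} (hL : FieldParity 0 L)
    (h : OPE a L ((Δ - 1) • D.deriv a) (Δ • a) (κ • D.one) 0) :
    OPE L a (D.deriv a) (Δ • a) ((-κ) • D.one) 0 := fun m n => by
  have e : D.superComm (L m) (a n) = (-1 : ℂ) • D.superComm (a n) (L m) := by
    rw [superComm_eq_of_even_right _ (hL m), superComm_eq (hL m), tw_zero]
    module
  rw [e, h]
  simp only [Pi.smul_apply, Pi.zero_apply, deriv_apply, one, add_comm n m]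
  by_cases hmn : m + n - 2 = -1
  · have hn : (n : ℂ) = 1 - m := by
      have : n = 1 - m := by omega
      rw [this]; push_cast; ring
    rw [if_pos hmn]
    push_cast
    rw [hn]
    module
  · rw [if_neg hmn]
    push_cast
    module

/-- Multiplying `c` by one more power of `z` moves one mode of `c` from the right of `b` to its
left, at the cost of a commutator. -/
theorem normalOrd_shift_succ_left {c b : D.Fld} (hc : IsField c) (hb : IsField b) (M n : ℤ) :
    D.normalOrd (shift (M + 1) c) b n
      = D.normalOrd (shift M c) b (n + 1) + D.superComm (c M) (b n) := by
  have s1 := summable_mul hb (fun j : ℕ => shift (M + 1) c (-(j : ℤ) - 1)) n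
  have s2 := summable_swap (hc.shift M) fun j => b (n + 1 - j - 1)
  have e1 : ∑' j : ℕ, shift (M + 1) c (-(j : ℤ) - 1) * b (n + j)
      = c M * b n + ∑' j : ℕ, shift M c (-(j : ℤ) - 1) * b (n + 1 + j) := by
    rw [s1.tsum_eq_zero_add]
    congr 1
    · simp [shift]
    · refine tsum_congr fun j => ?_
      simp only [shift]
      congr 2 <;> push_cast <;> ring
  have e2 : ∑' j : ℕ, D.swap (shift M c j) (b (n + 1 - j - 1))
      = D.swap (c M) (b n) + ∑' j : ℕ, D.swap (shift (M + 1) c j) (b (n - j - 1)) := by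
    rw [s2.tsum_eq_zero_add]
    congr 1
    · simp [shift]
    · refine tsum_congr fun j => ?_
      simp only [shift]
      congr 2 <;> push_cast <;> ring
  rw [normalOrd, normalOrd, e1, e2, superComm]
  abel

/-- Multiplication by a power of `z` does not commute with normal ordering; the difference is
given by the operator product expansion. -/
theorem normalOrd_shift_left {c b f0 f1 f2 : D.Fld} (hc : IsField c) (hb : IsField b)
    (h : OPE c b f0 f1 f2 0) (M n : ℤ) :
    D.normalOrd (shift M c) b n = D.normalOrd c b (n + M) + (M : ℂ) • f0 (n + M - 1)
      + ((M : ℂ) * (M - 1) / 2) • f1 (n + M - 2)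
      + ((M : ℂ) * (M - 1) * (M - 2) / 6) • f2 (n + M - 3) := by
  have key : ∀ M n : ℤ, D.superComm (c M) (b n) = f0 (n + M) + (M : ℂ) • f1 (n + M - 1)
      + ((M : ℂ) * (M - 1) / 2) • f2 (n + M - 2) := fun M n => by
    rw [h, Pi.zero_apply, smul_zero, add_zero, add_comm n M]
  induction M generalizing n with
  | zero =>
    have h0 : shift 0 c = c := by funext n; simp [shift]
    simp [h0]
  | succ M ih =>
    rw [normalOrd_shift_succ_left hc hb, ih (n + 1), key]
    have e1 : n + 1 + (M : ℤ) = n + (M + 1) := by ring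
    have e2 : n + (M : ℤ) = n + (M + 1) - 1 := by ring
    have e3 : n + ((M : ℤ) + 1) - 1 - 1 = n + (M + 1) - 2 := by ring
    have e4 : n + ((M : ℤ) + 1) - 1 - 2 = n + (M + 1) - 3 := by ring
    rw [e1, e2, e3, e4]
    push_cast
    module
  | pred M ih =>
    have hs := normalOrd_shift_succ_left hc hb (-(M : ℤ) - 1) (n - 1)
    have i1 : -(M : ℤ) - 1 + 1 = -M := by ring
    have i2 : n - 1 + 1 = n := by ring
    rw [i1, i2, ih (n - 1), key] at hs
    have e1 : n - 1 + -(M : ℤ) = n + (-M - 1) := by ring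
    have e3 : n - 1 + (-(M : ℤ) - 1) = n + (-M - 1) - 1 := by ring
    have e4 : n + (-(M : ℤ) - 1) - 1 - 1 = n + (-M - 1) - 2 := by ring
    have e5 : n + (-(M : ℤ) - 1) - 1 - 2 = n + (-M - 1) - 3 := by ring
    rw [e1, e3, e4, e5] at hs
    rw [← sub_eq_iff_eq_add] at hs
    rw [← hs]
    push_cast
    module

/-- The non-commutative Wick formula
`[X_λ :ab:] = :[X_λ a]b: + (-1)^{p(X)p(a)} :a[X_λ b]: + ∫_0^λ [[X_λ a]_μ b] dμ`. -/
theorem OPE.wick {p q : ZMod 2} {X a b c0 c1 c2 c3 e0 e1 e2 e3 f00 f01 f02 f10 f11 f20 : D.Fld}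
    (hX : FieldParity p X) (hpa : FieldParity q a) (ha : IsField a) (hb : IsField b)
    (i0 : IsField c0) (i1 : IsField c1) (i2 : IsField c2) (i3 : IsField c3)
    (j0 : IsField e0) (j1 : IsField e1) (j2 : IsField e2) (j3 : IsField e3)
    (h1 : OPE X a c0 c1 c2 c3) (h2 : OPE X b e0 e1 e2 e3)
    (g0 : OPE c0 b f00 f01 f02 0) (g1 : OPE c1 b f10 f11 0 0)
    (g2 : OPE c2 b f20 0 0 0) (g3 : OPE c3 b 0 0 0 0) :
    OPE X (D.normalOrd a b)
      (D.normalOrd c0 b + sgn (p * q) • D.normalOrd a e0)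
      (D.normalOrd c1 b + sgn (p * q) • D.normalOrd a e1 + f00)
      (D.normalOrd c2 b + sgn (p * q) • D.normalOrd a e2 + f01 + (2 : ℂ) • f10)
      (D.normalOrd c3 b + sgn (p * q) • D.normalOrd a e3 + f02 + (3 : ℂ) • f11
        + (3 : ℂ) • f20) := by
  intro m n
  -- `[X_(m), Y(z)] = ∑ j, (m choose j) z^{m-j} d_j(z)`. In the Leibniz rule for `[X_(m), :ab:]` the
  -- powers of `z` have to be taken out of the normally ordered products; those in the first
  -- factor yield the integral term.
  have hs : ∀ {Y d0 d1 d2 d3 : D.Fld}, OPE X Y d0 d1 d2 d3 →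
      D.ad (X m) Y = shift m d0 + (m : ℂ) • shift (m - 1) d1
        + ((m : ℂ) * (m - 1) / 2) • shift (m - 2) d2
        + ((m : ℂ) * (m - 1) * (m - 2) / 6) • shift (m - 3) d3 := by
    intro Y d0 d1 d2 d3 h
    funext n
    have := h m n
    simp only [Pi.add_apply, Pi.smul_apply, shift]
    have k1 : n + (m - 1) = m + n - 1 := by ring
    have k2 : n + (m - 2) = m + n - 2 := by ring
    have k3 : n + (m - 3) = m + n - 3 := by ring
    rw [k1, k2, k3, add_comm n m]
    exact this
  have ht : (fun n => D.tw p (a n)) = sgn (p * q) • a := funext fun n => (hpa n).tw p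
  have hw := congrFun (superComm_normalOrd (hX m) ha hb) n
  rw [hs h1, hs h2, ht, normalOrd_smul_left] at hw
  rw [normalOrd_add_left (((i0.shift _).add ((i1.shift _).smul _)).add ((i2.shift _).smul _))
      ((i3.shift _).smul _) hb,
    normalOrd_add_left ((i0.shift _).add ((i1.shift _).smul _)) ((i2.shift _).smul _) hb,
    normalOrd_add_left (i0.shift _) ((i1.shift _).smul _) hb,
    normalOrd_add_right ha (((j0.shift _).add ((j1.shift _).smul _)).add ((j2.shift _).smul _))
      ((j3.shift _).smul _),
    normalOrd_add_right ha ((j0.shift _).add ((j1.shift _).smul _)) ((j2.shift _).smul _),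
    normalOrd_add_right ha (j0.shift _) ((j1.shift _).smul _)] at hw
  simp only [normalOrd_smul_left, normalOrd_smul_right, normalOrd_shift_right, Pi.add_apply,
    Pi.smul_apply, normalOrd_shift_left i0 hb g0, normalOrd_shift_left i1 hb g1,
    normalOrd_shift_left i2 hb g2, normalOrd_shift_left i3 hb g3, Pi.zero_apply, smul_zero,
    add_zero] at hw
  refine hw.trans ?_
  simp only [shift, Pi.add_apply, Pi.smul_apply]
  have k0 : n + m = m + n := by ring
  have k1 : n + (m - 1) = m + n - 1 := by ring
  have k2 : n + (m - 2) = m + n - 2 := by ring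
  have k3 : n + (m - 3) = m + n - 3 := by ring
  have k4 : m + n - 1 - 1 = m + n - 2 := by ring
  have k5 : m + n - 1 - 2 = m + n - 3 := by ring
  have k6 : m + n - 2 - 1 = m + n - 3 := by ring
  rw [k1, k2, k3, k0, k4, k5, k6]
  push_cast
  module

/-- The Wick formula for a field whose brackets with `a` and `b` are scalars. -/
theorem OPE.wick_scalar {p q : ZMod 2} {X a b : D.Fld} {β0 β1 γ0 γ1 : ℂ}
    (hX : FieldParity p X) (hpa : FieldParity q a) (ha : IsField a) (hb : IsField b)
    (h1 : OPE X a (β0 • D.one) (β1 • D.one) 0 0) (h2 : OPE X b (γ0 • D.one) (γ1 • D.one) 0 0) :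
    OPE X (D.normalOrd a b) (β0 • b + (sgn (p * q) * γ0) • a)
      (β1 • b + (sgn (p * q) * γ1) • a) 0 0 := by
  have s0 : ∀ c : ℂ, OPE (c • D.one) b 0 0 0 0 := fun c => by
    simpa using (OPE.one_left b).smul_left c
  have z : OPE (0 : D.Fld) b 0 0 0 0 := OPE.zero_left b
  refine (OPE.wick hX hpa ha hb (isField_one.smul _) (isField_one.smul _) IsField.zero
    IsField.zero (isField_one.smul _) (isField_one.smul _) IsField.zero IsField.zero h1 h2
    (s0 _) (s0 _) z z).congr ?_ ?_ ?_ ?_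
  · simp only [normalOrd_smul_left, normalOrd_smul_right, normalOrd_one_left, normalOrd_one_right,
      smul_smul]
  · simp only [normalOrd_smul_left, normalOrd_smul_right, normalOrd_one_left, normalOrd_one_right,
      smul_smul, add_zero]
  · simp [normalOrd_zero_left, normalOrd_zero_right]
  · simp [normalOrd_zero_left, normalOrd_zero_right]

/-- The Wick formula for an even field `L` and two fields `a`, `b` of conformal weights `Δ`, `Δ'`
(not necessarily primary) with respect to `L`. -/
theorem OPE.wick_weight {q : ZMod 2} {L a b A B f0 : D.Fld} {Δ Δ' γ ε : ℂ}
    (hL : FieldParity 0 L) (hpa : FieldParity q a) (ha : IsField a) (hb : IsField b)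
    (hA : IsField A) (hB : IsField B)
    (h1 : OPE L a (D.deriv a) (Δ • a) A 0) (h2 : OPE L b (D.deriv b) (Δ' • b) B 0)
    (g0 : OPE a b f0 (γ • D.one) 0 0) (g2 : OPE A b (ε • D.one) 0 0 0) :
    OPE L (D.normalOrd a b) (D.deriv (D.normalOrd a b)) ((Δ + Δ') • D.normalOrd a b)
      (D.normalOrd A b + D.normalOrd a B + (2 * Δ - 1) • f0)
      (((3 * Δ - 2) * γ + 3 * ε) • D.one) := by
  have d0 : OPE (D.deriv a) b 0 (-f0) ((-2 : ℂ) • γ • D.one) 0 := by simpa using g0.deriv_left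
  have d1 : OPE (Δ • a) b (Δ • f0) (Δ • γ • D.one) 0 0 := by simpa using g0.smul_left Δ
  refine (OPE.wick hL hpa ha hb ha.deriv (ha.smul _) hA IsField.zero
    hb.deriv (hb.smul _) hB IsField.zero h1 h2 d0 d1 g2 (OPE.zero_left b)).congr ?_ ?_ ?_ ?_
  · rw [zero_mul, sgn_zero, one_smul, deriv_normalOrd ha hb]
  · rw [zero_mul, sgn_zero, normalOrd_smul_left, normalOrd_smul_right]
    module
  · rw [zero_mul, sgn_zero]
    module
  · rw [zero_mul, sgn_zero, normalOrd_zero_left, normalOrd_zero_right]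
    module

/-! ### Virasoro fields -/

/-- If `[L_λ L] = (∂ + 2λ) L + λ² Y / 2 + λ³ c / 6` then `Y = 0`, by skew-symmetry. -/
theorem OPE.eq_zero_of_even {L Y : D.Fld} {c : ℂ} (hL : FieldParity 0 L)
    (h : OPE L L (D.deriv L) ((2 : ℂ) • L) Y (c • D.one)) : Y = 0 := by
  funext t
  -- the coefficient of `Y_(t)` in `[L_(m), L_(n)] + [L_(n), L_(m)] = 0` for `m = -1`, `n = t + 3`
  have e : D.superComm (L (-1)) (L (t + 3)) + D.superComm (L (t + 3)) (L (-1)) = 0 := by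
    rw [superComm_eq (hL _), superComm_eq (hL _), tw_zero, tw_zero]
    abel
  rw [h, h] at e
  have k1 : t + 3 + -1 = t + 2 := by ring
  have k2 : -1 + (t + 3) = t + 2 := by ring
  have k3 : t + 2 - 1 = t + 1 := by ring
  have k4 : t + 2 - 2 = t := by ring
  rw [k1, k2] at e
  simp only [deriv_apply, Pi.smul_apply, one, k3, k4] at e
  -- `4 ((t + 3) (t + 2) + 2) = (2 t + 5)² + 7`
  have hpos : (2 : ℂ) + (t + 3) * (t + 2) ≠ 0 := by
    have h0 : (2 : ℤ) + (t + 3) * (t + 2) ≠ 0 := by nlinarith [sq_nonneg (2 * t + 5)]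
    exact_mod_cast h0
  have e' : (((2 : ℂ) + (t + 3) * (t + 2)) / 2) • Y t = 0 := by
    by_cases ht : t + 2 - 3 = -1
    · have h0 : t = 0 := by omega
      subst h0
      rw [← e, if_pos ht]
      push_cast
      module
    · rw [← e, if_neg ht]
      push_cast
      module
  rw [smul_eq_zero] at e'
  exact e'.resolve_left (div_ne_zero hpos two_ne_zero)

/-- The coefficient of `c_i` in `X_(n) Y` is the `n`-th difference at `0` of the polynomial
`t choose i`, thus `δ_{n,i}`. -/
theorem nprod_eq_of_OPE {X Y c0 c1 c2 c3 : D.Fld} (h : OPE X Y c0 c1 c2 c3) (n : ℕ) (m : ℤ) :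
    D.nprod n X Y m
      = (∑ j ∈ Finset.range (n + 1), (-1 : ℂ) ^ j * (n.choose j : ℂ)) • c0 (m + n)
      + (∑ j ∈ Finset.range (n + 1), (-1 : ℂ) ^ j * (n.choose j : ℂ) * (n - j)) • c1 (m + n - 1)
      + (∑ j ∈ Finset.range (n + 1), (-1 : ℂ) ^ j * (n.choose j : ℂ)
          * ((n - j) * (n - j - 1) / 2)) • c2 (m + n - 2)
      + (∑ j ∈ Finset.range (n + 1), (-1 : ℂ) ^ j * (n.choose j : ℂ)
          * ((n - j) * (n - j - 1) * (n - j - 2) / 6)) • c3 (m + n - 3) := by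
  change ∑ j ∈ Finset.range (n + 1), ((-1 : ℂ) ^ j * (n.choose j : ℂ)) •
    D.superComm (X ((n : ℤ) - j)) (Y (m + j)) = _
  simp only [Finset.sum_smul, ← Finset.sum_add_distrib]
  refine Finset.sum_congr rfl fun j _ => ?_
  rw [h]
  have k : (n : ℤ) - j + (m + j) = m + n := by ring
  rw [k]
  push_cast
  module

/-- The `n`-th difference of a polynomial of degree less than `n` vanishes. -/
theorem sum_neg_one_pow_mul_choose_eq_zero {n : ℕ} (P : Polynomial ℂ) (hP : P.natDegree < n) :
    ∑ j ∈ Finset.range (n + 1), (-1 : ℂ) ^ j * (n.choose j : ℂ) * P.eval ((n : ℂ) - j) = 0 := by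
  have h := congrFun (Polynomial.fwdDiff_iter_eq_zero_of_degree_lt hP) 0
  rw [fwdDiff_iter_eq_sum_shift, ← Finset.sum_range_reflect] at h
  rw [Pi.zero_apply] at h
  rw [← h]
  refine Finset.sum_congr rfl fun j hj => ?_
  rw [Finset.mem_range] at hj
  have e1 : n + 1 - 1 - j = n - j := by omega
  have e2 : n - (n - j) = j := by omega
  rw [e1, e2, Nat.choose_symm (by omega)]
  simp only [zsmul_eq_mul, nsmul_eq_mul, mul_one, zero_add]
  rw [Nat.cast_sub (by omega)]
  push_cast
  ring

theorem nprod_eq_zero_of_OPE {X Y c0 c1 c2 c3 : D.Fld} (h : OPE X Y c0 c1 c2 c3) {n : ℤ}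
    (hn : 4 ≤ n) : D.nprod n X Y = 0 := by
  lift n to ℕ using by omega
  funext m
  rw [nprod_eq_of_OPE h]
  have h0 := sum_neg_one_pow_mul_choose_eq_zero (n := n) 1 (by
    rw [Polynomial.natDegree_one]; omega)
  have h1 := sum_neg_one_pow_mul_choose_eq_zero (n := n) Polynomial.X (by
    rw [Polynomial.natDegree_X]; omega)
  have h2 := sum_neg_one_pow_mul_choose_eq_zero (n := n)
    (Polynomial.C (1 / 2) * (Polynomial.X * (Polynomial.X - 1))) (by
      refine lt_of_le_of_lt (b := 2) (by compute_degree) (by omega))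
  have h3 := sum_neg_one_pow_mul_choose_eq_zero (n := n)
    (Polynomial.C (1 / 6) * (Polynomial.X * (Polynomial.X - 1) * (Polynomial.X - 2))) (by
      refine lt_of_le_of_lt (b := 3) (by compute_degree) (by omega))
  simp only [Polynomial.eval_mul, Polynomial.eval_C, Polynomial.eval_X, Polynomial.eval_sub,
    Polynomial.eval_one, Polynomial.eval_ofNat, mul_one] at h0 h1 h2 h3
  have h2' : ∑ j ∈ Finset.range (n + 1), (-1 : ℂ) ^ j * (n.choose j : ℂ)
      * (((n : ℂ) - j) * (n - j - 1) / 2) = 0 := by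
    rw [← h2]; exact Finset.sum_congr rfl fun j _ => by ring
  have h3' : ∑ j ∈ Finset.range (n + 1), (-1 : ℂ) ^ j * (n.choose j : ℂ)
      * (((n : ℂ) - j) * (n - j - 1) * (n - j - 2) / 6) = 0 := by
    rw [← h3]; exact Finset.sum_congr rfl fun j _ => by ring
  rw [h0, h1, h2', h3']
  simp

theorem nprod_zero_of_OPE {X Y c0 c1 c2 c3 : D.Fld} (h : OPE X Y c0 c1 c2 c3) :
    D.nprod 0 X Y = c0 := by
  funext m
  have e := nprod_eq_of_OPE h 0 m
  norm_num [Finset.sum_range_succ, Nat.choose] at e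
  exact e

theorem nprod_one_of_OPE {X Y c0 c1 c2 c3 : D.Fld} (h : OPE X Y c0 c1 c2 c3) :
    D.nprod 1 X Y = c1 := by
  funext m
  have e := nprod_eq_of_OPE h 1 m
  norm_num [Finset.sum_range_succ, Nat.choose] at e
  exact e

theorem nprod_two_of_OPE {X Y c0 c1 c2 c3 : D.Fld} (h : OPE X Y c0 c1 c2 c3) :
    D.nprod 2 X Y = c2 := by
  funext m
  have e := nprod_eq_of_OPE h 2 m
  norm_num [Finset.sum_range_succ, Nat.choose] at e
  exact e

theorem nprod_three_of_OPE {X Y c0 c1 c2 c3 : D.Fld} (h : OPE X Y c0 c1 c2 c3) :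
    D.nprod 3 X Y = c3 := by
  funext m
  have e := nprod_eq_of_OPE h 3 m
  norm_num [Finset.sum_range_succ, Nat.choose] at e
  exact e

/-- The coefficients of an operator product expansion are polynomials of degree at most `3` in the
index of `X`; the fourth difference annihilates them. -/
theorem OPE.isLocal {X Y c0 c1 c2 c3 : D.Fld} (h : OPE X Y c0 c1 c2 c3) : D.IsLocal X Y := by
  refine ⟨4, fun m n => ?_⟩
  have e : ∀ j : ℕ, D.superComm (X (m + (4 : ℕ) - j)) (Y (n + j)) = c0 (m + n + 4)
      + ((m : ℂ) + 4 - j) • c1 (m + n + 3)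
      + (((m : ℂ) + 4 - j) * (m + 4 - j - 1) / 2) • c2 (m + n + 2)
      + (((m : ℂ) + 4 - j) * (m + 4 - j - 1) * (m + 4 - j - 2) / 6) • c3 (m + n + 1) := by
    intro j
    have k0 : m + (4 : ℕ) - j + (n + j) = m + n + 4 := by push_cast; ring
    have k1 : m + n + 4 - 1 = m + n + 3 := by ring
    have k2 : m + n + 4 - 2 = m + n + 2 := by ring
    have k3 : m + n + 4 - 3 = m + n + 1 := by ring
    rw [h, k0, k1, k2, k3]
    push_cast
    rfl
  simp only [e, Finset.sum_range_succ, Finset.sum_range_zero]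
  norm_num [Nat.choose]
  module

end ReductionData

/-! ### Dual families of a bilinear form -/

section DualPair

variable {V ι κ W : Type*} [AddCommGroup V] [Module ℂ V] [AddCommGroup W] [Module ℂ W]
  [Fintype ι] [Fintype κ]

omit [Fintype ι] in
/-- For a nondegenerate form on a finite-dimensional space the dual family exists, so that
`dualFamily` has its defining property. -/
theorem dualFamily_spec [DecidableEq ι] [FiniteDimensional ℂ V] {B : V →ₗ[ℂ] V →ₗ[ℂ] ℂ}
    (hB : B.SeparatingRight) (b : Module.Basis ι ℂ V) (i j : ι) :
    B (b i) (dualFamily B b j) = if i = j then 1 else 0 := by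
  have hinj : Function.Injective B.flip := by
    rw [injective_iff_map_eq_zero]
    intro y hy
    exact hB y fun v => by simpa using LinearMap.congr_fun hy v
  have hsurj : Function.Surjective B.flip :=
    (LinearMap.injective_iff_surjective_of_finrank_eq_finrank
      (Subspace.dual_finrank_eq (K := ℂ) (V := V)).symm).mp hinj
  have hex : ∃ b' : ι → V, ∀ i j, B (b i) (b' j) = if i = j then 1 else 0 := by
    choose b' hb' using fun j => hsurj (b.coord j)
    refine ⟨b', fun i j => ?_⟩
    have h := LinearMap.congr_fun (hb' j) (b i)
    rw [LinearMap.flip_apply] at h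
    rw [h, Module.Basis.coord_apply, Module.Basis.repr_self, Finsupp.single_apply]
  exact Classical.epsilon_spec hex i j

/-- `a` and `a'` are dual families for `B`, in terms of the expansions of vectors that they
provide. -/
structure IsDualPair (B : V →ₗ[ℂ] V →ₗ[ℂ] ℂ) (a a' : ι → V) : Prop where
  expand_left : ∀ v, ∑ i, B v (a' i) • a i = v
  expand_right : ∀ v, ∑ i, B (a i) v • a' i = v

theorem isDualPair_of_basis [DecidableEq ι] {B : V →ₗ[ℂ] V →ₗ[ℂ] ℂ} (hB : B.SeparatingRight)
    (a : Module.Basis ι ℂ V) {a' : ι → V} (h : ∀ i j, B (a i) (a' j) = if i = j then 1 else 0) :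
    IsDualPair B a a' where
  expand_left v := by
    have hv : ∀ i, B v (a' i) = a.repr v i := by
      classical
      intro i
      have hl : B.flip (a' i) = a.coord i := a.ext fun j => by
        rw [LinearMap.flip_apply, h, Module.Basis.coord_apply, Module.Basis.repr_self,
          Finsupp.single_apply]
      exact LinearMap.congr_fun hl v
    simp only [hv, a.sum_repr]
  expand_right y := by
    rw [← sub_eq_zero]
    refine hB _ fun v => ?_
    have hz : B.flip (∑ i, B (a i) y • a' i - y) = 0 := a.ext fun j => by
      rw [LinearMap.flip_apply, map_sub, map_sum]
      simp [h]
    exact LinearMap.congr_fun hz v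

/-- The element `∑ a_i ⊗ a^i` does not depend on the pair of dual families. -/
theorem IsDualPair.sum_eq {B : V →ₗ[ℂ] V →ₗ[ℂ] ℂ} {a a' : ι → V} {b b' : κ → V}
    (ha : IsDualPair B a a') (hb : IsDualPair B b b') (F : V →ₗ[ℂ] V →ₗ[ℂ] W) :
    ∑ i, F (a i) (a' i) = ∑ j, F (b j) (b' j) := by
  have h1 : ∀ i, F (a i) (a' i) = ∑ j, F (b j) (B (a i) (b' j) • a' i) := by
    intro i
    conv_lhs => rw [← hb.expand_left (a i)]
    simp
  simp only [h1]
  rw [Finset.sum_comm]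
  refine Finset.sum_congr rfl fun j _ => ?_
  rw [← map_sum, ha.expand_right]

end DualPair

namespace ReductionData

variable {g : Type*} [AddCommGroup g] [Module ℂ g] {D : ReductionData g}

/-! ### Linear algebra of the Lie superalgebra -/

theorem exists_part_add (a : g) : ∃ b ∈ part D.Γ 0, ∃ c ∈ part D.Γ 1, a = b + c := by
  refine ⟨(1 / 2 : ℂ) • (a + D.Γ a), ?_, (1 / 2 : ℂ) • (a - D.Γ a), ?_, by module⟩
  · rw [mem_part_iff, sgn_zero, map_smul, map_add, D.Γ_Γ]
    module
  · rw [mem_part_iff, sgn_one, map_smul, map_sub, D.Γ_Γ]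
    module

theorem bracket_mem_part {p q : ZMod 2} {a b : g} (ha : a ∈ part D.Γ p) (hb : b ∈ part D.Γ q) :
    D.bracket a b ∈ part D.Γ (p + q) := by
  rw [mem_part_iff] at *
  rw [D.Γ_bracket, ha, hb, sgn_add]
  simp [smul_smul, mul_comm]

theorem form_eq_zero_of_parity {p q : ZMod 2} {a b : g} (ha : a ∈ part D.Γ p)
    (hb : b ∈ part D.Γ q) (h : p ≠ q) : D.form a b = 0 := by
  have e := D.form_even a b
  rw [mem_part_iff] at ha hb
  have hs : sgn p * sgn q = -1 := by
    rcases parity_cases p with rfl | rfl <;> rcases parity_cases q with rfl | rfl <;>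
      simp_all [sgn_zero, sgn_one]
  rw [ha, hb] at e
  simp only [map_smul, LinearMap.smul_apply, smul_eq_mul, ← mul_assoc] at e
  rw [mul_comm (sgn q), hs] at e
  linear_combination (-1 / 2 : ℂ) * e

theorem form_comm {p : ZMod 2} {a : g} (ha : a ∈ part D.Γ p) (b : g) :
    D.form a b = sgn p * D.form b a := by
  have key : ∀ q, ∀ b ∈ part D.Γ q, D.form a b = sgn p * D.form b a := by
    intro q b hb
    by_cases h : p = q
    · subst h
      rw [D.form_symm p p a ha b hb, sgn_mul_self]
    · rw [form_eq_zero_of_parity ha hb h, form_eq_zero_of_parity hb ha (Ne.symm h), mul_zero]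
  obtain ⟨b0, h0, b1, h1, rfl⟩ := D.exists_part_add b
  rw [map_add, key 0 b0 h0, key 1 b1 h1, map_add, LinearMap.add_apply]
  ring

theorem x_mem_part : D.x ∈ part D.Γ 0 := by
  rw [mem_part_iff, D.x_even, sgn_zero, one_smul]

theorem f_mem_part : D.f ∈ part D.Γ 0 := by
  rw [mem_part_iff, D.f_even, sgn_zero, one_smul]

theorem bracket_comm_of_even (a : g) {b : g} (hb : b ∈ part D.Γ 0) :
    D.bracket a b = -D.bracket b a := by
  obtain ⟨a0, h0, a1, h1, rfl⟩ := D.exists_part_add a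
  have e0 := D.skew 0 0 a0 h0 b hb
  have e1 := D.skew 1 0 a1 h1 b hb
  rw [mul_zero, sgn_zero, one_smul] at e0 e1
  rw [map_add, LinearMap.add_apply, e0, e1, map_add, neg_add]

theorem mem_gr_iff {j : ℚ} {a : g} : a ∈ D.gr j ↔ D.bracket D.x a = (j : ℂ) • a :=
  Module.End.mem_eigenspace_iff

theorem form_eq_zero_of_gr {i j : ℚ} {a b : g} (ha : a ∈ D.gr i) (hb : b ∈ D.gr j)
    (h : i + j ≠ 0) : D.form a b = 0 := by
  have e := D.form_invariant a D.x b
  rw [bracket_comm_of_even a x_mem_part, mem_gr_iff.mp ha, mem_gr_iff.mp hb] at e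
  simp only [map_neg, map_smul, LinearMap.neg_apply, LinearMap.smul_apply, smul_eq_mul] at e
  have e2 : ((i + j : ℚ) : ℂ) * D.form a b = 0 := by
    push_cast
    linear_combination -e
  exact (mul_eq_zero.mp e2).resolve_left (by exact_mod_cast h)

theorem bracket_mem_gr {i j : ℚ} {a b : g} (ha : a ∈ D.gr i) (hb : b ∈ D.gr j) :
    D.bracket a b ∈ D.gr (i + j) := by
  rw [mem_gr_iff] at ha hb ⊢
  have e : D.bracket D.x (D.bracket a b)
      = D.bracket (D.bracket D.x a) b + D.bracket a (D.bracket D.x b) := by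
    obtain ⟨a0, h0, a1, h1, h⟩ := D.exists_part_add a
    have e0 := D.jacobi 0 0 D.x x_mem_part a0 h0 b
    have e1 := D.jacobi 0 1 D.x x_mem_part a1 h1 b
    rw [zero_mul, sgn_zero, one_smul] at e0 e1
    subst h
    simp only [map_add, LinearMap.add_apply, e0, e1]
    abel
  rw [e, ha, hb]
  simp only [map_smul, LinearMap.smul_apply]
  push_cast
  module

theorem x_mem_gr : D.x ∈ D.gr 0 := by
  rw [mem_gr_iff]
  have h := bracket_comm_of_even D.x (D.x_mem_part)
  have h2 : (2 : ℂ) • D.bracket D.x D.x = 0 := by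
    rw [two_smul]
    nth_rewrite 1 [h]
    abel
  rw [(smul_eq_zero.mp h2).resolve_left two_ne_zero]
  simp

theorem f_mem_gr : D.f ∈ D.gr (-1) := by
  rw [mem_gr_iff, D.bracket_x_f]
  simp

namespace HomogeneousBasis

variable {ι : Type*} (B : D.HomogeneousBasis ι)

theorem repr_eq_zero_of_mem_gr {j : ℚ} {a : g} (ha : a ∈ D.gr j) {i : ι} (h : B.deg i ≠ j) :
    B.u.repr a i = 0 := by
  have hl : B.u.coord i ∘ₗ D.bracket D.x = (B.deg i : ℂ) • B.u.coord i := by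
    refine B.u.ext fun l => ?_
    have e := mem_gr_iff.mp (B.mem_gr l)
    simp only [LinearMap.comp_apply, e, map_smul, LinearMap.smul_apply, Module.Basis.coord_apply,
      Module.Basis.repr_self, smul_eq_mul]
    by_cases hli : l = i
    · rw [hli]
    · rw [Finsupp.single_eq_of_ne (Ne.symm hli), mul_zero, mul_zero]
  have e := LinearMap.congr_fun hl a
  simp only [LinearMap.comp_apply, mem_gr_iff.mp ha, map_smul, LinearMap.smul_apply,
    Module.Basis.coord_apply, smul_eq_mul] at e
  have e2 : ((B.deg i - j : ℚ) : ℂ) * B.u.repr a i = 0 := by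
    push_cast
    linear_combination -e
  exact (mul_eq_zero.mp e2).resolve_left (by exact_mod_cast sub_ne_zero.mpr h)

theorem repr_Γ (a : g) (i : ι) : B.u.repr (D.Γ a) i = sgn (B.parity i) * B.u.repr a i := by
  have hl : B.u.coord i ∘ₗ D.Γ = sgn (B.parity i) • B.u.coord i := by
    refine B.u.ext fun l => ?_
    have e := mem_part_iff.mp (B.mem_part l)
    simp only [LinearMap.comp_apply, e, map_smul, LinearMap.smul_apply, Module.Basis.coord_apply,
      Module.Basis.repr_self, smul_eq_mul]
    by_cases hli : l = i
    · rw [hli]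
    · rw [Finsupp.single_eq_of_ne (Ne.symm hli), mul_zero, mul_zero]
  exact LinearMap.congr_fun hl a

theorem mem_part_iff_repr {p : ZMod 2} {a : g} :
    a ∈ part D.Γ p ↔ ∀ i, B.parity i ≠ p → B.u.repr a i = 0 := by
  rw [mem_part_iff, ← B.u.repr.injective.eq_iff, Finsupp.ext_iff]
  refine forall_congr' fun i => ?_
  rw [repr_Γ, map_smul, Finsupp.smul_apply, smul_eq_mul]
  by_cases h : B.parity i = p
  · simp [h]
  · have hs : sgn (B.parity i) = -sgn p := by
      rcases parity_cases (B.parity i) with hi | hi <;> rcases parity_cases p with rfl | rfl <;>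
        simp_all [sgn_zero, sgn_one]
    have hp : sgn p ≠ 0 := by
      rcases parity_cases p with rfl | rfl <;> simp [sgn_zero, sgn_one]
    simp only [h, ne_eq, not_false_eq_true, forall_true_left, hs]
    constructor
    · intro e
      have e2 : sgn p * B.u.repr a i = 0 := by linear_combination (-1 / 2 : ℂ) * e
      exact (mul_eq_zero.mp e2).resolve_left hp
    · intro e
      simp [e]

theorem c_eq_zero_of_deg {i j l : ι} (h : B.deg l ≠ B.deg i + B.deg j) : B.c i j l = 0 :=
  B.repr_eq_zero_of_mem_gr (bracket_mem_gr (B.mem_gr i) (B.mem_gr j)) h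

theorem c_eq_zero_of_parity {i j l : ι} (h : B.parity l ≠ B.parity i + B.parity j) :
    B.c i j l = 0 :=
  B.mem_part_iff_repr.mp (bracket_mem_part (B.mem_part i) (B.mem_part j)) l h

variable [Fintype ι]

/-- The dimension of the subspace spanned by the basis vectors `u_i` with `Q i`. -/
theorem finrank_eq_card {W : Submodule ℂ g} {Q : ι → Prop} [DecidablePred Q]
    (h : ∀ a, a ∈ W ↔ ∀ i, ¬Q i → B.u.repr a i = 0) :
    Module.finrank ℂ W = Fintype.card {i // Q i} := by
  have hW : W = Submodule.span ℂ (Set.range fun i : {i // Q i} => B.u i) := by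
    ext a
    have hr : (Set.range fun i : {i // Q i} => B.u i) = B.u '' {i | Q i} := by
      ext v
      simp
    rw [h, hr, Module.Basis.mem_span_image]
    constructor
    · intro ha i hi
      by_contra hq
      exact (Finsupp.mem_support_iff.mp hi) (ha i hq)
    · intro ha i hi
      by_contra hne
      exact hi (ha (Finsupp.mem_support_iff.mpr hne))
  rw [hW]
  exact finrank_span_eq_card (B.u.linearIndependent.comp _ Subtype.val_injective)

/-- The superdimension of the subspace spanned by the basis vectors `u_i` with `Q i`. -/
theorem sdim_eq_sum {W : Submodule ℂ g} {Q : ι → Prop} [DecidablePred Q]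
    (h : ∀ a, a ∈ W ↔ ∀ i, ¬Q i → B.u.repr a i = 0) :
    sdim D.Γ W = ∑ i : {i // Q i}, sgn (B.parity i) := by
  have hf : ∀ p, Module.finrank ℂ (W ⊓ part D.Γ p : Submodule ℂ g)
      = Fintype.card {i // Q i ∧ B.parity i = p} := by
    intro p
    refine B.finrank_eq_card fun a => ?_
    rw [Submodule.mem_inf, h, B.mem_part_iff_repr]
    constructor
    · rintro ⟨h1, h2⟩ i hi
      by_cases hq : Q i
      · exact h2 i fun hp => hi ⟨hq, hp⟩
      · exact h1 i hq
    · intro h1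
      exact ⟨fun i hi => h1 i fun hq => hi hq.1, fun i hi => h1 i fun hq => hi hq.2⟩
  rw [sdim, hf, hf, Fintype.card_subtype, Fintype.card_subtype, Finset.natCast_card_filter,
    Finset.natCast_card_filter, ← Finset.sum_subtype (Finset.univ.filter Q) (by simp)
      fun i => sgn (B.parity i), Finset.sum_filter, ← Finset.sum_sub_distrib]
  refine Finset.sum_congr rfl fun i _ => ?_
  rcases parity_cases (B.parity i) with hi | hi <;> by_cases hq : Q i <;>
    simp [hi, hq, sgn_zero, sgn_one]

/-! ### Dual bases and the Casimir operator -/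

variable [DecidableEq ι] [FiniteDimensional ℂ g]

/-- The basis dual to `u` with respect to the invariant form. -/
def ud (i : ι) : g := dualFamily D.form B.u i

omit [Fintype ι] in
theorem form_u_ud (i j : ι) : D.form (B.u i) (B.ud j) = if i = j then 1 else 0 :=
  dualFamily_spec D.form_nondegenerate.2 B.u i j

theorem isDualPair_u_ud : IsDualPair D.form B.u B.ud :=
  isDualPair_of_basis D.form_nondegenerate.2 B.u B.form_u_ud

omit [Fintype ι] [DecidableEq ι] [FiniteDimensional ℂ g] in
theorem eq_of_form_u {a b : g} (h : ∀ i, D.form (B.u i) a = D.form (B.u i) b) : a = b := by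
  have e : D.form.flip a = D.form.flip b := B.u.ext h
  rw [← sub_eq_zero]
  refine D.form_nondegenerate.2 _ fun v => ?_
  rw [map_sub, sub_eq_zero]
  exact LinearMap.congr_fun e v

omit [Fintype ι] in
theorem ud_mem_part (i : ι) : B.ud i ∈ part D.Γ (B.parity i) := by
  rw [mem_part_iff]
  refine B.eq_of_form_u fun j => ?_
  have e := D.form_even (B.u j) (D.Γ (B.ud i))
  rw [D.Γ_Γ, mem_part_iff.mp (B.mem_part j)] at e
  rw [← e, map_smul, map_smul, LinearMap.smul_apply, form_u_ud]
  by_cases h : j = i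
  · rw [h]
  · simp [h]

omit [Fintype ι] in
theorem ud_mem_gr (i : ι) : B.ud i ∈ D.gr (-B.deg i) := by
  rw [mem_gr_iff]
  refine B.eq_of_form_u fun j => ?_
  rw [← D.form_invariant, bracket_comm_of_even _ x_mem_part, mem_gr_iff.mp (B.mem_gr j), map_neg,
    map_smul, map_smul, LinearMap.neg_apply, LinearMap.smul_apply, form_u_ud]
  by_cases h : j = i
  · rw [h]; push_cast; simp
  · simp [h]

theorem isDualPair_ud_u : IsDualPair D.form B.ud fun i => sgn (B.parity i) • B.u i where
  expand_left v := by
    refine Eq.trans (Finset.sum_congr rfl fun i _ => ?_) (B.isDualPair_u_ud.expand_right v)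
    rw [form_comm (B.mem_part i), map_smul, smul_eq_mul]
  expand_right v := by
    refine Eq.trans (Finset.sum_congr rfl fun i _ => ?_) (B.isDualPair_u_ud.expand_left v)
    rw [form_comm (B.ud_mem_part i), smul_smul, mul_right_comm, sgn_mul_sgn_self, one_mul]

variable {W : Type*} [AddCommGroup W] [Module ℂ W]

/-- The supersymmetry of the Casimir element. -/
theorem sum_sgn_u_ud (F : g →ₗ[ℂ] g →ₗ[ℂ] W) :
    ∑ i, sgn (B.parity i) • F (B.u i) (B.ud i) = ∑ i, F (B.ud i) (B.u i) := by
  have h := B.isDualPair_u_ud.sum_eq B.isDualPair_ud_u (F ∘ₗ D.Γ)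
  simp only [LinearMap.comp_apply, mem_part_iff.mp (B.mem_part _),
    mem_part_iff.mp (B.ud_mem_part _), map_smul, LinearMap.smul_apply, smul_smul,
    sgn_mul_sgn_self, one_smul] at h
  exact h

/-- The invariance of the Casimir element. -/
theorem sum_bracket_u_ud {p : ZMod 2} {a : g} (ha : a ∈ part D.Γ p) (F : g →ₗ[ℂ] g →ₗ[ℂ] W) :
    ∑ i, sgn (B.parity i) • (F (D.bracket a (B.u i)) (B.ud i)
      + sgn (p * B.parity i) • F (B.u i) (D.bracket a (B.ud i))) = 0 := by
  have h1 : ∀ i, F (D.bracket a (B.u i)) (B.ud i)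
      = ∑ j, D.form (D.bracket a (B.u i)) (B.ud j) • F (B.u j) (B.ud i) := by
    intro i
    conv_lhs => rw [← B.isDualPair_u_ud.expand_left (D.bracket a (B.u i))]
    simp
  have h2 : ∀ j, F (B.u j) (D.bracket a (B.ud j))
      = ∑ i, (-(sgn (p * B.parity i) * D.form (D.bracket a (B.u i)) (B.ud j)))
        • F (B.u j) (B.ud i) := by
    intro j
    conv_lhs => rw [← B.isDualPair_u_ud.expand_right (D.bracket a (B.ud j))]
    rw [map_sum]
    refine Finset.sum_congr rfl fun i _ => ?_
    rw [map_smul, ← D.form_invariant, D.skew _ _ _ (B.mem_part i) _ ha, map_neg, map_smul,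
      LinearMap.neg_apply, LinearMap.smul_apply, smul_eq_mul, mul_comm p]
  simp only [smul_add, Finset.sum_add_distrib, h1, h2, Finset.smul_sum]
  rw [Finset.sum_comm, ← Finset.sum_add_distrib]
  refine Finset.sum_eq_zero fun j _ => ?_
  rw [← Finset.sum_add_distrib]
  refine Finset.sum_eq_zero fun i _ => ?_
  by_cases hp : B.parity j = p + B.parity i
  · rw [hp, smul_smul, smul_smul, smul_smul, ← add_smul]
    have hs : sgn (p * B.parity i) * sgn (p * B.parity i) = 1 := sgn_mul_sgn_self _
    have hs' : sgn p * sgn p = 1 := sgn_mul_sgn_self _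
    rw [mul_add, sgn_add, sgn_add, sgn_mul_self]
    convert zero_smul ℂ _
    linear_combination (-(sgn (B.parity i) * D.form (D.bracket a (B.u i)) (B.ud j)
      * sgn p * sgn p)) * hs
      - (sgn (B.parity i) * D.form (D.bracket a (B.u i)) (B.ud j)) * hs'
  · have h0 : D.form (D.bracket a (B.u i)) (B.ud j) = 0 :=
      form_eq_zero_of_parity (bracket_mem_part ha (B.mem_part i)) (B.ud_mem_part j) (Ne.symm hp)
    simp [h0]

/-- By the supersymmetry of the Casimir element the sum equals `∑ [u^i, u_i]`, which is its
negative by skew-symmetry. -/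
theorem sum_sgn_bracket_u_ud : ∑ i, sgn (B.parity i) • D.bracket (B.u i) (B.ud i) = 0 := by
  have h := B.sum_sgn_u_ud D.bracket
  have e : ∑ i, D.bracket (B.ud i) (B.u i)
      = -∑ i, sgn (B.parity i) • D.bracket (B.u i) (B.ud i) := by
    rw [← Finset.sum_neg_distrib]
    refine Finset.sum_congr rfl fun i _ => ?_
    rw [D.skew _ _ _ (B.ud_mem_part i) _ (B.mem_part i), sgn_mul_self]
  rw [e] at h
  have h2 : (2 : ℂ) • ∑ i, sgn (B.parity i) • D.bracket (B.u i) (B.ud i) = 0 := by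
    rw [two_smul]
    nth_rewrite 1 [h]
    abel
  exact (smul_eq_zero.mp h2).resolve_left two_ne_zero

/-- The supertrace of `ad x` vanishes. -/
theorem sum_sgn_mul_deg : ∑ i, sgn (B.parity i) * (B.deg i : ℂ) = 0 := by
  have h := B.sum_sgn_u_ud (D.form ∘ₗ D.bracket D.x)
  have e1 : ∀ i, D.form (D.bracket D.x (B.u i)) (B.ud i) = B.deg i := by
    intro i
    rw [mem_gr_iff.mp (B.mem_gr i), map_smul, LinearMap.smul_apply, form_u_ud]
    simp
  have e2 : ∀ i, D.form (D.bracket D.x (B.ud i)) (B.u i) = -(sgn (B.parity i) * B.deg i) := by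
    intro i
    rw [mem_gr_iff.mp (B.ud_mem_gr i), map_smul, LinearMap.smul_apply,
      form_comm (B.ud_mem_part i), form_u_ud]
    push_cast
    simp [mul_comm]
  simp only [LinearMap.comp_apply, e1, e2, smul_eq_mul, Finset.sum_neg_distrib] at h
  linear_combination (1 / 2 : ℂ) * h

/-- The Casimir operator of the adjoint representation. -/
def casimir : g →ₗ[ℂ] g :=
  ∑ i, sgn (B.parity i) • (D.bracket (B.u i) ∘ₗ D.bracket (B.ud i))

omit [FiniteDimensional ℂ g] in
theorem casimir_apply (v : g) :
    B.casimir v = ∑ i, sgn (B.parity i) • D.bracket (B.u i) (D.bracket (B.ud i) v) := by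
  simp [casimir, LinearMap.sum_apply]

theorem casimir_Γ (v : g) : B.casimir (D.Γ v) = D.Γ (B.casimir v) := by
  rw [casimir_apply, casimir_apply, map_sum]
  refine Finset.sum_congr rfl fun i _ => ?_
  rw [map_smul, D.Γ_bracket, D.Γ_bracket, mem_part_iff.mp (B.mem_part i),
    mem_part_iff.mp (B.ud_mem_part i)]
  simp only [map_smul, LinearMap.smul_apply, smul_smul]
  rw [sgn_mul_sgn_self, mul_one]

/-- The bilinear map `(y, z) ↦ [y, [z, v]]`. -/
def bracketBracket (D : ReductionData g) (v : g) : g →ₗ[ℂ] g →ₗ[ℂ] g :=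
  LinearMap.mk₂ ℂ (fun y z => D.bracket y (D.bracket z v)) (by intros; simp) (by intros; simp)
    (by intros; simp) (by intros; simp)

omit [Fintype ι] [DecidableEq ι] [FiniteDimensional ℂ g] in
theorem bracketBracket_apply (v y z : g) :
    bracketBracket D v y z = D.bracket y (D.bracket z v) := rfl

theorem casimir_bracket (a v : g) : B.casimir (D.bracket a v) = D.bracket a (B.casimir v) := by
  have key : ∀ p, ∀ a ∈ part D.Γ p, B.casimir (D.bracket a v) = D.bracket a (B.casimir v) := by
    intro p a ha
    have h := B.sum_bracket_u_ud ha (bracketBracket D v)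
    rw [casimir_apply, casimir_apply, map_sum, eq_comm, ← sub_eq_zero, ← Finset.sum_sub_distrib,
      ← h]
    refine Finset.sum_congr rfl fun i _ => ?_
    rw [map_smul, D.jacobi p _ a ha _ (B.mem_part i), D.jacobi p _ a ha _ (B.ud_mem_part i)]
    simp only [map_add, map_smul, smul_add, smul_smul, bracketBracket_apply]
    rw [sgn_mul_sgn_self, mul_one]
    abel
  obtain ⟨b, hb, c, hc, rfl⟩ := D.exists_part_add a
  simp only [map_add, LinearMap.add_apply, key _ _ hb, key _ _ hc]

/-- Schur's lemma for the Casimir operator. -/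
theorem exists_casimir_eq : ∃ h : ℂ, ∀ v, B.casimir v = (2 * h) • v := by
  obtain ⟨a, b, hab⟩ := D.simple.1
  have hnt : Nontrivial g := ⟨⟨_, _, hab⟩⟩
  obtain ⟨μ, hμ⟩ := Module.End.exists_eigenvalue (B.casimir : Module.End ℂ g)
  have htop : Module.End.eigenspace (B.casimir : Module.End ℂ g) μ = ⊤ := by
    refine (D.simple.2 _ (fun a ha => ?_) fun a b hb => ?_).resolve_left hμ
    · rw [Module.End.mem_eigenspace_iff] at ha ⊢
      rw [casimir_Γ, ha, map_smul]
    · rw [Module.End.mem_eigenspace_iff] at hb ⊢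
      rw [casimir_bracket, hb, map_smul]
  refine ⟨μ / 2, fun v => ?_⟩
  have hv : v ∈ Module.End.eigenspace (B.casimir : Module.End ℂ g) μ := htop ▸ Submodule.mem_top
  rw [Module.End.mem_eigenspace_iff.mp hv, mul_div_cancel₀ _ two_ne_zero]

/-- The constant of Schur's lemma is `2 h^∨`: it does not depend on the dual bases, so that
`h^∨` has its defining property. -/
theorem casimir_eq (v : g) : B.casimir v = (2 * D.dualCoxeter) • v := by
  have hex : ∃ h, D.IsDualCoxeterNumber h := by
    obtain ⟨h, hh⟩ := B.exists_casimir_eq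
    refine ⟨h, fun n a p a' hp ha v => ?_⟩
    rw [← hh, casimir_apply]
    have e := (isDualPair_of_basis D.form_nondegenerate.2 a ha).sum_eq B.isDualPair_u_ud
      (bracketBracket D v ∘ₗ D.Γ)
    simp only [LinearMap.comp_apply, mem_part_iff.mp (B.mem_part _), mem_part_iff.mp (hp _),
      map_smul, LinearMap.smul_apply, bracketBracket_apply] at e
    exact e
  have hs : D.IsDualCoxeterNumber D.dualCoxeter := Classical.epsilon_spec hex
  let e := Fintype.equivFin ι
  have h := hs (Fintype.card ι) (B.u.reindex e) (fun i => B.parity (e.symm i))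
    (fun i => B.ud (e.symm i)) (fun i => by simpa using B.mem_part (e.symm i))
    (fun i j => by simp [form_u_ud]) v
  rw [← h, casimir_apply, ← e.symm.sum_comp]
  simp

/-- The Casimir operator in the form in which it appears in the double brackets
`[[a, u_i], u^i]` of the Wick formula. -/
theorem sum_bracket_bracket {p : ZMod 2} {a : g} (ha : a ∈ part D.Γ p) :
    ∑ i, sgn (B.parity i) • D.bracket (D.bracket a (B.u i)) (B.ud i)
      = (2 * D.dualCoxeter) • a := by
  rw [← casimir_eq B, casimir_apply]
  have h := B.sum_sgn_u_ud (bracketBracket D a)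
  simp only [bracketBracket_apply] at h
  rw [h]
  refine Finset.sum_congr rfl fun i _ => ?_
  rw [D.skew _ _ _ (bracket_mem_part ha (B.mem_part i)) _ (B.ud_mem_part i),
    D.skew _ _ _ ha _ (B.mem_part i)]
  simp only [map_neg, map_smul, smul_neg, neg_neg, smul_smul]
  have hs : sgn (B.parity i) * (sgn ((p + B.parity i) * B.parity i) * sgn (p * B.parity i)) = 1 := by
    rw [add_mul, sgn_add, sgn_mul_self]
    linear_combination sgn (p * B.parity i) * sgn (p * B.parity i)
      * sgn_mul_sgn_self (B.parity i) + sgn_mul_sgn_self (p * B.parity i)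
  rw [hs, one_smul]

omit [Fintype ι] [DecidableEq ι] [FiniteDimensional ℂ g] in
theorem form_x_u {i : ι} (h : B.deg i ≠ 0) : D.form D.x (B.u i) = 0 :=
  form_eq_zero_of_gr x_mem_gr (B.mem_gr i) (by simpa using h)

omit [Fintype ι] [DecidableEq ι] [FiniteDimensional ℂ g] in
theorem form_f_u_of_deg {i : ι} (h : B.deg i ≠ 1) : D.form D.f (B.u i) = 0 :=
  form_eq_zero_of_gr f_mem_gr (B.mem_gr i) fun e => h (by linarith)

omit [Fintype ι] [DecidableEq ι] [FiniteDimensional ℂ g] in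
theorem form_f_u_of_parity {i : ι} (h : B.parity i ≠ 0) : D.form D.f (B.u i) = 0 :=
  form_eq_zero_of_parity f_mem_part (B.mem_part i) (Ne.symm h)

/-! ### The space of neutral free superfermions -/

omit [DecidableEq ι] [FiniteDimensional ℂ g] in
theorem mem_ghalf_iff {a : g} : a ∈ D.ghalf ↔ ∀ i, ¬B.deg i = 1 / 2 → B.u.repr a i = 0 := by
  constructor
  · exact fun ha i hi => B.repr_eq_zero_of_mem_gr ha hi
  · intro h
    rw [← B.u.sum_repr a]
    refine Submodule.sum_mem _ fun i _ => ?_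
    by_cases hi : B.deg i = 1 / 2
    · refine Submodule.smul_mem _ _ ?_
      have := B.mem_gr i
      rwa [hi] at this
    · rw [h i hi, zero_smul]
      exact Submodule.zero_mem _

/-- The basis `u_i`, `i ∈ S'`, of `g_{1/2}`. -/
def halfBasis : Module.Basis B.S' ℂ D.ghalf :=
  Module.Basis.mk (v := B.uhalf)
    (LinearIndependent.of_comp D.ghalf.subtype
      (B.u.linearIndependent.comp (fun i : B.S' => (i : ι)) Subtype.val_injective)) (by
    rintro ⟨a, ha⟩ -
    have e : (⟨a, ha⟩ : D.ghalf) = ∑ i : B.S', B.u.repr a i • B.uhalf i := by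
      apply Subtype.ext
      have hc : ((∑ i : B.S', B.u.repr a i • B.uhalf i : D.ghalf) : g)
          = ∑ i : B.S', B.u.repr a i • B.u i := by
        rw [AddSubmonoidClass.coe_finsetSum]
        rfl
      rw [hc]
      refine (B.u.sum_repr a).symm.trans ?_
      rw [← Finset.sum_subtype (Finset.univ.filter fun i => B.deg i = 1 / 2) (by simp)
        fun i => B.u.repr a i • B.u i, Finset.sum_filter]
      refine Finset.sum_congr rfl fun i _ => ?_
      split_ifs with hi
      · rfl
      · rw [B.mem_ghalf_iff.mp ha i hi, zero_smul]
    rw [e]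
    exact Submodule.sum_mem _ fun i _ => Submodule.smul_mem _ _
      (Submodule.subset_span (Set.mem_range_self i)))

omit [DecidableEq ι] [FiniteDimensional ℂ g] in
theorem halfBasis_apply (i : B.S') : B.halfBasis i = B.uhalf i := by
  simp [halfBasis]

omit [Fintype ι] [DecidableEq ι] [FiniteDimensional ℂ g] in
theorem neForm_apply (a b : D.ghalf) : D.neForm a b = D.form D.f (D.bracket a b) := rfl

omit [Fintype ι] [DecidableEq ι] [FiniteDimensional ℂ g] in
/-- `⟨a, y⟩ = ([f, a]|y)`, and `[f, a]` runs through `g_{-1/2}`, which is dual to `g_{1/2}` under the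
invariant form. -/
theorem neForm_separatingRight (B : D.HomogeneousBasis ι)
    (hA3 : Set.BijOn (D.bracket D.f) (D.gr (1 / 2)) (D.gr (-1 / 2))) :
    D.neForm.SeparatingRight := by
  rintro ⟨y, hy⟩ h
  apply Subtype.ext
  refine B.eq_of_form_u fun i => ?_
  rw [ZeroMemClass.coe_zero, map_zero]
  by_cases hi : B.deg i = -1 / 2
  · have hu := B.mem_gr i
    rw [hi] at hu
    obtain ⟨a, ha, hau⟩ := hA3.surjOn hu
    rw [← hau, D.form_invariant]
    exact h ⟨a, ha⟩
  · refine form_eq_zero_of_gr (B.mem_gr i) hy fun e => hi ?_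
    linarith

/-- The basis of `g_{1/2}` dual to `u_i`, `i ∈ S'`, with respect to `⟨.,.⟩`. -/
def uhalfd (i : B.S') : D.ghalf := dualFamily D.neForm B.uhalf i

theorem neForm_uhalf_uhalfd
    (hA3 : Set.BijOn (D.bracket D.f) (D.gr (1 / 2)) (D.gr (-1 / 2))) (i j : B.S') :
    D.neForm (B.uhalf i) (B.uhalfd j) = if i = j then 1 else 0 := by
  have h := dualFamily_spec (B.neForm_separatingRight hA3) B.halfBasis i j
  have e : (B.halfBasis : B.S' → D.ghalf) = B.uhalf := funext B.halfBasis_apply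
  rw [e] at h
  exact h

theorem isDualPair_uhalf_uhalfd
    (hA3 : Set.BijOn (D.bracket D.f) (D.gr (1 / 2)) (D.gr (-1 / 2))) :
    IsDualPair D.neForm B.uhalf B.uhalfd := by
  have h := isDualPair_of_basis (B.neForm_separatingRight hA3) B.halfBasis
    (a' := B.uhalfd) (fun i j => by rw [halfBasis_apply]; exact B.neForm_uhalf_uhalfd hA3 i j)
  have e : (B.halfBasis : B.S' → D.ghalf) = B.uhalf := funext B.halfBasis_apply
  rwa [e] at h

omit [Fintype ι] [DecidableEq ι] [FiniteDimensional ℂ g] in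
theorem neForm_comm {p q : ZMod 2} {a b : D.ghalf} (ha : (a : g) ∈ part D.Γ p)
    (hb : (b : g) ∈ part D.Γ q) : D.neForm a b = -(sgn (p * q) * D.neForm b a) := by
  rw [neForm_apply, D.skew _ _ _ ha _ hb, map_neg, map_smul, smul_eq_mul, neForm_apply]

theorem uhalfd_mem_part
    (hA3 : Set.BijOn (D.bracket D.f) (D.gr (1 / 2)) (D.gr (-1 / 2))) (i : B.S') :
    (B.uhalfd i : g) ∈ part D.Γ (B.parity i) := by
  have hΓ : ∀ a b : D.ghalf, D.neForm (D.Γhalf a) (D.Γhalf b) = D.neForm a b := by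
    intro a b
    change D.form D.f (D.bracket (D.Γ a) (D.Γ b)) = D.form D.f (D.bracket a b)
    rw [← D.Γ_bracket, ← D.form_even D.f (D.bracket a b), D.f_even]
  have h : D.Γhalf (B.uhalfd i) = sgn (B.parity i) • B.uhalfd i := by
    rw [← (B.isDualPair_uhalf_uhalfd hA3).expand_right (D.Γhalf (B.uhalfd i)),
      Finset.sum_eq_single i]
    · congr 1
      have hu : D.Γhalf (B.uhalf i) = sgn (B.parity i) • B.uhalf i :=
        Subtype.ext (mem_part_iff.mp (B.mem_part i))
      have e := hΓ (D.Γhalf (B.uhalf i)) (B.uhalfd i)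
      have e2 : D.Γhalf (D.Γhalf (B.uhalf i)) = B.uhalf i := Subtype.ext (D.Γ_Γ _)
      rw [e2, hu, map_smul, LinearMap.smul_apply, B.neForm_uhalf_uhalfd hA3] at e
      simpa using e
    · intro j _ hj
      have hu : D.Γhalf (B.uhalf j) = sgn (B.parity j) • B.uhalf j :=
        Subtype.ext (mem_part_iff.mp (B.mem_part j))
      have e := hΓ (D.Γhalf (B.uhalf j)) (B.uhalfd i)
      have e2 : D.Γhalf (D.Γhalf (B.uhalf j)) = B.uhalf j := Subtype.ext (D.Γ_Γ _)
      rw [e2, hu, map_smul, LinearMap.smul_apply, B.neForm_uhalf_uhalfd hA3, if_neg hj,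
        smul_zero] at e
      rw [e, zero_smul]
    · simp
  rw [mem_part_iff]
  exact congrArg Subtype.val h

end HomogeneousBasis

/-! ### Operator product expansions of the generating fields -/

theorem hasParity_mode {p : ZMod 2} {a : D.Gen} (ha : a ∈ part D.genΓ p) :
    FieldParity p (D.field a) := fun n => by
  rw [HasParity, field, par_coe, parU_mode, mem_part_iff.mp ha, map_smul,
    UniformSpace.Completion.coe_smul]

/-- The defining relations of `U_k`, extended from homogeneous elements by bilinearity. -/
theorem superComm_field (a b : D.Gen) (m n : ℤ) :
    D.superComm (D.field a m) (D.field b n)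
      = D.field (D.genBracket a b) (m + n) + D.cocycle a m b n • (1 : D.UCom) := by
  have key : ∀ p q a b, a ∈ part D.genΓ p → b ∈ part D.genΓ q →
      D.superComm (D.field a m) (D.field b n)
        = D.field (D.genBracket a b) (m + n) + D.cocycle a m b n • (1 : D.UCom) := by
    intro p q a b ha hb
    rw [superComm_eq (hasParity_mode ha m), (hasParity_mode hb n).tw]
    have h := congrArg (fun u : D.U => (u : D.UCom)) (D.mode_mul_mode m n ha hb)
    simp only [UniformSpace.Completion.coe_add, UniformSpace.Completion.coe_mul,
      UniformSpace.Completion.coe_smul, Algebra.algebraMap_eq_smul_one,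
      UniformSpace.Completion.coe_one] at h
    rw [field, field, h, field, smul_mul_assoc]
    abel
  have hf : ∀ (a b : D.Gen) (n : ℤ), D.field (a + b) n = D.field a n + D.field b n := by
    intro a b n
    simp only [field, map_add, UniformSpace.Completion.coe_add]
  have hb : ∀ a b c : D.Gen, D.genBracket (a + b) c = D.genBracket a c + D.genBracket b c := by
    intro a b c
    simp [genBracket]
  have hb' : ∀ a b c : D.Gen, D.genBracket a (b + c) = D.genBracket a b + D.genBracket a c := by
    intro a b c
    simp [genBracket]
  have hc : ∀ a b c : D.Gen, D.cocycle (a + b) m c n = D.cocycle a m c n + D.cocycle b m c n := by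
    intro a b c
    simp only [cocycle, ghostForm, Prod.fst_add, Prod.snd_add, map_add, LinearMap.add_apply]
    split_ifs <;> ring
  have hc' : ∀ a b c : D.Gen, D.cocycle a m (b + c) n = D.cocycle a m b n + D.cocycle a m c n := by
    intro a b c
    simp only [cocycle, ghostForm, Prod.fst_add, Prod.snd_add, map_add, LinearMap.add_apply]
    split_ifs <;> ring
  obtain ⟨a0, ha0, a1, ha1, rfl⟩ := D.exists_parts a
  obtain ⟨b0, hb0, b1, hb1, rfl⟩ := D.exists_parts b
  simp only [hf, hb, hb', hc, hc', superComm_add_left, superComm_add_right, add_smul,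
    key _ _ _ _ ha0 hb0, key _ _ _ _ ha0 hb1, key _ _ _ _ ha1 hb0, key _ _ _ _ ha1 hb1]
  abel

theorem OPE.field (a b : D.Gen) :
    OPE (D.field a) (D.field b) (D.field (D.genBracket a b) + D.ghostForm a b • D.one)
      ((D.k * D.form a.1 b.1) • D.one) 0 0 := fun m n => by
  rw [superComm_field]
  simp only [Pi.add_apply, Pi.smul_apply, Pi.zero_apply, one, cocycle, smul_zero, add_zero]
  have h1 : m + n - 1 = -1 ↔ m + n = 0 := by omega
  simp only [h1]
  split_ifs <;> module

theorem field_zero : D.field 0 = 0 := by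
  funext n
  simp only [ReductionData.field, map_zero, UniformSpace.Completion.coe_zero, Pi.zero_apply]

theorem OPE.current_current (a b : g) :
    OPE (D.current a) (D.current b) (D.current (D.bracket a b)) ((D.k * D.form a b) • D.one) 0 0 :=
  (OPE.field (D := D) (a, 0, 0, 0) (b, 0, 0, 0)).congr
    (by simp [ghostForm, genBracket, ReductionData.current]) rfl rfl rfl

/-- Generators whose bracket in `g` vanishes have a scalar operator product expansion. -/
theorem OPE.field_scalar {a b : D.Gen} (h : a.1 = 0 ∨ b.1 = 0) :
    OPE (D.field a) (D.field b) (D.ghostForm a b • D.one) 0 0 0 := by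
  have h1 : D.bracket a.1 b.1 = 0 := by rcases h with h | h <;> simp [h]
  have h2 : D.form a.1 b.1 = 0 := by rcases h with h | h <;> simp [h]
  refine (OPE.field a b).congr ?_ ?_ rfl rfl
  · have h0 : D.genBracket a b = 0 := by rw [genBracket, h1]; rfl
    rw [h0, field_zero, zero_add]
  · rw [h2, mul_zero, zero_smul]

theorem OPE.field_zero {a b : D.Gen} (h : a.1 = 0 ∨ b.1 = 0) (h0 : D.ghostForm a b = 0) :
    OPE (D.field a) (D.field b) 0 0 0 0 :=
  (OPE.field_scalar h).congr (by rw [h0, zero_smul]) rfl rfl rfl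

theorem OPE.neutral_neutral (a b : D.ghalf) :
    OPE (D.neutral a) (D.neutral b) (D.neForm a b • D.one) 0 0 0 :=
  (OPE.field_scalar (a := (0, 0, 0, a)) (b := (0, 0, 0, b)) (Or.inl rfl)).congr
    (by simp [ghostForm]) rfl rfl rfl

theorem deriv_one : D.deriv D.one = 0 := by
  funext n
  rw [deriv_apply, one]
  split_ifs with h
  · have : n = 0 := by omega
    simp [this]
  · simp

/-- A field with scalar bracket with `a` has the bracket `λ` times this scalar with `∂a`. -/
theorem OPE.deriv_right_scalar {X a : D.Fld} {β : ℂ} (h : OPE X a (β • D.one) 0 0 0) :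
    OPE X (D.deriv a) 0 (β • D.one) 0 0 :=
  h.deriv_right.congr (by rw [map_smul, deriv_one, smul_zero]) (by simp) (by simp) (by simp)

theorem OPE.deriv_right_zero {X a : D.Fld} (h : OPE X a 0 0 0 0) :
    OPE X (D.deriv a) 0 0 0 0 :=
  h.deriv_right.congr (by simp) (by simp) (by simp) (by simp)

theorem OPE.deriv_left_scalar {X a : D.Fld} {β : ℂ} (h : OPE X a (β • D.one) 0 0 0) :
    OPE (D.deriv X) a 0 ((-β) • D.one) 0 0 :=
  h.deriv_left.congr rfl (by rw [neg_smul]) (by simp) (by simp)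

theorem OPE.wick_zero {p q : ZMod 2} {X a b : D.Fld}
    (hX : FieldParity p X) (hpa : FieldParity q a) (ha : IsField a) (hb : IsField b)
    (h1 : OPE X a 0 0 0 0) (h2 : OPE X b 0 0 0 0) : OPE X (D.normalOrd a b) 0 0 0 0 := by
  have z : ((0 : ℂ) • D.one : D.Fld) = 0 := zero_smul _ _
  refine (OPE.wick_scalar (β0 := 0) (β1 := 0) (γ0 := 0) (γ1 := 0) hX hpa ha hb
    (h1.congr z.symm z.symm rfl rfl) (h2.congr z.symm z.symm rfl rfl)).congr ?_ ?_ rfl rfl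
  · simp
  · simp

theorem fieldParity_current {p : ZMod 2} {a : g} (ha : a ∈ part D.Γ p) :
    FieldParity p (D.current a) := by
  refine hasParity_mode ?_
  rw [mem_part_iff] at ha ⊢
  simp [genΓ, ha]

theorem fieldParity_neutral {p : ZMod 2} {a : D.ghalf} (ha : (a : g) ∈ part D.Γ p) :
    FieldParity p (D.neutral a) := by
  refine hasParity_mode ?_
  rw [mem_part_iff] at ha ⊢
  have h : D.Γhalf a = sgn p • a := Subtype.ext ha
  simp [genΓ, h]

theorem isField_current (a : g) : IsField (D.current a) := isField_field _

theorem isField_neutral (a : D.ghalf) : IsField (D.neutral a) := isField_field _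

theorem current_smul (c : ℂ) (a : g) : D.current (c • a) = c • D.current a := by
  funext n
  have h : ((c • a, 0, 0, 0) : D.Gen) = c • (a, 0, 0, 0) := by simp
  simp only [current, ReductionData.field, Pi.smul_apply]
  rw [h, map_smul, UniformSpace.Completion.coe_smul]

theorem current_add (a b : g) : D.current (a + b) = D.current a + D.current b := by
  funext n
  have h : ((a + b, 0, 0, 0) : D.Gen) = (a, 0, 0, 0) + (b, 0, 0, 0) := by simp
  simp only [current, ReductionData.field, Pi.add_apply]
  rw [h, map_add, UniformSpace.Completion.coe_add]

theorem neutral_smul (c : ℂ) (a : D.ghalf) : D.neutral (c • a) = c • D.neutral a := by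
  funext n
  have h : ((0, 0, 0, c • a) : D.Gen) = c • (0, 0, 0, a) := by simp
  simp only [neutral, ReductionData.field, Pi.smul_apply]
  rw [h, map_smul, UniformSpace.Completion.coe_smul]

theorem neutral_add (a b : D.ghalf) : D.neutral (a + b) = D.neutral a + D.neutral b := by
  funext n
  have h : ((0, 0, 0, a + b) : D.Gen) = (0, 0, 0, a) + (0, 0, 0, b) := by simp
  simp only [neutral, ReductionData.field, Pi.add_apply]
  rw [h, map_add, UniformSpace.Completion.coe_add]

variable (D) in
/-- `a ↦ a(z)`, `a ∈ g`, as a linear map. -/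
def currentL : g →ₗ[ℂ] D.Fld where
  toFun := D.current
  map_add' := current_add
  map_smul' := current_smul

variable (D) in
/-- `a ↦ a(z)`, `a ∈ A_ne`, as a linear map. -/
def neutralL : D.ghalf →ₗ[ℂ] D.Fld where
  toFun := D.neutral
  map_add' := neutral_add
  map_smul' := neutral_smul

variable (D) in
/-- `(a, b) ↦ :a(z)b(z):`, `a, b ∈ g`, as a bilinear map. -/
def currentNormalOrd : g →ₗ[ℂ] g →ₗ[ℂ] D.Fld :=
  LinearMap.mk₂ ℂ (fun a b => D.normalOrd (D.current a) (D.current b))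
    (fun a b c => by
      rw [current_add, normalOrd_add_left (isField_current _) (isField_current _)
        (isField_current _)])
    (fun c a b => by rw [current_smul, normalOrd_smul_left])
    (fun a b c => by
      rw [current_add, normalOrd_add_right (isField_current _) (isField_current _)
        (isField_current _)])
    (fun c a b => by rw [current_smul, normalOrd_smul_right])

namespace HomogeneousBasis

variable {ι : Type*} (B : D.HomogeneousBasis ι)

theorem fieldParity_φ (i : B.S) : FieldParity (B.parity i + 1) (B.φ i) := by
  refine hasParity_mode ?_
  rw [mem_part_iff, sgn_add, sgn_one]
  have h : D.Γplus (B.uplus i) = sgn (B.parity i) • B.uplus i :=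
    Subtype.ext (mem_part_iff.mp (B.mem_part i))
  simp [genΓ, h]

theorem fieldParity_φs (i : B.S) : FieldParity (B.parity i + 1) (B.φs i) := by
  refine hasParity_mode ?_
  rw [mem_part_iff, sgn_add, sgn_one]
  have h : D.Γplus.dualMap ((B.u.coord i).domRestrict D.gplus)
      = sgn (B.parity i) • (B.u.coord i).domRestrict D.gplus :=
    LinearMap.ext fun v => B.repr_Γ v i
  simp [genΓ, h]

theorem fieldParity_Φ (i : B.S') : FieldParity (B.parity i) (B.Φ i) :=
  fieldParity_neutral (B.mem_part i)

theorem isField_φ (i : B.S) : IsField (B.φ i) := isField_field _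

theorem isField_φs (i : B.S) : IsField (B.φs i) := isField_field _

theorem isField_Φ (i : B.S') : IsField (B.Φ i) := isField_field _

variable [DecidableEq ι]

theorem OPE_φ_φs (i j : B.S) :
    OPE (B.φ i) (B.φs j) ((if i = j then (1 : ℂ) else 0) • D.one) 0 0 0 := by
  refine (OPE.field_scalar (a := (0, B.uplus i, 0, 0))
    (b := (0, 0, (B.u.coord j).domRestrict D.gplus, 0)) (Or.inl rfl)).congr ?_ rfl rfl rfl
  congr 1
  have h : B.u.coord j (B.u i) = if i = j then (1 : ℂ) else 0 := by
    rw [Module.Basis.coord_apply, Module.Basis.repr_self, Finsupp.single_apply]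
    simp only [Subtype.ext_iff]
  simp only [ghostForm, map_zero, add_zero]
  exact h

theorem OPE_φs_φ (i j : B.S) :
    OPE (B.φs i) (B.φ j) ((if i = j then sgn (B.parity i) else 0) • D.one) 0 0 0 := by
  refine (OPE.field_scalar (b := (0, B.uplus j, 0, 0))
    (a := (0, 0, (B.u.coord i).domRestrict D.gplus, 0)) (Or.inl rfl)).congr ?_ rfl rfl rfl
  congr 1
  have h : B.u.coord i (D.Γ (B.u j)) = if i = j then sgn (B.parity i) else 0 := by
    rw [Module.Basis.coord_apply, repr_Γ, Module.Basis.repr_self, Finsupp.single_apply]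
    by_cases hij : i = j
    · simp [hij]
    · have : (j : ι) ≠ i := fun e => hij (Subtype.ext e.symm)
      simp [hij, this]
  simp only [ghostForm, map_zero, add_zero, zero_add]
  exact h

variable [Fintype ι]

/-! ### The action of the energy-momentum field on the generating fields -/

/-- The Sugawara construction. -/
theorem OPE_current_Lg [FiniteDimensional ℂ g] (hk : D.k + D.dualCoxeter ≠ 0) {p : ZMod 2} {a : g}
    (ha : a ∈ part D.Γ p) : OPE (D.current a) B.Lg 0 (D.current a) 0 0 := by
  have hterm : ∀ i ∈ Finset.univ, OPE (D.current a)
      (sgn (B.parity i) • D.normalOrd (D.current (B.u i)) (D.current (B.ud i)))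
      (sgn (B.parity i) • (D.currentNormalOrd (D.bracket a (B.u i)) (B.ud i)
        + sgn (p * B.parity i) • D.currentNormalOrd (B.u i) (D.bracket a (B.ud i))))
      (D.currentL (sgn (B.parity i) • ((D.k * D.form a (B.u i)) • B.ud i
        + (sgn (p * B.parity i) * (D.k * D.form a (B.ud i))) • B.u i
        + D.bracket (D.bracket a (B.u i)) (B.ud i))))
      ((sgn (B.parity i) * (D.k * D.form (D.bracket a (B.u i)) (B.ud i))) • D.one) 0 := by
    intro i _
    refine ((OPE.wick (fieldParity_current ha) (fieldParity_current (B.mem_part i))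
      (isField_current _) (isField_current _) (isField_current _) (isField_one.smul _)
      IsField.zero IsField.zero (isField_current _) (isField_one.smul _) IsField.zero IsField.zero
      (OPE.current_current a (B.u i)) (OPE.current_current a (B.ud i))
      (OPE.current_current (D.bracket a (B.u i)) (B.ud i))
      (((OPE.one_left _).smul_left _).congr (smul_zero _) (smul_zero _) (smul_zero _)
        (smul_zero _)) (OPE.zero_left _) (OPE.zero_left _)).smul_right
        (sgn (B.parity i))).congr ?_ ?_ ?_ ?_
    · rfl
    · rw [normalOrd_smul_left, normalOrd_one_left, normalOrd_smul_right, normalOrd_one_right]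
      simp only [map_smul, map_add]
      simp only [smul_smul]
      rfl
    · simp only [normalOrd_zero_left, normalOrd_zero_right, smul_zero, zero_add, add_zero, smul_smul]
    · simp only [normalOrd_zero_left, normalOrd_zero_right, smul_zero, add_zero]
  have hsum := (OPE.sum_right Finset.univ hterm).smul_right (1 / (2 * (D.k + D.dualCoxeter)))
  refine hsum.congr ?_ ?_ ?_ ?_
  -- the quadratic term vanishes by the invariance of the Casimir element
  · rw [B.sum_bracket_u_ud ha D.currentNormalOrd, smul_zero]
  -- the two single contractions contribute `k` each, the double bracket contributes `2 h^∨`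
  · rw [← map_sum, ← map_smul]
    change D.currentL _ = D.currentL a
    congr 1
    simp only [smul_add, Finset.sum_add_distrib]
    rw [B.sum_bracket_bracket ha]
    have h1 : ∑ i, sgn (B.parity i) • (D.k * D.form a (B.u i)) • B.ud i = D.k • a := by
      conv_rhs => rw [← B.isDualPair_u_ud.expand_right a, Finset.smul_sum]
      refine Finset.sum_congr rfl fun i _ => ?_
      rw [form_comm (B.mem_part i) a, smul_smul, smul_smul]
      congr 1
      ring
    have h2 : ∑ i, sgn (B.parity i) • (sgn (p * B.parity i) * (D.k * D.form a (B.ud i))) • B.u i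
        = D.k • a := by
      conv_rhs => rw [← B.isDualPair_u_ud.expand_left a, Finset.smul_sum]
      refine Finset.sum_congr rfl fun i _ => ?_
      by_cases hp : p = B.parity i
      · rw [hp, sgn_mul_self, smul_smul, smul_smul, ← mul_assoc, sgn_mul_sgn_self, one_mul]
      · rw [form_eq_zero_of_parity ha (B.ud_mem_part i) hp]
        simp
    rw [h1, h2]
    have h3 : (1 / (2 * (D.k + D.dualCoxeter))) * (2 * (D.k + D.dualCoxeter)) = 1 := by
      field_simp
    refine Eq.trans (b := ((1 / (2 * (D.k + D.dualCoxeter))) * (2 * (D.k + D.dualCoxeter))) • a)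
      (by module) ?_
    rw [h3, one_smul]
  -- the double contraction is `k ∑ (-1)^{p(u_i)} ([a, u_i]|u^i) = k (a|∑ (-1)^{p(u_i)} [u_i, u^i]) = 0`
  · rw [← Finset.sum_smul]
    have h3 : ∑ i, sgn (B.parity i) * (D.k * D.form (D.bracket a (B.u i)) (B.ud i)) = 0 := by
      have e : ∀ i, sgn (B.parity i) * (D.k * D.form (D.bracket a (B.u i)) (B.ud i))
          = D.k * D.form a (sgn (B.parity i) • D.bracket (B.u i) (B.ud i)) := by
        intro i
        rw [D.form_invariant, map_smul, smul_eq_mul]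
        ring
      simp only [e]
      rw [← Finset.mul_sum, ← map_sum, B.sum_sgn_bracket_u_ud, map_zero, mul_zero]
    rw [h3, zero_smul, smul_zero]
  · simp

/-- A field that commutes with all currents commutes with the Sugawara field. -/
theorem OPE_Lg_zero [FiniteDimensional ℂ g] {p : ZMod 2} {X : D.Fld} (hX : FieldParity p X)
    (h : ∀ a : g, OPE X (D.current a) 0 0 0 0) : OPE X B.Lg 0 0 0 0 := by
  have hterm : ∀ i ∈ Finset.univ, OPE X
      (sgn (B.parity i) • D.normalOrd (D.current (B.u i)) (D.current (B.ud i))) 0 0 0 0 :=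
    fun i _ => ((OPE.wick_zero hX (fieldParity_current (B.mem_part i)) (isField_current _)
      (isField_current _) (h _) (h _)).smul_right _).congr (smul_zero _) (smul_zero _)
        (smul_zero _) (smul_zero _)
  exact ((OPE.sum_right Finset.univ hterm).smul_right _).congr (by simp) (by simp) (by simp)
    (by simp)

omit [Fintype ι] [DecidableEq ι] in
/-- The summand `∂x` of `L` changes the weight of a current `a(z)`, `a ∈ g_m`, from `1` to `1 - m`. -/
theorem OPE_current_deriv_x {a : g} {m : ℚ} (ha : a ∈ D.gr m) :
    OPE (D.current a) (D.deriv (D.current D.x)) ((-(m : ℂ)) • D.deriv (D.current a))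
      ((-(m : ℂ)) • D.current a) ((2 * (D.k * D.form a D.x)) • D.one) 0 := by
  have hb : D.current (D.bracket a D.x) = (-(m : ℂ)) • D.current a := by
    rw [bracket_comm_of_even a x_mem_part, mem_gr_iff.mp ha, ← neg_smul, current_smul]
  refine (OPE.current_current a D.x).deriv_right.congr ?_ ?_ ?_ ?_
  · rw [hb, map_smul]
  · rw [hb, map_smul, deriv_one, smul_zero, zero_add]
  · rw [map_zero, zero_add, smul_smul]
  · rw [smul_zero]

/-- The ghost `φ_j` has weight `1 - m_j`. -/
theorem OPE_φ_Lch (j : B.S) :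
    OPE (B.φ j) B.Lch ((1 - (B.deg j : ℂ) - 1) • D.deriv (B.φ j))
      ((1 - (B.deg j : ℂ)) • B.φ j) 0 0 := by
  have h0 : ∀ i, OPE (B.φ j) (B.φ i) 0 0 0 0 := fun i =>
    OPE.field_zero (Or.inl rfl) (by simp [ghostForm])
  have z : ((0 : ℂ) • D.one : D.Fld) = 0 := zero_smul _ _
  have t1 : ∀ i : B.S, OPE (B.φ j)
      ((B.deg i : ℂ) • D.normalOrd (B.φs i) (D.deriv (B.φ i)))
      (if j = i then (B.deg i : ℂ) • D.deriv (B.φ i) else 0) 0 0 0 := by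
    intro i
    refine ((OPE.wick_scalar (β1 := 0) (γ0 := 0) (γ1 := 0) (B.fieldParity_φ j)
      (B.fieldParity_φs i) (B.isField_φs i) (B.isField_φ i).deriv
      ((B.OPE_φ_φs j i).congr rfl z.symm rfl rfl)
      ((h0 i).deriv_right_zero.congr z.symm z.symm rfl rfl)).smul_right _).congr ?_ ?_ ?_ ?_
    · split_ifs <;> simp
    all_goals simp
  have t2 : ∀ i : B.S, OPE (B.φ j)
      ((1 - (B.deg i : ℂ)) • D.normalOrd (D.deriv (B.φs i)) (B.φ i))
      0 (if j = i then (1 - (B.deg i : ℂ)) • B.φ i else 0) 0 0 := by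
    intro i
    refine ((OPE.wick_scalar (β0 := 0) (γ0 := 0) (γ1 := 0) (B.fieldParity_φ j)
      (B.fieldParity_φs i).deriv (B.isField_φs i).deriv (B.isField_φ i)
      ((B.OPE_φ_φs j i).deriv_right_scalar.congr z.symm rfl rfl rfl)
      ((h0 i).congr z.symm z.symm rfl rfl)).smul_right _).congr ?_ ?_ ?_ ?_
    · simp
    · split_ifs <;> simp
    all_goals simp
  refine ((OPE.sum_right Finset.univ fun i _ => t1 i).neg_right.add_right
    (OPE.sum_right Finset.univ fun i _ => t2 i)).congr ?_ ?_ ?_ ?_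
  · rw [Finset.sum_ite_eq, if_pos (Finset.mem_univ j), Finset.sum_const_zero]
    module
  · rw [Finset.sum_ite_eq, if_pos (Finset.mem_univ j), Finset.sum_const_zero]
    module
  all_goals simp

/-- The ghost `φ^*_j` has weight `m_j`. -/
theorem OPE_φs_Lch (j : B.S) :
    OPE (B.φs j) B.Lch (((B.deg j : ℂ) - 1) • D.deriv (B.φs j))
      ((B.deg j : ℂ) • B.φs j) 0 0 := by
  have h0 : ∀ i, OPE (B.φs j) (B.φs i) 0 0 0 0 := fun i =>
    OPE.field_zero (Or.inl rfl) (by simp [ghostForm])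
  have z : ((0 : ℂ) • D.one : D.Fld) = 0 := zero_smul _ _
  have hs : ∀ p : ZMod 2, sgn ((p + 1) * (p + 1)) * sgn p = -1 := fun p => by
    rw [sgn_mul_self, sgn_add, mul_right_comm, sgn_mul_sgn_self, sgn_one, one_mul]
  have t1 : ∀ i : B.S, OPE (B.φs j)
      ((B.deg i : ℂ) • D.normalOrd (B.φs i) (D.deriv (B.φ i)))
      0 (if j = i then (-(B.deg i : ℂ)) • B.φs i else 0) 0 0 := by
    intro i
    refine ((OPE.wick_scalar (β0 := 0) (β1 := 0) (γ0 := 0) (B.fieldParity_φs j)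
      (B.fieldParity_φs i) (B.isField_φs i) (B.isField_φ i).deriv
      ((h0 i).congr z.symm z.symm rfl rfl)
      ((B.OPE_φs_φ j i).deriv_right_scalar.congr z.symm rfl rfl rfl)).smul_right _).congr
        ?_ ?_ ?_ ?_
    · simp
    · split_ifs with hij
      · subst hij
        rw [hs]
        module
      · simp
    all_goals simp
  have t2 : ∀ i : B.S, OPE (B.φs j)
      ((1 - (B.deg i : ℂ)) • D.normalOrd (D.deriv (B.φs i)) (B.φ i))
      (if j = i then ((B.deg i : ℂ) - 1) • D.deriv (B.φs i) else 0) 0 0 0 := by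
    intro i
    refine ((OPE.wick_scalar (β0 := 0) (β1 := 0) (γ1 := 0) (B.fieldParity_φs j)
      (B.fieldParity_φs i).deriv (B.isField_φs i).deriv (B.isField_φ i)
      ((h0 i).deriv_right_zero.congr z.symm z.symm rfl rfl)
      ((B.OPE_φs_φ j i).congr rfl z.symm rfl rfl)).smul_right _).congr ?_ ?_ ?_ ?_
    · split_ifs with hij
      · subst hij
        rw [hs]
        module
      · simp
    all_goals simp
  refine ((OPE.sum_right Finset.univ fun i _ => t1 i).neg_right.add_right
    (OPE.sum_right Finset.univ fun i _ => t2 i)).congr ?_ ?_ ?_ ?_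
  · rw [Finset.sum_ite_eq, if_pos (Finset.mem_univ j), Finset.sum_const_zero]
    module
  · rw [Finset.sum_ite_eq, if_pos (Finset.mem_univ j), Finset.sum_const_zero]
    module
  all_goals simp

omit [DecidableEq ι] in
/-- A field that commutes with the charged ghosts commutes with `L^ch`. -/
theorem OPE_Lch_zero {p : ZMod 2} {X : D.Fld} (hX : FieldParity p X)
    (h : ∀ i, OPE X (B.φ i) 0 0 0 0) (h' : ∀ i, OPE X (B.φs i) 0 0 0 0) :
    OPE X B.Lch 0 0 0 0 := by
  have t1 : ∀ i : B.S, OPE X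
      ((B.deg i : ℂ) • D.normalOrd (B.φs i) (D.deriv (B.φ i))) 0 0 0 0 := fun i =>
    ((OPE.wick_zero hX (B.fieldParity_φs i) (B.isField_φs i) (B.isField_φ i).deriv (h' i)
      (h i).deriv_right_zero).smul_right _).congr (smul_zero _) (smul_zero _)
        (smul_zero _) (smul_zero _)
  have t2 : ∀ i : B.S, OPE X
      ((1 - (B.deg i : ℂ)) • D.normalOrd (D.deriv (B.φs i)) (B.φ i)) 0 0 0 0 := fun i =>
    ((OPE.wick_zero hX (B.fieldParity_φs i).deriv (B.isField_φs i).deriv (B.isField_φ i)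
      (h' i).deriv_right_zero (h i)).smul_right _).congr (smul_zero _) (smul_zero _)
        (smul_zero _) (smul_zero _)
  exact ((OPE.sum_right Finset.univ fun i _ => t1 i).neg_right.add_right
    (OPE.sum_right Finset.univ fun i _ => t2 i)).congr (by simp) (by simp) (by simp) (by simp)

/-- The neutral ghosts have weight `1/2`; the two contractions with `½ ∑ :(∂Φ^i) Φ_i:` are the
expansions of `a` in the two dual bases. -/
theorem OPE_neutral_Lne [FiniteDimensional ℂ g]
    (hA3 : Set.BijOn (D.bracket D.f) (D.gr (1 / 2)) (D.gr (-1 / 2))) {p : ZMod 2} {a : D.ghalf}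
    (ha : (a : g) ∈ part D.Γ p) :
    OPE (D.neutral a) B.Lne ((1 / 2 - 1 : ℂ) • D.deriv (D.neutral a))
      ((1 / 2 : ℂ) • D.neutral a) 0 0 := by
  have z : ((0 : ℂ) • D.one : D.Fld) = 0 := zero_smul _ _
  have hterm : ∀ i : B.S', OPE (D.neutral a) (D.normalOrd (D.deriv (B.Φd i)) (B.Φ i))
      ((-1 : ℂ) • D.deriv (D.neutralL (D.neForm (B.uhalf i) a • B.uhalfd i)))
      (D.neutralL (D.neForm a (B.uhalfd i) • B.uhalf i)) 0 0 := by
    intro i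
    refine (OPE.wick_scalar (β0 := 0) (γ1 := 0) (fieldParity_neutral ha)
      (fieldParity_neutral (B.uhalfd_mem_part hA3 i)).deriv (isField_neutral _).deriv
      (B.isField_Φ i)
      ((OPE.neutral_neutral a (B.uhalfd i)).deriv_right_scalar.congr z.symm rfl rfl rfl)
      ((OPE.neutral_neutral a (B.uhalf i)).congr rfl z.symm rfl rfl)).congr ?_ ?_ rfl rfl
    · rw [map_smul, map_smul, zero_smul, zero_add, smul_smul]
      change _ = (_ : ℂ) • D.deriv (D.neutral (B.uhalfd i))
      congr 1
      rw [neForm_comm (a := B.uhalf i) (B.mem_part i) ha, mul_comm (B.parity i) p]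
      ring
    · rw [map_smul, mul_zero, zero_smul, add_zero]
      rfl
  refine ((OPE.sum_right Finset.univ fun i _ => hterm i).smul_right (1 / 2)).congr ?_ ?_ ?_ ?_
  · rw [← Finset.smul_sum, ← map_sum, ← map_sum, (B.isDualPair_uhalf_uhalfd hA3).expand_right]
    change _ • _ • D.deriv (D.neutral a) = _
    module
  · rw [← map_sum, (B.isDualPair_uhalf_uhalfd hA3).expand_left]
    rfl
  all_goals simp

/-- A field that commutes with the neutral ghosts commutes with `L^ne`. -/
theorem OPE_Lne_zero [FiniteDimensional ℂ g]
    (hA3 : Set.BijOn (D.bracket D.f) (D.gr (1 / 2)) (D.gr (-1 / 2))) {p : ZMod 2} {X : D.Fld}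
    (hX : FieldParity p X) (h : ∀ a, OPE X (D.neutral a) 0 0 0 0) : OPE X B.Lne 0 0 0 0 := by
  have t : ∀ i : B.S', OPE X (D.normalOrd (D.deriv (B.Φd i)) (B.Φ i)) 0 0 0 0 := fun i =>
    OPE.wick_zero hX (fieldParity_neutral (B.uhalfd_mem_part hA3 i)).deriv
      (isField_neutral _).deriv (B.isField_Φ i) (h _).deriv_right_zero (h _)
  exact ((OPE.sum_right Finset.univ fun i _ => t i).smul_right _).congr
    (by simp) (by simp) (by simp) (by simp)

theorem fieldParity_L [FiniteDimensional ℂ g]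
    (hA3 : Set.BijOn (D.bracket D.f) (D.gr (1 / 2)) (D.gr (-1 / 2))) : FieldParity 0 B.L := by
  have hp : ∀ p : ZMod 2, p + p = 0 := fun p => CharTwo.add_self_eq_zero p
  refine ((FieldParity.add ?_ ?_).add ?_).add ?_
  · refine (FieldParity.sum fun i _ => FieldParity.smul ?_ _).smul _
    rw [← hp (B.parity i)]
    exact (fieldParity_current (B.mem_part i)).normalOrd (fieldParity_current (B.ud_mem_part i))
      (isField_current _) (isField_current _)
  · exact (fieldParity_current x_mem_part).deriv
  · have h1 : FieldParity 0 (∑ i : B.S, (B.deg i : ℂ) •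
        D.normalOrd (B.φs i) (D.deriv (B.φ i))) := by
      refine FieldParity.sum fun i _ => FieldParity.smul ?_ _
      rw [← hp (B.parity i + 1)]
      exact (B.fieldParity_φs i).normalOrd (B.fieldParity_φ i).deriv (B.isField_φs i)
        (B.isField_φ i).deriv
    have h2 := h1.smul (-1)
    rw [neg_one_smul] at h2
    refine h2.add (FieldParity.sum fun i _ => FieldParity.smul ?_ _)
    rw [← hp (B.parity i + 1)]
    exact (B.fieldParity_φs i).deriv.normalOrd (B.fieldParity_φ i) (B.isField_φs i).deriv
      (B.isField_φ i)
  · refine (FieldParity.sum fun i _ => ?_).smul _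
    rw [← hp (B.parity i)]
    exact (fieldParity_neutral (B.uhalfd_mem_part hA3 i)).deriv.normalOrd (B.fieldParity_Φ i)
      (isField_neutral _).deriv (B.isField_Φ i)

section Weights

variable [FiniteDimensional ℂ g]

/-- `a(z)`, `a ∈ g_m`, has weight `1 - m`, and is primary if `(a|x) = 0`. -/
theorem OPE_L_current (hk : D.k + D.dualCoxeter ≠ 0)
    (hA3 : Set.BijOn (D.bracket D.f) (D.gr (1 / 2)) (D.gr (-1 / 2)))
    {p : ZMod 2} {m : ℚ} {a : g} (ha : a ∈ part D.Γ p) (ha' : a ∈ D.gr m) :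
    OPE B.L (D.current a) (D.deriv (D.current a)) ((1 - (m : ℂ)) • D.current a)
      ((-(2 * (D.k * D.form a D.x))) • D.one) 0 := by
  refine OPE.flip (B.fieldParity_L hA3) ?_
  have hX := fieldParity_current ha
  have h0 : ∀ b : D.Gen, b.1 = 0 → OPE (D.current a) (D.field b) 0 0 0 0 := fun b hb =>
    OPE.field_zero (Or.inr hb) (by simp [ghostForm])
  refine ((((B.OPE_current_Lg hk ha).add_right (OPE_current_deriv_x ha')).add_right
    (B.OPE_Lch_zero hX (fun i => h0 _ rfl) fun i => h0 _ rfl)).add_right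
      (B.OPE_Lne_zero hA3 hX fun a => h0 _ rfl)).congr ?_ ?_ ?_ ?_
  · module
  · module
  · simp
  · simp

theorem OPE_L_φ (hA3 : Set.BijOn (D.bracket D.f) (D.gr (1 / 2)) (D.gr (-1 / 2))) (i : B.S) :
    OPE B.L (B.φ i) (D.deriv (B.φ i)) ((1 - (B.deg i : ℂ)) • B.φ i) 0 0 := by
  have hX := B.fieldParity_φ i
  have h0 : ∀ b : D.Gen, b.2 = (0, 0, b.2.2.2) → OPE (B.φ i) (D.field b) 0 0 0 0 := fun b hb =>
    OPE.field_zero (Or.inl rfl) (by rw [ghostForm, hb]; simp)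
  refine (OPE.flip (κ := 0) (B.fieldParity_L hA3) ?_).congr rfl rfl (by simp) rfl
  refine ((((B.OPE_Lg_zero hX fun a => h0 _ rfl).add_right
    (h0 (D.x, 0, 0, 0) rfl).deriv_right_zero).add_right (B.OPE_φ_Lch i)).add_right
      (B.OPE_Lne_zero hA3 hX fun a => h0 _ rfl)).congr ?_ ?_ ?_ ?_ <;> simp

theorem OPE_L_φs (hA3 : Set.BijOn (D.bracket D.f) (D.gr (1 / 2)) (D.gr (-1 / 2))) (i : B.S) :
    OPE B.L (B.φs i) (D.deriv (B.φs i)) ((B.deg i : ℂ) • B.φs i) 0 0 := by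
  have hX := B.fieldParity_φs i
  have h0 : ∀ b : D.Gen, b.2 = (0, 0, b.2.2.2) → OPE (B.φs i) (D.field b) 0 0 0 0 := fun b hb =>
    OPE.field_zero (Or.inl rfl) (by rw [ghostForm, hb]; simp)
  refine (OPE.flip (κ := 0) (B.fieldParity_L hA3) ?_).congr rfl rfl (by simp) rfl
  refine ((((B.OPE_Lg_zero hX fun a => h0 _ rfl).add_right
    (h0 (D.x, 0, 0, 0) rfl).deriv_right_zero).add_right (B.OPE_φs_Lch i)).add_right
      (B.OPE_Lne_zero hA3 hX fun a => h0 _ rfl)).congr ?_ ?_ ?_ ?_ <;> simp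

theorem OPE_L_neutral (hA3 : Set.BijOn (D.bracket D.f) (D.gr (1 / 2)) (D.gr (-1 / 2)))
    {p : ZMod 2} {a : D.ghalf} (ha : (a : g) ∈ part D.Γ p) :
    OPE B.L (D.neutral a) (D.deriv (D.neutral a)) ((1 / 2 : ℂ) • D.neutral a) 0 0 := by
  have hX := fieldParity_neutral ha
  have h0 : ∀ b : D.Gen, b.2.2.2 = 0 → OPE (D.neutral a) (D.field b) 0 0 0 0 := fun b hb =>
    OPE.field_zero (Or.inl rfl) (by rw [ghostForm, hb]; simp)
  refine (OPE.flip (κ := 0) (B.fieldParity_L hA3) ?_).congr rfl rfl (by simp) rfl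
  refine ((((B.OPE_Lg_zero hX fun a => h0 _ rfl).add_right
    (h0 (D.x, 0, 0, 0) rfl).deriv_right_zero).add_right
      (B.OPE_Lch_zero hX (fun i => h0 _ rfl) fun i => h0 _ rfl)).add_right
        (B.OPE_neutral_Lne hA3 ha)).congr ?_ ?_ ?_ ?_ <;> simp

end Weights

end HomogeneousBasis

/-! ### Fields with prescribed brackets with `L` -/

/-- `[L_λ Z] = (∂ + 2λ) Z + λ² Y / 2 + λ³ c / 6` for some field `Y`. -/
def IsQuasiVirasoro (L Z : D.Fld) (c : ℂ) : Prop :=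
  ∃ Y, OPE L Z (D.deriv Z) ((2 : ℂ) • Z) Y (c • D.one)

theorem IsQuasiVirasoro.add {L Z Z' : D.Fld} {c c' : ℂ} (h : IsQuasiVirasoro L Z c)
    (h' : IsQuasiVirasoro L Z' c') : IsQuasiVirasoro L (Z + Z') (c + c') := by
  obtain ⟨Y, hY⟩ := h
  obtain ⟨Y', hY'⟩ := h'
  exact ⟨_, (hY.add_right hY').congr (map_add _ _ _).symm (smul_add _ _ _).symm rfl
    (add_smul _ _ _).symm⟩

theorem IsQuasiVirasoro.smul {L Z : D.Fld} {c : ℂ} (h : IsQuasiVirasoro L Z c) (r : ℂ) :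
    IsQuasiVirasoro L (r • Z) (r * c) := by
  obtain ⟨Y, hY⟩ := h
  exact ⟨_, (hY.smul_right r).congr (map_smul _ _ _).symm (smul_comm _ _ _) rfl
    (smul_smul _ _ _)⟩

theorem IsQuasiVirasoro.neg {L Z : D.Fld} {c : ℂ} (h : IsQuasiVirasoro L Z c) :
    IsQuasiVirasoro L (-Z) (-c) := by
  simpa using h.smul (-1)

theorem IsQuasiVirasoro.sum {α : Type*} [Fintype α] {L : D.Fld} {Z : α → D.Fld} {c : α → ℂ}
    (h : ∀ i, IsQuasiVirasoro L (Z i) (c i)) : IsQuasiVirasoro L (∑ i, Z i) (∑ i, c i) := by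
  choose Y hY using h
  refine ⟨_, (OPE.sum_right Finset.univ fun i _ => hY i).congr ?_ ?_ rfl ?_⟩
  · rw [map_sum]
  · rw [Finset.smul_sum]
  · rw [Finset.sum_smul]

theorem OPE.smul_one_left (a : D.Fld) (c : ℂ) :
    OPE (c • D.one) a ((0 : ℂ) • D.one) 0 0 0 :=
  ((OPE.one_left a).smul_left c).congr (by simp) (by simp) (by simp) (by simp)

/-- `[L_λ Z] = (∂ + λ) Z`. -/
def IsCurrent (L Z : D.Fld) : Prop := OPE L Z (D.deriv Z) Z 0 0

theorem IsCurrent.add {L Z Z' : D.Fld} (h : IsCurrent L Z) (h' : IsCurrent L Z') :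
    IsCurrent L (Z + Z') :=
  (OPE.add_right h h').congr (map_add _ _ _).symm rfl (add_zero 0) (add_zero 0)

theorem IsCurrent.smul {L Z : D.Fld} (h : IsCurrent L Z) (r : ℂ) : IsCurrent L (r • Z) :=
  (OPE.smul_right h r).congr (map_smul _ _ _).symm rfl (smul_zero r) (smul_zero r)

theorem IsCurrent.sum {α : Type*} {s : Finset α} {L : D.Fld} {Z : α → D.Fld}
    (h : ∀ i ∈ s, IsCurrent L (Z i)) : IsCurrent L (∑ i ∈ s, Z i) :=
  Finset.sum_induction Z (IsCurrent L) (fun _ _ => IsCurrent.add)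
    ((OPE.zero_right L).congr (map_zero _).symm rfl rfl rfl) h

/-- Two commuting primary fields of weights `Δ`, `Δ'` have a primary normally ordered product. -/
theorem OPE.normalOrd_primary {q : ZMod 2} {L a b : D.Fld} {Δ Δ' : ℂ}
    (hL : FieldParity 0 L) (hpa : FieldParity q a) (ha : IsField a) (hb : IsField b)
    (h1 : OPE L a (D.deriv a) (Δ • a) 0 0) (h2 : OPE L b (D.deriv b) (Δ' • b) 0 0)
    (h : OPE a b 0 0 0 0) :
    OPE L (D.normalOrd a b) (D.deriv (D.normalOrd a b)) ((Δ + Δ') • D.normalOrd a b) 0 0 := by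
  have z : ((0 : ℂ) • D.one : D.Fld) = 0 := zero_smul _ _
  refine (OPE.wick_weight (γ := 0) (ε := 0) hL hpa ha hb IsField.zero IsField.zero h1 h2
    (h.congr rfl z.symm rfl rfl) ((OPE.zero_left b).congr z.symm rfl rfl rfl)).congr rfl rfl ?_ ?_
  · simp [normalOrd_zero_left, normalOrd_zero_right]
  · simp

namespace HomogeneousBasis

variable {ι : Type*} (B : D.HomogeneousBasis ι) [Fintype ι] [DecidableEq ι]
  [FiniteDimensional ℂ g]

/-! ### The Virasoro relation -/

/-- The pair `u_i`, `u^i` has weights `1 - m_i`, `1 + m_i` and contributes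
`(-1)^{p(u_i)} k (1 - 3 m_i)`; the supertrace of `ad x` vanishes. -/
theorem isQuasiVirasoro_Lg (hk : D.k + D.dualCoxeter ≠ 0)
    (hA3 : Set.BijOn (D.bracket D.f) (D.gr (1 / 2)) (D.gr (-1 / 2))) :
    IsQuasiVirasoro B.L B.Lg (D.k * sdim D.Γ ⊤ / (2 * (D.k + D.dualCoxeter))) := by
  have hL := B.fieldParity_L hA3
  have hterm : ∀ i, IsQuasiVirasoro B.L
      (sgn (B.parity i) • D.normalOrd (D.current (B.u i)) (D.current (B.ud i)))
      (sgn (B.parity i) * ((3 * (1 - (B.deg i : ℂ)) - 2) * D.k)) := by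
    intro i
    refine IsQuasiVirasoro.smul ?_ _
    refine ⟨_, (OPE.wick_weight (γ := D.k) (ε := 0) hL (fieldParity_current (B.mem_part i))
      (isField_current _) (isField_current _) (isField_one.smul _) (isField_one.smul _)
      (B.OPE_L_current hk hA3 (B.mem_part i) (B.mem_gr i))
      (B.OPE_L_current hk hA3 (B.ud_mem_part i) (B.ud_mem_gr i))
      ((OPE.current_current _ _).congr rfl ?_ rfl rfl)
      (OPE.smul_one_left _ _)).congr rfl ?_ rfl ?_⟩
    · rw [form_u_ud, if_pos rfl, mul_one]
    · congr 1
      push_cast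
      ring
    · rw [mul_zero, add_zero]
  have hsum := (IsQuasiVirasoro.sum hterm).smul (1 / (2 * (D.k + D.dualCoxeter)))
  have hd : sdim D.Γ ⊤ = ∑ i, sgn (B.parity i) := by
    rw [B.sdim_eq_sum (Q := fun _ => True) (by simp)]
    exact Fintype.sum_equiv (Equiv.subtypeUnivEquiv fun _ => trivial) _ _ fun _ => rfl
  have hc : ∑ i, sgn (B.parity i) * ((3 * (1 - (B.deg i : ℂ)) - 2) * D.k)
      = D.k * sdim D.Γ ⊤ := by
    have e : ∀ i, sgn (B.parity i) * ((3 * (1 - (B.deg i : ℂ)) - 2) * D.k)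
        = D.k * sgn (B.parity i) - (3 * D.k) * (sgn (B.parity i) * B.deg i) := fun i => by ring
    simp only [e]
    rw [Finset.sum_sub_distrib, ← Finset.mul_sum, ← Finset.mul_sum, B.sum_sgn_mul_deg, hd]
    ring
  rw [hc, one_div_mul_eq_div] at hsum
  exact hsum

/-- The scalar comes from `x(z)` not being primary. -/
theorem isQuasiVirasoro_deriv_x (hk : D.k + D.dualCoxeter ≠ 0)
    (hA3 : Set.BijOn (D.bracket D.f) (D.gr (1 / 2)) (D.gr (-1 / 2))) :
    IsQuasiVirasoro B.L (D.deriv (D.current D.x)) (-(6 * (D.k * D.form D.x D.x))) := by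
  refine ⟨_, (B.OPE_L_current hk hA3 x_mem_part x_mem_gr).deriv_right.congr rfl ?_ rfl ?_⟩
  · rw [map_smul]
    push_cast
    module
  · module

/-- A pair of charged ghosts contributes `-m (3m - 2) + (1 - m) (3m - 1) = -(6m² - 6m + 1)`, up to
the sign `(-1)^{p(u_i)}`. -/
theorem isQuasiVirasoro_Lch
    (hA3 : Set.BijOn (D.bracket D.f) (D.gr (1 / 2)) (D.gr (-1 / 2))) :
    IsQuasiVirasoro B.L B.Lch
      (-∑ i : B.S, sgn (B.parity i) * (6 * (B.deg i : ℂ) ^ 2 - 6 * (B.deg i : ℂ) + 1)) := by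
  have hL := B.fieldParity_L hA3
  have t1 : ∀ i : B.S, IsQuasiVirasoro B.L
      ((B.deg i : ℂ) • D.normalOrd (B.φs i) (D.deriv (B.φ i)))
      ((B.deg i : ℂ) * ((3 * (B.deg i : ℂ) - 2) * sgn (B.parity i))) := by
    intro i
    refine IsQuasiVirasoro.smul ?_ _
    refine ⟨_, (OPE.wick_weight (Δ := B.deg i) (Δ' := 2 - B.deg i) (γ := sgn (B.parity i))
      (ε := 0) (B := ((2 : ℂ) * (1 - B.deg i)) • B.φ i) hL (B.fieldParity_φs i)
      (B.isField_φs i) (B.isField_φ i).deriv IsField.zero ((B.isField_φ i).smul _)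
      (B.OPE_L_φs hA3 i) ((B.OPE_L_φ hA3 i).deriv_right.congr rfl ?_ ?_ ?_)
      ((B.OPE_φs_φ i i).deriv_right_scalar.congr rfl ?_ rfl rfl)
      ((OPE.zero_left _).congr ?_ rfl rfl rfl)).congr rfl ?_ rfl ?_⟩
    · rw [map_smul]; module
    · rw [map_zero, zero_add, smul_smul]
    · simp
    · rw [if_pos rfl]
    · rw [zero_smul]
    · congr 1; ring
    · rw [mul_zero, add_zero]
  have t2 : ∀ i : B.S, IsQuasiVirasoro B.L
      ((1 - (B.deg i : ℂ)) • D.normalOrd (D.deriv (B.φs i)) (B.φ i))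
      ((1 - (B.deg i : ℂ)) * ((3 * (B.deg i : ℂ) - 1) * sgn (B.parity i))) := by
    intro i
    refine IsQuasiVirasoro.smul ?_ _
    refine ⟨_, (OPE.wick_weight (Δ := 1 + B.deg i) (Δ' := 1 - B.deg i) (γ := -sgn (B.parity i))
      (ε := 2 * B.deg i * sgn (B.parity i)) (A := ((2 : ℂ) * B.deg i) • B.φs i)
      hL (B.fieldParity_φs i).deriv
      (B.isField_φs i).deriv (B.isField_φ i) ((B.isField_φs i).smul _) IsField.zero
      ((B.OPE_L_φs hA3 i).deriv_right.congr rfl ?_ ?_ ?_) (B.OPE_L_φ hA3 i)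
      ((B.OPE_φs_φ i i).deriv_left_scalar.congr rfl ?_ rfl rfl)
      (((B.OPE_φs_φ i i).smul_left _).congr ?_ ?_ ?_ ?_)).congr rfl ?_ rfl ?_⟩
    · rw [map_smul]; module
    · rw [map_zero, zero_add, smul_smul]
    · simp
    · rw [if_pos rfl]
    · rw [if_pos rfl, smul_smul]
    · simp
    · simp
    · simp
    · congr 1; ring
    · congr 1; ring
  have h := (IsQuasiVirasoro.sum t1).neg.add (IsQuasiVirasoro.sum t2)
  have hc : -∑ i : B.S, sgn (B.parity i) * (6 * (B.deg i : ℂ) ^ 2 - 6 * (B.deg i : ℂ) + 1)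
      = -(∑ i : B.S, (B.deg i : ℂ) * ((3 * (B.deg i : ℂ) - 2) * sgn (B.parity i)))
        + ∑ i : B.S, (1 - (B.deg i : ℂ)) * ((3 * (B.deg i : ℂ) - 1) * sgn (B.parity i)) := by
    rw [← Finset.sum_neg_distrib, ← Finset.sum_neg_distrib, ← Finset.sum_add_distrib]
    exact Finset.sum_congr rfl fun i _ => by ring
  rw [hc]
  exact h

/-- Each `:(∂Φ^i) Φ_i:` contributes `(3 · 3/2 - 2) - 3 = -1/2`, up to the sign `(-1)^{p(u_i)}`. -/
theorem isQuasiVirasoro_Lne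
    (hA3 : Set.BijOn (D.bracket D.f) (D.gr (1 / 2)) (D.gr (-1 / 2))) :
    IsQuasiVirasoro B.L B.Lne (-(1 / 4 * sdim D.Γ D.ghalf)) := by
  have hL := B.fieldParity_L hA3
  have hterm : ∀ i : B.S', IsQuasiVirasoro B.L (D.normalOrd (D.deriv (B.Φd i)) (B.Φ i))
      (-(1 / 2 * sgn (B.parity i))) := by
    intro i
    have hp := B.uhalfd_mem_part hA3 i
    have hγ : D.neForm (B.uhalfd i) (B.uhalf i) = -sgn (B.parity i) := by
      rw [neForm_comm hp (b := B.uhalf i) (B.mem_part i), B.neForm_uhalf_uhalfd hA3, if_pos rfl,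
        sgn_mul_self, mul_one]
    have hn := OPE.neutral_neutral (B.uhalfd i) (B.uhalf i)
    rw [hγ] at hn
    have hw := B.OPE_L_neutral hA3 hp
    refine ⟨_, (OPE.wick_weight (Δ := 3 / 2) (Δ' := 1 / 2) (γ := sgn (B.parity i))
      (ε := -sgn (B.parity i)) (A := D.neutral (B.uhalfd i)) hL (fieldParity_neutral hp).deriv
      (isField_neutral _).deriv (B.isField_Φ i) (isField_neutral _) IsField.zero
      (hw.deriv_right.congr rfl ?_ ?_ ?_)
      (B.OPE_L_neutral hA3 (a := B.uhalf i) (B.mem_part i))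
      (hn.deriv_left_scalar.congr rfl ?_ rfl rfl) hn).congr rfl ?_ rfl ?_⟩
    · rw [map_smul]; module
    · rw [map_zero, zero_add, smul_smul]; module
    · simp
    · rw [neg_neg]
    · congr 1; norm_num
    · congr 1; ring
  have h := (IsQuasiVirasoro.sum hterm).smul (1 / 2)
  rw [B.sdim_eq_sum fun _ => B.mem_ghalf_iff]
  have hc : -(1 / 4 * ∑ i : B.S', sgn (B.parity i))
      = 1 / 2 * ∑ i : B.S', -(1 / 2 * sgn (B.parity i)) := by
    rw [Finset.sum_neg_distrib, ← Finset.mul_sum]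
    ring
  rw [hc]
  exact h

/-- The Virasoro relation for `L`, at the level of fields. -/
theorem OPE_L_L (hk : D.k + D.dualCoxeter ≠ 0)
    (hA3 : Set.BijOn (D.bracket D.f) (D.gr (1 / 2)) (D.gr (-1 / 2))) :
    OPE B.L B.L (D.deriv B.L) ((2 : ℂ) • B.L) 0 ((B.centralCharge / 2) • D.one) := by
  obtain ⟨Y, hY⟩ := (((B.isQuasiVirasoro_Lg hk hA3).add (B.isQuasiVirasoro_deriv_x hk hA3)).add
    (B.isQuasiVirasoro_Lch hA3)).add (B.isQuasiVirasoro_Lne hA3)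
  have hY0 : Y = 0 := OPE.eq_zero_of_even (B.fieldParity_L hA3) hY
  refine hY.congr rfl rfl hY0 ?_
  congr 1
  have e : ∑ i : B.S, sgn (B.parity i) * (12 * (B.deg i : ℂ) ^ 2 - 12 * (B.deg i : ℂ) + 2)
      = 2 * ∑ i : B.S, sgn (B.parity i) * (6 * (B.deg i : ℂ) ^ 2 - 6 * (B.deg i : ℂ) + 1) := by
    rw [Finset.mul_sum]
    exact Finset.sum_congr rfl fun i _ => by ring
  rw [centralCharge, e]
  field_simp
  ring

/-! ### The differential -/

/-- `d` is a primary field of weight one: `(u_i|x) = 0` for `m_i > 0`, `[u_i, u_j]` has degree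
`m_i + m_j`, `(f|u_i) ≠ 0` only if `m_i = 1`, and no summand has contractions between its factors. -/
theorem isCurrent_d (hk : D.k + D.dualCoxeter ≠ 0)
    (hA3 : Set.BijOn (D.bracket D.f) (D.gr (1 / 2)) (D.gr (-1 / 2))) : IsCurrent B.L B.d := by
  have hL := B.fieldParity_L hA3
  have z : ((0 : ℂ) • D.one : D.Fld) = 0 := zero_smul _ _
  have hss : ∀ i j, OPE (B.φs i) (B.φs j) 0 0 0 0 := fun i j =>
    OPE.field_zero (Or.inl rfl) (by simp [ghostForm])
  rw [HomogeneousBasis.d, sub_eq_add_neg, ← neg_smul]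
  refine ((IsCurrent.add (IsCurrent.sum fun i _ => IsCurrent.smul ?_ _)
    (IsCurrent.smul (IsCurrent.sum fun i _ => IsCurrent.sum fun j _ => IsCurrent.sum
      fun l _ => ?_) _)).add (IsCurrent.sum fun i _ => ?_)).add (IsCurrent.sum fun i _ => ?_)
  · have hx : D.form (B.u i) D.x = 0 := by
      rw [form_comm (B.mem_part i), B.form_x_u i.2.ne', mul_zero]
    refine (OPE.normalOrd_primary hL (fieldParity_current (B.mem_part i)) (isField_current _)
      (B.isField_φs i) ((B.OPE_L_current hk hA3 (B.mem_part i) (B.mem_gr i)).congr rfl rfl ?_ rfl)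
      (B.OPE_L_φs hA3 i) (OPE.field_zero (Or.inr rfl) (by simp [ghostForm]))).congr rfl ?_ rfl rfl
    · rw [hx, mul_zero, mul_zero, neg_zero, zero_smul]
    · rw [sub_add_cancel, one_smul]
  · by_cases hc : B.c i j l = 0
    · rw [hc, mul_zero, zero_smul]
      exact (OPE.zero_right B.L).congr (map_zero _).symm rfl rfl rfl
    refine IsCurrent.smul ?_ _
    have hdeg : B.deg l = B.deg i + B.deg j := by
      by_contra h
      exact hc (B.c_eq_zero_of_deg h)
    -- `m_l = m_i + m_j` with `m_i, m_j > 0` excludes the contractions of `φ_l` with `φ^*_i`, `φ^*_j`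
    have hli : l ≠ i := by
      rintro rfl
      have := j.2
      linarith
    have hlj : l ≠ j := by
      rintro rfl
      have := i.2
      linarith
    have h0 : OPE (B.φ l) (D.normalOrd (B.φs i) (B.φs j)) 0 0 0 0 :=
      OPE.wick_zero (B.fieldParity_φ l) (B.fieldParity_φs i) (B.isField_φs i) (B.isField_φs j)
        ((B.OPE_φ_φs l i).congr (by rw [if_neg hli, z]) rfl rfl rfl)
        ((B.OPE_φ_φs l j).congr (by rw [if_neg hlj, z]) rfl rfl rfl)
    refine (OPE.normalOrd_primary hL (B.fieldParity_φ l) (B.isField_φ l)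
      ((B.isField_φs i).normalOrd (B.isField_φs j)) (B.OPE_L_φ hA3 l)
      (OPE.normalOrd_primary hL (B.fieldParity_φs i) (B.isField_φs i) (B.isField_φs j)
        (B.OPE_L_φs hA3 i) (B.OPE_L_φs hA3 j) (hss i j)) h0).congr rfl ?_ rfl rfl
    rw [hdeg]
    push_cast
    rw [sub_add_cancel, one_smul]
  · by_cases hi : B.deg i = 1
    · refine IsCurrent.smul ((B.OPE_L_φs hA3 i).congr rfl ?_ rfl rfl) _
      rw [hi]
      push_cast
      rw [one_smul]
    · rw [B.form_f_u_of_deg hi, zero_smul]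
      exact (OPE.zero_right B.L).congr (map_zero _).symm rfl rfl rfl
  · refine (OPE.normalOrd_primary hL (B.fieldParity_φs _) (B.isField_φs _) (B.isField_Φ i)
      (B.OPE_L_φs hA3 _) (B.OPE_L_neutral hA3 (a := B.uhalf i) (B.mem_part i))
      (OPE.field_zero (Or.inl rfl) (by simp [ghostForm]))).congr rfl ?_ rfl rfl
    have hdeg : B.deg (B.S'toS i) = 1 / 2 := i.2
    rw [hdeg]
    push_cast
    change (1 / 2 + 1 / 2 : ℂ) • _ = _
    rw [add_halves, one_smul]

/-- For a primary field `d` of weight one, `[L_(n), d_(0)] = (∂d)_(n) + n d_(n-1) = 0`. -/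
theorem superComm_d0_L (hk : D.k + D.dualCoxeter ≠ 0)
    (hA3 : Set.BijOn (D.bracket D.f) (D.gr (1 / 2)) (D.gr (-1 / 2))) (n : ℤ) :
    D.superComm B.d0 (B.L n) = 0 := by
  have hL := B.fieldParity_L hA3 n
  have h := B.isCurrent_d hk hA3 n 0
  rw [superComm_eq hL, tw_zero] at h
  rw [superComm_eq_of_even_right _ hL, ← neg_sub, d0, h]
  simp only [deriv_apply, Pi.zero_apply, smul_zero, add_zero]
  module

omit [DecidableEq ι] [FiniteDimensional ℂ g] in
theorem fieldParity_d : FieldParity 1 B.d := by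
  have hp : ∀ p : ZMod 2, p + (p + 1) = 1 := fun p => by
    rw [← add_assoc, CharTwo.add_self_eq_zero, zero_add]
  rw [HomogeneousBasis.d, sub_eq_add_neg, ← neg_smul]
  refine ((FieldParity.add (FieldParity.sum fun i _ => FieldParity.smul ?_ _)
    (FieldParity.smul (FieldParity.sum fun i _ => FieldParity.sum fun j _ => FieldParity.sum
      fun l _ => ?_) _)).add (FieldParity.sum fun i _ => ?_)).add (FieldParity.sum fun i _ => ?_)
  · rw [← hp (B.parity i)]
    exact (fieldParity_current (B.mem_part i)).normalOrd (B.fieldParity_φs i) (isField_current _)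
      (B.isField_φs i)
  · by_cases hc : B.c i j l = 0
    · rw [hc, mul_zero, zero_smul]
      exact FieldParity.zero 1
    refine FieldParity.smul ?_ _
    have hpar : B.parity l = B.parity i + B.parity j := by
      by_contra h
      exact hc (B.c_eq_zero_of_parity h)
    have h := (B.fieldParity_φ l).normalOrd ((B.fieldParity_φs i).normalOrd (B.fieldParity_φs j)
      (B.isField_φs i) (B.isField_φs j)) (B.isField_φ l)
        ((B.isField_φs i).normalOrd (B.isField_φs j))
    have e : B.parity l + 1 + (B.parity i + 1 + (B.parity j + 1)) = 1 := by
      rw [hpar]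
      have h1 := CharTwo.add_self_eq_zero (B.parity i : ZMod 2)
      have h2 := CharTwo.add_self_eq_zero (B.parity j : ZMod 2)
      have h3 := CharTwo.add_self_eq_zero (1 : ZMod 2)
      linear_combination h1 + h2 + h3
    rwa [e] at h
  · by_cases hi : B.parity i = 0
    · have h := (B.fieldParity_φs i).smul (D.form D.f (B.u i))
      rwa [hi, zero_add] at h
    · rw [B.form_f_u_of_parity hi, zero_smul]
      exact FieldParity.zero 1
  · rw [← hp (B.parity i), add_comm]
    exact (B.fieldParity_φs _).normalOrd (B.fieldParity_Φ i) (B.isField_φs _) (B.isField_Φ i)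

end HomogeneousBasis

/-! ### Products on the homology -/

theorem iterate_deriv_add (n : ℕ) (a b : D.Fld) :
    (D.deriv)^[n] (a + b) = (D.deriv)^[n] a + (D.deriv)^[n] b := by
  simp only [← Module.End.pow_apply, map_add]

theorem iterate_deriv_smul (n : ℕ) (c : ℂ) (a : D.Fld) :
    (D.deriv)^[n] (c • a) = c • (D.deriv)^[n] a := by
  simp only [← Module.End.pow_apply, map_smul]

theorem nprod_add_left (n : ℤ) {a a' b : D.Fld} (ha : IsField a) (ha' : IsField a')
    (hb : IsField b) : D.nprod n (a + a') b = D.nprod n a b + D.nprod n a' b := by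
  cases n with
  | ofNat n =>
    funext m
    simp only [nprod, Pi.add_apply, superComm_add_left, smul_add, Finset.sum_add_distrib]
  | negSucc n =>
    simp only [nprod]
    rw [iterate_deriv_add, normalOrd_add_left (ha.iterate_deriv n) (ha'.iterate_deriv n) hb,
      smul_add]

theorem nprod_add_right (n : ℤ) {a b b' : D.Fld} (ha : IsField a) (hb : IsField b)
    (hb' : IsField b') : D.nprod n a (b + b') = D.nprod n a b + D.nprod n a b' := by
  cases n with
  | ofNat n =>
    funext m
    simp only [nprod, Pi.add_apply, superComm_add_right, smul_add, Finset.sum_add_distrib]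
  | negSucc n =>
    simp only [nprod]
    rw [normalOrd_add_right (ha.iterate_deriv n) hb hb', smul_add]

theorem nprod_smul_left (n : ℤ) (c : ℂ) (a b : D.Fld) :
    D.nprod n (c • a) b = c • D.nprod n a b := by
  cases n with
  | ofNat n =>
    funext m
    simp only [nprod, Pi.smul_apply, superComm_smul_left, Finset.smul_sum, smul_comm c]
  | negSucc n =>
    simp only [nprod]
    rw [iterate_deriv_smul, normalOrd_smul_left, smul_comm]

theorem nprod_smul_right (n : ℤ) (c : ℂ) (a b : D.Fld) :
    D.nprod n a (c • b) = c • D.nprod n a b := by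
  cases n with
  | ofNat n =>
    funext m
    simp only [nprod, Pi.smul_apply, superComm_smul_right, Finset.smul_sum, smul_comm c]
  | negSucc n =>
    simp only [nprod]
    rw [normalOrd_smul_right, smul_comm]

theorem nprod_zero_left (n : ℤ) (b : D.Fld) : D.nprod n 0 b = 0 := by
  simpa using nprod_smul_left n 0 0 b

theorem nprod_zero_right (n : ℤ) (a : D.Fld) : D.nprod n a 0 = 0 := by
  simpa using nprod_smul_right n 0 a 0

theorem par_nprod (n : ℤ) {a b : D.Fld} (ha : IsField a) (hb : IsField b) :
    (fun m => D.par (D.nprod n a b m))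
      = D.nprod n (fun m => D.par (a m)) (fun m => D.par (b m)) := by
  funext m
  cases n with
  | ofNat n =>
    simp only [nprod, map_sum, map_smul, par_superComm]
  | negSucc n =>
    have h := iterate_deriv_tw 1 a n
    simp only [tw_one] at h
    simp only [nprod, Pi.smul_apply, map_smul]
    rw [par_normalOrd (ha.iterate_deriv n) hb, h]

theorem par_field (a : D.Gen) : (fun n => D.par (D.field a n)) = D.field (D.genΓ a) := by
  funext n
  rw [field, par_coe, parU_mode, field]

/-- The charge spaces are stable under the parity automorphism. -/
theorem HasCharge.par {m : ℤ} {a : D.Fld} (h : D.HasCharge m a) :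
    D.HasCharge m fun n => D.par (a n) := by
  induction h with
  | one =>
    convert HasCharge.one (D := D) using 1
    funext n
    rw [ReductionData.one]
    split_ifs <;> simp
  | current a =>
    rw [ReductionData.current, par_field]
    simpa [genΓ, ReductionData.current] using HasCharge.current (D := D) (D.Γ a)
  | neutral a =>
    rw [ReductionData.neutral, par_field]
    simpa [genΓ, ReductionData.neutral] using HasCharge.neutral (D := D) (D.Γhalf a)
  | ghost a =>
    rw [ReductionData.ghost, par_field]
    simpa [genΓ, ReductionData.ghost] using HasCharge.ghost (D := D) (-D.Γplus a)
  | ghostDual a =>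
    rw [ReductionData.ghostDual, par_field]
    simpa [genΓ, ReductionData.ghostDual] using HasCharge.ghostDual (D := D) (-D.Γplus.dualMap a)
  | zero m =>
    convert HasCharge.zero (D := D) m using 1
    funext n
    simp
  | add m a b _ _ ha hb =>
    convert HasCharge.add m _ _ ha hb using 1
    funext n
    simp
  | smul m c a _ ha =>
    convert HasCharge.smul m c _ ha using 1
    funext n
    simp
  | deriv m a _ ha =>
    convert HasCharge.deriv m _ ha using 1
    funext n
    simp [deriv_apply]
  | nprod m m' n a b h h' ha hb =>
    rw [par_nprod n h.isField h'.isField]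
    exact HasCharge.nprod m m' n _ _ ha hb

theorem nprod_neg_one (a b : D.Fld) : D.nprod (-1) a b = D.normalOrd a b := by
  change (1 / (Nat.factorial 0 : ℂ)) • D.normalOrd a b = _
  simp

theorem HasCharge.normalOrd {m m' l : ℤ} {a b : D.Fld} (ha : D.HasCharge m a)
    (hb : D.HasCharge m' b) (h : m + m' = l) : D.HasCharge l (D.normalOrd a b) := by
  rw [← nprod_neg_one, ← h]
  exact HasCharge.nprod m m' (-1) a b ha hb

namespace HomogeneousBasis

variable {ι : Type*} [Fintype ι] (B : D.HomogeneousBasis ι)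

theorem L_mem_chargePart [DecidableEq ι] : B.L ∈ D.chargePart 0 := by
  refine Submodule.add_mem _ (Submodule.add_mem _ (Submodule.add_mem _ ?_ ?_) ?_) ?_
  · refine Submodule.smul_mem _ _ (Submodule.sum_mem _ fun i _ => Submodule.smul_mem _ _ ?_)
    exact (HasCharge.current _).normalOrd (HasCharge.current _) rfl
  · exact HasCharge.deriv 0 _ (HasCharge.current _)
  · refine Submodule.add_mem _ (Submodule.neg_mem _ ?_) ?_
    · refine Submodule.sum_mem _ fun i _ => Submodule.smul_mem _ _ ?_
      exact (HasCharge.ghostDual _).normalOrd (HasCharge.deriv _ _ (HasCharge.ghost _)) rfl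
    · refine Submodule.sum_mem _ fun i _ => Submodule.smul_mem _ _ ?_
      exact (HasCharge.deriv _ _ (HasCharge.ghostDual _)).normalOrd (HasCharge.ghost _) rfl
  · refine Submodule.smul_mem _ _ (Submodule.sum_mem _ fun i _ => ?_)
    exact (HasCharge.deriv _ _ (HasCharge.neutral _)).normalOrd (HasCharge.neutral _) rfl

theorem hasParity_d0 : D.HasParity 1 B.d0 := B.fieldParity_d 0

theorem ad_d0_nprod (n : ℤ) {a b : D.Fld} (ha : IsField a) (hb : IsField b) :
    D.ad B.d0 (D.nprod n a b)
      = D.nprod n (D.ad B.d0 a) b + D.nprod n (fun m => D.par (a m)) (D.ad B.d0 b) := by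
  have h := ad_nprod B.hasParity_d0 n ha hb
  simp only [tw_one] at h
  exact h

theorem ad_d0_par {a : D.Fld} (h : D.ad B.d0 a = 0) : D.ad B.d0 (fun n => D.par (a n)) = 0 := by
  funext n
  have h1 : D.superComm B.d0 (a n) = 0 := congrFun h n
  have h2 : D.par B.d0 = sgn 1 • B.d0 := B.hasParity_d0
  have h3 := par_superComm B.d0 (a n)
  rw [h1, map_zero, h2, superComm_smul_left, sgn_one, neg_one_smul, eq_comm, neg_eq_zero] at h3
  exact h3

theorem nprod_mem_cycles (n : ℤ) {a b : D.Fld} (ha : a ∈ B.cycles) (hb : b ∈ B.cycles) :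
    D.nprod n a b ∈ B.cycles := by
  have ha' : D.HasCharge 0 a := ha.1
  have hb' : D.HasCharge 0 b := hb.1
  refine ⟨HasCharge.nprod 0 0 n a b ha' hb', ?_⟩
  change D.ad B.d0 _ = 0
  rw [B.ad_d0_nprod n ha'.isField hb'.isField, LinearMap.mem_ker.mp ha.2,
    LinearMap.mem_ker.mp hb.2, nprod_zero_left, nprod_zero_right, add_zero]

theorem nprod_mem_boundaries_left (n : ℤ) {a b : D.Fld} (ha : a ∈ B.boundaries)
    (hb : b ∈ B.cycles) : D.nprod n a b ∈ B.boundaries := by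
  obtain ⟨c, hc, rfl⟩ := ha
  have hc' : D.HasCharge 1 c := hc
  have hb' : D.HasCharge 0 b := hb.1
  refine ⟨D.nprod n c b, HasCharge.nprod 1 0 n c b hc' hb', ?_⟩
  rw [B.ad_d0_nprod n hc'.isField hb'.isField, LinearMap.mem_ker.mp hb.2, nprod_zero_right,
    add_zero]

/-- The Leibniz rule gives `(par a)_(n) [d_0, c]`; the sign is absorbed by starting from `par a`,
which is again a cycle. -/
theorem nprod_mem_boundaries_right (n : ℤ) {a b : D.Fld} (ha : a ∈ B.cycles)
    (hb : b ∈ B.boundaries) : D.nprod n a b ∈ B.boundaries := by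
  obtain ⟨c, hc, rfl⟩ := hb
  have hc' : D.HasCharge 1 c := hc
  have ha' : D.HasCharge 0 a := ha.1
  refine ⟨D.nprod n (fun m => D.par (a m)) c, HasCharge.nprod 0 1 n _ c ha'.par hc', ?_⟩
  rw [B.ad_d0_nprod n ha'.par.isField hc'.isField, B.ad_d0_par (LinearMap.mem_ker.mp ha.2),
    nprod_zero_left, zero_add]
  simp only [par_par]

/-- The `n`-th product of cycles. -/
def nprodCycles (n : ℤ) : B.cycles →ₗ[ℂ] B.cycles →ₗ[ℂ] B.cycles :=
  have hF : ∀ a : B.cycles, IsField (a : D.Fld) := fun a => HasCharge.isField (m := 0) a.2.1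
  LinearMap.mk₂ ℂ (fun a b => ⟨D.nprod n a b, B.nprod_mem_cycles n a.2 b.2⟩)
    (fun a a' b => Subtype.ext (nprod_add_left n (hF a) (hF a') (hF b)))
    (fun c a b => Subtype.ext (nprod_smul_left n c (a : D.Fld) (b : D.Fld)))
    (fun a b b' => Subtype.ext (nprod_add_right n (hF a) (hF b) (hF b')))
    (fun c a b => Subtype.ext (nprod_smul_right n c (a : D.Fld) (b : D.Fld)))

/-- The `n`-th product of the homology. -/
def nprodW (n : ℤ) : B.W →ₗ[ℂ] B.W →ₗ[ℂ] B.W :=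
  Submodule.liftQ _
    (LinearMap.flip (Submodule.liftQ _ (LinearMap.flip ((B.nprodCycles n).compr₂ B.cls))
      fun b hb => by
        rw [LinearMap.mem_ker]
        refine LinearMap.ext fun a => ?_
        exact (Submodule.Quotient.mk_eq_zero _).mpr (B.nprod_mem_boundaries_right n a.2 hb)))
    fun a ha => by
      rw [LinearMap.mem_ker]
      refine LinearMap.ext fun w => ?_
      obtain ⟨b, rfl⟩ := Submodule.mkQ_surjective _ w
      exact (Submodule.Quotient.mk_eq_zero _).mpr (B.nprod_mem_boundaries_left n ha b.2)

/-- The products `nprodW` are those induced by the `n`-th products of fields. -/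
theorem isInduced_nprodW : B.IsInduced B.nprodW := fun n a b =>
  ⟨B.nprod_mem_cycles n a.2 b.2, rfl⟩

end HomogeneousBasis

end ReductionData

end QuantumReduction

open QuantumReduction QuantumReduction.ReductionData in
theorem theorem2p3 {g : Type*} [AddCommGroup g] [Module ℂ g] [FiniteDimensional ℂ g]
    (D : QuantumReduction.ReductionData g)
    (hk : D.k + D.dualCoxeter ≠ 0)
    (hA3 : Set.BijOn (D.bracket D.f) (D.gr (1 / 2)) (D.gr (-1 / 2)))
    {ι : Type*} [Fintype ι] [DecidableEq ι] (B : D.HomogeneousBasis ι) :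
    (∀ n : ℤ, D.superComm B.d0 (B.L n) = 0) ∧
      D.IsLocal B.L B.L ∧
      ∃ hL : B.L ∈ B.cycles, ∃ P : ℤ → B.W →ₗ[ℂ] B.W →ₗ[ℂ] B.W, B.IsInduced P ∧
        QuantumReduction.IsEnergyMomentum P B.T B.vac (B.cls ⟨B.L, hL⟩) B.centralCharge := by
  have hLL := B.OPE_L_L hk hA3
  have hd := B.superComm_d0_L hk hA3
  have hL : B.L ∈ B.cycles := ⟨B.L_mem_chargePart, LinearMap.mem_ker.mpr (funext hd)⟩
  refine ⟨hd, hLL.isLocal, hL, B.nprodW, B.isInduced_nprodW, ?_⟩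
  have key : ∀ (n : ℤ) {c : D.Fld} (hc : c ∈ B.cycles), D.nprod n B.L B.L = c →
      B.nprodW n (B.cls ⟨B.L, hL⟩) (B.cls ⟨B.L, hL⟩) = B.cls ⟨c, hc⟩ := by
    rintro n c hc rfl
    rfl
  refine ⟨key 0 (B.deriv_mem_cycles hL) (nprod_zero_of_OPE hLL),
    key 1 (Submodule.smul_mem _ _ hL) (nprod_one_of_OPE hLL), ?_, ?_, fun n hn => ?_⟩
  · rw [key 2 (Submodule.zero_mem _) (nprod_two_of_OPE hLL)]
    exact map_zero B.cls
  · exact key 3 (Submodule.smul_mem _ _ B.one_mem_cycles) (nprod_three_of_OPE hLL)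
  · rw [key n (Submodule.zero_mem _) (nprod_eq_zero_of_OPE hLL hn)]
    exact map_zero B.cls
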